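/- **Setting.** Let $M$ be a closed (compact, Hausdorff, without boundary) smooth manifold of dimension $n\ge 1$. Let $\Gamma$ be a trivalent ribbon graph, i.e. a nonempty finite set $\mathrm{Flag}$ of flags with a permutation $\sigma$ all of whose cycles have length $3$ (the cycles are the vertices, with their cyclic orders) and an involution $\tau$ (its fixed points are the leaves, its orbits $\{x,\tau x\}$ of size two are the edges), such that each boundary component of the associated oriented ribbon surface, i.e. each cycle of $\sigma\tau$, contains a leaf. Fix an orientation of each edge. Write $k=|\mathrm{Vert}|$ for the number of vertices. Let $X_\Gamma=(M^2)^{\mathrm{Edge}}\times M^{\mathrm{Leaf}}\cong M^{\mathrm{Flag}}$, let $\Delta_{3\Gamma}\cong M^{\mathrm{Vert}}$ be the subset of $X_\Gamma$ corresponding to the maps $\mathrm{Flag}\to M$ that are constant at each vertex, let $\Delta_2^l\subset X_\Gamma$ be the locus where the two variables of the edge $l$ agree, and let $\Delta_{2\Gamma}=\bigcup_l\Delta_2^l$. For $J\subset\mathrm{Edge}$ put $\Delta_2^J=\bigcap_{j\in J}\Delta_2^j\setminus\bigcup_{l\notin J}\Delta_2^l$. Let $\widetilde M^2$ be the oriented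 real blow-up of the diagonal of $M^2$, whose boundary consists of the rays in $TM$ (the normal space of the diagonal at $(x,x)$ being identified with $T_xM$ by $(u,v)\mapsto v-u$), and let $\pi:\widetilde X_\Gamma=(\widetilde M^2)^{\mathrm{Edge}}\times M^{\mathrm{Leaf}}\to X_\Gamma$ be the blow-down map. $\widetilde X_\Gamma$ is a manifold with corners; its codimension $m$ stratum is the set of points over which exactly $m$ edges lie on the diagonal. Define $$\mathcal C_\Gamma=\overline{\pi^{-1}(\Delta_{3\Gamma}\setminus\Delta_{2\Gamma})}\subset\widetilde X_\Gamma,\qquad \mathcal C_J=\mathcal C_\Gamma\cap\pi^{-1}(\Delta_2^J).$$ Let $p_+$ be the map from $\widetilde X_\Gamma$ to the unoriented blow-up that replaces rays by lines. Put $$\mathcal C_2'=\bigcup_{\varnothing\ne I\subsetneq J}\mathcal C_J\cap\overline{\mathcal C_I},\qquad \mathcal C_\Gamma^{\rm sing}=\mathcal C_\Gamma\cap p_+^{-1}(p_+(\mathcal C_2')),\qquad \mathcal C_{J1}=\mathcal C_J\setminus\mathcal C_\Gamma^{\rm sing}\ (J\neq\varnothing),$$ $$\partial_1\mathcal C_\Gamma=\bigcup_{J\ne\varnothing}\mathcal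 C_{J1},\qquad \mathcal C_\Gamma^{\rm smooth}=\mathcal C_\varnothing\cup\partial_1\mathcal C_\Gamma.$$ **Theorem.** (a) $\mathcal C_\Gamma$ is compact and is the disjoint union $\mathcal C_\Gamma^{\rm smooth}\amalg\mathcal C_\Gamma^{\rm sing}$. Here $\mathcal C_\varnothing=\pi^{-1}(\Delta_{3\Gamma}\setminus\Delta_{2\Gamma})$. The set $\mathcal C_\Gamma^{\rm sing}$ is closed and of codimension at least $2$, i.e. it is covered by countably many smooth images of Euclidean spaces of dimension at most $nk-2$ (so it is empty if $nk<2$). $\mathcal C_\Gamma^{\rm smooth}$, with the subspace topology, is a smooth manifold with boundary of dimension $nk$ whose inclusion into $\widetilde X_\Gamma$ is a smooth immersion; its interior is $\mathcal C_\varnothing$ and its boundary is $\partial_1\mathcal C_\Gamma$. (b) $\partial_1\mathcal C_\Gamma$ is the disjoint union of the main faces $\partial_1^l\mathcal C_\Gamma=\partial_1\mathcal C_\Gamma\cap\pi^{-1}(\Delta_2^{\{l\}})$, $l\in\mathrm{Edge}$, and of the hidden part $\partial_1^{\rm hidden}\mathcal C_\Gamma=\coprod_{|J|\ge2}\mathcal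 C_{J1}$. (c) $\mathcal C_\varnothing$ is an embedded submanifold of dimension $nk$ of the interior of $\widetilde X_\Gamma$, and each connected component of $\partial_1\mathcal C_\Gamma$ is an embedded submanifold of dimension $nk-1$ contained in the codimension $m$ stratum of $\widetilde X_\Gamma$ for some $m>0$. For each $J\neq\varnothing$ the set $\mathcal C_{J1}$ is open and closed in $\partial_1\mathcal C_\Gamma$ and is an embedded submanifold of $\widetilde X_\Gamma$ of dimension $nk-1$; its image $\pi(\mathcal C_{J1})$ is an embedded submanifold of $X_\Gamma$ and $\pi:\mathcal C_{J1}\to\pi(\mathcal C_{J1})$ is a submersion. (d) For $J\subset\mathrm{Edge}$ let $\Gamma_J$ be the subgraph of $\Gamma$ formed by the edges in $J$ and their end points, and let $$\Delta'_J=\Bigl\{x\in(\mathbb R^n)^J\ \Big|\ \sum_{j\in J}c_jx_j=0\text{ for all simplicial }1\text{-cycles }c=\sum_{j\in J} c_j\,j\text{ of }\Gamma_J\Bigr\}.$$ Let $J\neq\varnothing$ and let $\varphi$ be a smooth chart of $M$ (with possibly disconnected domain). Let $y\in\widetilde X_\Gamma$ be a point with $\pi(y)\in\Delta_{3\Gamma}\cap\Delta_2^J$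 all of whose positions in $M$ lie in the domain of $\varphi$, and let $(l_j)_{j\in J}\in(S^{n-1})^J$ be its multiray in the coordinates given by $\varphi$. Then $y\in\mathcal C_{J1}$ if and only if there is a unique $x\in\Delta'_J$ with $\sum_{j\in J}\|x_j\|^2=1$ and $0\ne x_j\in l_j$ for all $j\in J$. (e) Let $J\neq\varnothing$, let $\varphi$ be a chart as in (d), let $y_0\in\mathcal C_{J1}$ have all its positions in the domain of $\varphi$, and let $a$ be a vertex of $\Gamma_J$. Then there is a diffeomorphism $\beta$ from an open neighbourhood of $(0,y_0)$ in $[0,\infty)\times\mathcal C_{J1}$ onto an open subset of $\mathcal C_\Gamma^{\rm smooth}$ with the following properties. One has $\beta(0,y)=y$. For $t>0$ the point $\beta(t,y)$ lies in $\mathcal C_\varnothing$; at the vertex $a$ and at all vertices not in $\Gamma_J$ it has the same positions in $M$ as $y$; and along each edge $j\in J$, from $b$ to $b'$, the difference (position at $b'$ minus position at $b$) in the coordinates given by $\varphi$ is $t\,x_j$, where $x$ is the unique solution for $y$ from (d). -/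

import Mathlib

open Set Topology
open scoped Manifold ContDiff

/-! ## Trivalent ribbon graphs, described by their flags -/

/-- A ribbon graph with finite set of flags `F`.  The permutation `next` sends a flag to the
following flag in the cyclic order at its vertex, so that the vertices are the cycles of `next`.
The involution `opp` exchanges the two flags of an edge and fixes the leaves.  The boundary
components of the thickened oriented surface are the cycles of `next * opp`; each of them is
required to contain a leaf, and there has to be at least one vertex. -/
structure RibbonGraph (F : Type*) [Finite F] where
  next : Equiv.Perm F
  opp : Equiv.Perm F
  opp_opp : ∀ x, opp (opp x) = x
  exists_flag : Nonempty F
  boundary_has_leaf : ∀ x, ∃ y, (next * opp).SameCycle x y ∧ opp y = y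

namespace RibbonGraph

variable {F : Type*} [Finite F] (Γ : RibbonGraph F)

/-- Every vertex has degree three: every cycle of `next` has length three. -/
def IsTrivalent : Prop := ∀ x, Γ.next x ≠ x ∧ Γ.next (Γ.next (Γ.next x)) = x

/-- The vertices: cycles of `next`. -/
def Vert : Type _ := Quotient (Equiv.Perm.SameCycle.setoid Γ.next)

/-- The vertex of a flag. -/
def vert (x : F) : Γ.Vert := Quotient.mk (Equiv.Perm.SameCycle.setoid Γ.next) x

/-- The edges: unordered pairs `{x, opp x}` of distinct flags. -/
def Edge : Type _ := {s : Set F // ∃ x, Γ.opp x ≠ x ∧ s = {x, Γ.opp x}}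

/-- The leaves: the flags fixed by `opp`. -/
def Leaf : Type _ := {x : F // Γ.opp x = x}

instance : Finite Γ.Vert := Quotient.finite _
instance : Finite Γ.Edge := Subtype.finite
instance : Finite Γ.Leaf := Subtype.finite
instance : Nonempty Γ.Vert := Γ.exists_flag.map Γ.vert
noncomputable instance : Fintype Γ.Edge := Fintype.ofFinite _
noncomputable instance : Fintype Γ.Leaf := Fintype.ofFinite _

/-- An orientation of every edge: the choice of a first flag. -/
structure EdgeOrientation where
  out : Γ.Edge → F
  out_mem : ∀ l, out l ∈ l.1

variable {Γ}

/-- The initial vertex of an oriented edge. -/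
def EdgeOrientation.tail (o : Γ.EdgeOrientation) (l : Γ.Edge) : Γ.Vert := Γ.vert (o.out l)

/-- The final vertex of an oriented edge. -/
def EdgeOrientation.head (o : Γ.EdgeOrientation) (l : Γ.Edge) : Γ.Vert := Γ.vert (Γ.opp (o.out l))

/-- Integral simplicial 1-cycles of the subgraph `Γ_J` formed by the edges in `J`
and their end points. -/
def EdgeOrientation.IsCycle (o : Γ.EdgeOrientation) (J : Finset Γ.Edge) (c : J → ℤ) : Prop :=
  open Classical in
  ∀ v : Γ.Vert, ∑ j : J, c j * ((if o.head j.1 = v then 1 else 0) -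
    (if o.tail j.1 = v then 1 else 0)) = 0

/-- The linear space of all `x ∈ (ℝⁿ)^J` that satisfy the equation `∑ j, c j • x j = 0` for every
1-cycle `c` of `Γ_J`; it suffices to ask this for the members of a basis of `H₁(Γ_J)`. -/
def EdgeOrientation.cycleSpace (o : Γ.EdgeOrientation) (n : ℕ) (J : Finset Γ.Edge) :
    Set (J → EuclideanSpace ℝ (Fin n)) :=
  {x | ∀ c : J → ℤ, o.IsCycle J c → ∑ j, c j • x j = 0}

/-- The vertices of the subgraph `Γ_J`. -/
def EdgeOrientation.vertOf (o : Γ.EdgeOrientation) (J : Finset Γ.Edge) : Set Γ.Vert :=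
  {v | ∃ j ∈ J, v = o.tail j ∨ v = o.head j}

end RibbonGraph

/-! ## The oriented real blow-up of the diagonal in `M × M` -/

section Blowup

variable (n : ℕ) (M : Type*) [TopologicalSpace M] [ChartedSpace (EuclideanSpace ℝ (Fin n)) M]

/-- The oriented real blow-up of the diagonal of `M × M`, as a set: the pairs of distinct points,
together with the rays in the normal spaces `T(M × M) / TΔ` of the diagonal.  The normal space at
`(x, x)` is identified with `T_x M` by `(u, v) ↦ v - u`. -/
def DiagBlowup : Type _ :=
  {q : M × M // q.1 ≠ q.2} ⊕ (Σ x : M, Module.Ray ℝ (TangentSpace (𝓡 n) x))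

/-- The unoriented real blow-up of the diagonal of `M × M`, as a set: rays are replaced by lines. -/
def DiagBlowupUnoriented : Type _ :=
  {q : M × M // q.1 ≠ q.2} ⊕ (Σ x : M, Projectivization ℝ (TangentSpace (𝓡 n) x))

variable {n M}

/-- The blow-down map to `M × M`. -/
def DiagBlowup.blowdown : DiagBlowup n M → M × M
  | Sum.inl q => q.1
  | Sum.inr r => (r.1, r.1)

/-- The projection to the unoriented blow-up. -/
noncomputable def DiagBlowup.unorient : DiagBlowup n M → DiagBlowupUnoriented n M
  | Sum.inl q => Sum.inl q
  | Sum.inr r => Sum.inr ⟨r.1, Projectivization.mk ℝ r.2.someVector r.2.someVector_ne_zero⟩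

/-- Polar coordinates on the blow-up associated with a chart `φ` of `M`: a pair `(x, y)` of
distinct points has coordinates `(φ x, u / ‖u‖, ‖u‖)` with `u = φ y - φ x`, and the ray through
`v ∈ T_x M` has coordinates `(φ x, w / ‖w‖, 0)` with `w = dφ_x v` (for any `v` on the ray).
They identify the part of the blow-up over `φ.source × φ.source` with a relatively open subset of
`{(a, θ, r) | ‖θ‖ = 1, 0 ≤ r}`. -/
noncomputable def DiagBlowup.polar (φ : OpenPartialHomeomorph M (EuclideanSpace ℝ (Fin n))) :
    DiagBlowup n M → EuclideanSpace ℝ (Fin n) × EuclideanSpace ℝ (Fin n) × ℝ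
  | Sum.inl q => (φ q.1.1, ‖φ q.1.2 - φ q.1.1‖⁻¹ • (φ q.1.2 - φ q.1.1), ‖φ q.1.2 - φ q.1.1‖)
  | Sum.inr r =>
      let w : EuclideanSpace ℝ (Fin n) :=
        mfderiv (𝓡 n) 𝓘(ℝ, EuclideanSpace ℝ (Fin n)) φ r.1 r.2.someVector
      (φ r.1, ‖w‖⁻¹ • w, 0)

/-- The topology of the blow-up: it is generated by the preimages of the open sets of `M × M` and
the coordinate neighbourhoods of all polar coordinate systems. -/
instance : TopologicalSpace (DiagBlowup n M) :=
  TopologicalSpace.generateFrom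
    ({s | ∃ O : Set (M × M), IsOpen O ∧ s = DiagBlowup.blowdown ⁻¹' O} ∪
     {s | ∃ φ ∈ IsManifold.maximalAtlas (𝓡 n) ∞ M,
        ∃ V : Set (EuclideanSpace ℝ (Fin n) × EuclideanSpace ℝ (Fin n) × ℝ), IsOpen V ∧
        s = {z | DiagBlowup.blowdown z ∈ φ.source ×ˢ φ.source ∧ DiagBlowup.polar φ z ∈ V}})

end Blowup

/-! ## Smooth maps, submanifolds and codimension, in terms of a system of charts -/

/-- Coordinates on a space `Y`, one system for every chart of `M`, with values in a normed
space `Z`; they identify `dom φ` with (an embedded submanifold with boundary and corners of) `Z`. -/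
structure ChartSystem (n : ℕ) (M Y Z : Type*) [TopologicalSpace M] where
  dom : OpenPartialHomeomorph M (EuclideanSpace ℝ (Fin n)) → Set Y
  chart : OpenPartialHomeomorph M (EuclideanSpace ℝ (Fin n)) → Y → Z

namespace ChartSystem

variable {n : ℕ} {M Y Z : Type*} [TopologicalSpace M] [ChartedSpace (EuclideanSpace ℝ (Fin n)) M]
  [TopologicalSpace Y] [NormedAddCommGroup Z] [NormedSpace ℝ Z] (S : ChartSystem n M Y Z)
  {V H N : Type*} [NormedAddCommGroup V] [NormedSpace ℝ V] [TopologicalSpace H]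
  [TopologicalSpace N] [ChartedSpace H N]

/-- Smooth maps from a manifold (with boundary) `N` to `Y`. -/
def Smooth (I : ModelWithCorners ℝ V H) (f : N → Y) : Prop :=
  Continuous f ∧ ∀ φ ∈ IsManifold.maximalAtlas (𝓡 n) ∞ M,
    ContMDiffOn I 𝓘(ℝ, Z) ∞ (S.chart φ ∘ f) (f ⁻¹' S.dom φ)

/-- Smooth immersions from a manifold (with boundary) `N` to `Y`. -/
def Immersion (I : ModelWithCorners ℝ V H) (f : N → Y) : Prop :=
  S.Smooth I f ∧ ∀ φ ∈ IsManifold.maximalAtlas (𝓡 n) ∞ M, ∀ p, f p ∈ S.dom φ →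
    Function.Injective (mfderiv I 𝓘(ℝ, Z) (S.chart φ ∘ f) p)

/-- `A` is an embedded smooth submanifold (without boundary) of `Y` of dimension `d`: with the
subspace topology it carries a smooth structure for which the inclusion is an immersion. -/
def IsSubmanifold (A : Set Y) (d : ℕ) : Prop :=
  ∃ _ : ChartedSpace (EuclideanSpace ℝ (Fin d)) A,
    IsManifold (𝓡 d) ∞ A ∧ S.Immersion (𝓡 d) (Subtype.val : A → Y)

/-- `A` has codimension at least `c` relative to dimension `d`: it is covered by countably many
smooth images of Euclidean spaces of dimension at most `d - c`. (If `d < c`, this says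
that `A` is empty.) -/
def CodimAtLeast (A : Set Y) (d c : ℕ) : Prop :=
  ∃ T : Set (Σ m : ℕ, EuclideanSpace ℝ (Fin m) → Y), T.Countable ∧
    (∀ s ∈ T, s.1 + c ≤ d ∧ S.Smooth (𝓡 s.1) s.2) ∧ A ⊆ ⋃ s ∈ T, range s.2

end ChartSystem

/-! ## The configuration space of a trivalent ribbon graph -/

namespace RibbonGraph

variable {F : Type*} [Finite F] {Γ : RibbonGraph F} (o : Γ.EdgeOrientation)
  (n : ℕ) (M : Type*) [TopologicalSpace M] [ChartedSpace (EuclideanSpace ℝ (Fin n)) M]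

variable (Γ) in
/-- The space `X_Γ = (M²)^e × M^s`. -/
abbrev X : Type _ := (Γ.Edge → M × M) × (Γ.Leaf → M)

variable (Γ) in
/-- The blow-up of `X_Γ` along the edge diagonals. -/
abbrev Xtilde : Type _ := (Γ.Edge → DiagBlowup n M) × (Γ.Leaf → M)

variable (Γ) in
/-- The number `n |Vert(Γ)|`, the dimension of the configuration space. -/
noncomputable def confDim : ℕ := n * Nat.card Γ.Vert

instance [NeZero n] : NeZero (Γ.confDim n) := inferInstanceAs (NeZero (n * Nat.card Γ.Vert))

variable {n M}

/-- The blow-down map. -/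
def blowdown (y : Γ.Xtilde n M) : Γ.X M := (fun l => (y.1 l).blowdown, y.2)

/-- The map to the unoriented blow-up. -/
noncomputable def unorient (y : Γ.Xtilde n M) :
    (Γ.Edge → DiagBlowupUnoriented n M) × (Γ.Leaf → M) :=
  (fun l => (y.1 l).unorient, y.2)

/-- The reordering map from `M^Flag` to `X_Γ`. -/
def EdgeOrientation.reorder (f : F → M) : Γ.X M :=
  (fun l => (f (o.out l), f (Γ.opp (o.out l))), fun x => f x.1)

variable (n M)

variable (Γ) in
/-- The vertex diagonal in `M^Flag`: the families that are constant at each vertex. -/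
def vertexDiagonal : Set (F → M) := {f | ∃ p : Γ.Vert → M, f = p ∘ Γ.vert}

/-- The vertex diagonal as a subset of `X_Γ`. -/
def EdgeOrientation.vertexDiagonal : Set (Γ.X M) := o.reorder '' Γ.vertexDiagonal M

variable (Γ) in
/-- The union of all edge diagonals. -/
def edgeDiagonal : Set (Γ.X M) := ⋃ l : Γ.Edge, {x | (x.1 l).1 = (x.1 l).2}

/-- The locus in `X_Γ` where the two variables along an edge `l` agree precisely if `l ∈ J`. -/
def edgeStratum (J : Finset Γ.Edge) : Set (Γ.X M) :=
  {x | ∀ l, (x.1 l).1 = (x.1 l).2 ↔ l ∈ J}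

/-- The configuration space `C_Γ`: the proper transform of the vertex diagonal. -/
def EdgeOrientation.conf : Set (Γ.Xtilde n M) :=
  closure (blowdown ⁻¹' (o.vertexDiagonal M \ Γ.edgeDiagonal M))

/-- The stratum `C_J`. -/
def EdgeOrientation.stratum (J : Finset Γ.Edge) : Set (Γ.Xtilde n M) :=
  o.conf n M ∩ blowdown ⁻¹' edgeStratum M J

/-- The union of the sets `C_J ∩ closure C_I` over all nonempty proper subsets `I` of sets `J`. -/
def EdgeOrientation.sing' : Set (Γ.Xtilde n M) :=
  ⋃ (J : Finset Γ.Edge) (I : Finset Γ.Edge) (_ : I.Nonempty) (_ : I ⊂ J),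
    o.stratum n M J ∩ closure (o.stratum n M I)

/-- The singular part of `C_Γ`: the saturation of `sing'` in `C_Γ` with respect to the projection
to the unoriented blow-up. -/
def EdgeOrientation.sing : Set (Γ.Xtilde n M) :=
  o.conf n M ∩ unorient ⁻¹' (unorient '' o.sing' n M)

/-- The smooth part `C_{J1}` of the stratum `C_J` (for `J` nonempty). -/
def EdgeOrientation.smoothStratum (J : Finset Γ.Edge) : Set (Γ.Xtilde n M) :=
  o.stratum n M J \ o.sing n M

/-- The smooth codimension 1 boundary. -/
def EdgeOrientation.boundary1 : Set (Γ.Xtilde n M) :=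
  ⋃ (J : Finset Γ.Edge) (_ : J.Nonempty), o.smoothStratum n M J

/-- The smooth part of `C_Γ`: the union of the open stratum and the codimension 1 boundary. -/
def EdgeOrientation.smoothPart : Set (Γ.Xtilde n M) :=
  o.stratum n M ∅ ∪ o.boundary1 n M

/-- The main face of an edge. -/
def EdgeOrientation.mainFace (l : Γ.Edge) : Set (Γ.Xtilde n M) :=
  o.boundary1 n M ∩ blowdown ⁻¹' edgeStratum M {l}

/-- The hidden part of the boundary. -/
def EdgeOrientation.hiddenBoundary : Set (Γ.Xtilde n M) :=
  ⋃ (J : Finset Γ.Edge) (_ : 2 ≤ J.card), o.smoothStratum n M J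

variable (Γ) in
/-- The codimension `m` stratum of the manifold with corners `(Bl M²)^e × M^s`. -/
def cornerStratum (m : ℕ) : Set (Γ.Xtilde n M) :=
  {y | Nat.card {l : Γ.Edge // (y.1 l).blowdown.1 = (y.1 l).blowdown.2} = m}

variable (Γ) in
/-- Coordinates on `X_Γ`: a chart `φ` of `M` is applied to all components.  As every finite
set of points of a Hausdorff manifold of positive dimension lies in the (possibly disconnected)
domain of a single chart of the maximal atlas, these coordinate domains cover `X_Γ`. -/
def baseCharts : ChartSystem n M (Γ.X M)
    ((Γ.Edge → EuclideanSpace ℝ (Fin n) × EuclideanSpace ℝ (Fin n)) ×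
      (Γ.Leaf → EuclideanSpace ℝ (Fin n))) where
  dom φ := {x | (∀ l, x.1 l ∈ φ.source ×ˢ φ.source) ∧ ∀ s, x.2 s ∈ φ.source}
  chart φ x := (fun l => (φ (x.1 l).1, φ (x.1 l).2), fun s => φ (x.2 s))

variable (Γ) in
/-- Coordinates on the blow-up of `X_Γ`: polar coordinates in the factors for the edges and the
given chart in the factors for the leaves. -/
noncomputable def blowupCharts : ChartSystem n M (Γ.Xtilde n M)
    ((Γ.Edge → EuclideanSpace ℝ (Fin n) × EuclideanSpace ℝ (Fin n) × ℝ) ×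
      (Γ.Leaf → EuclideanSpace ℝ (Fin n))) where
  dom φ := blowdown ⁻¹' (Γ.baseCharts n M).dom φ
  chart φ y := (fun l => (y.1 l).polar φ, fun s => φ (y.2 s))

variable {n M}

/-- For a point `y` over the locus where the edges in `J` are collapsed, with multiray
`(l_j)_{j ∈ J}` in the coordinates given by `φ`: `x` is a solution of the cycle equations
with `∑ ‖x_j‖² = 1` and `0 ≠ x_j ∈ l_j` for all `j ∈ J`. -/
def EdgeOrientation.IsSolution (φ : OpenPartialHomeomorph M (EuclideanSpace ℝ (Fin n)))
    (J : Finset Γ.Edge) (y : Γ.Xtilde n M) (x : J → EuclideanSpace ℝ (Fin n)) : Prop :=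
  x ∈ o.cycleSpace n J ∧ ∑ j, ‖x j‖ ^ 2 = 1 ∧
    ∀ j : J, x j ≠ 0 ∧ ∃ c : ℝ, 0 < c ∧ x j = c • ((y.1 j.1).polar φ).2.1

/-- The description of the boundary chart `(t, y) ↦ b` near `C_{J1}` in the coordinates given
by `φ` and a base vertex `a` of `Γ_J`: for `t = 0` it is the identity; for `t > 0` the point `b`
lies in the open stratum, the positions of the vertex `a` and of all vertices outside `Γ_J`
are the same as for `y`, and the differences of the positions along the edges `j ∈ J` are `t x_j`,
where `x` is the solution for `y`. -/
def EdgeOrientation.IsBoundaryChartValue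
    (φ : OpenPartialHomeomorph M (EuclideanSpace ℝ (Fin n)))
    (J : Finset Γ.Edge) (a : Γ.Vert) (t : ℝ) (y b : Γ.Xtilde n M) : Prop :=
  y ∈ (Γ.blowupCharts n M).dom φ ∧ b ∈ (Γ.blowupCharts n M).dom φ ∧
  (t = 0 → b = y) ∧
  (0 < t → b ∈ o.stratum n M ∅ ∧
    ∀ p q : Γ.Vert → M, blowdown y = o.reorder (p ∘ Γ.vert) →
      blowdown b = o.reorder (q ∘ Γ.vert) →
      (∀ v, v = a ∨ v ∉ o.vertOf J → q v = p v) ∧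
      ∀ x, o.IsSolution φ J y x →
        ∀ j : J, φ (q (o.head j.1)) - φ (q (o.tail j.1)) = t • x j)

end RibbonGraph

/-!
The theorem is a statement about linear systems with parameters, once the points of the blow-up are
written in polar coordinates.

*Local description.* Finitely many points of `M` lie in the domain of one chart `φ`, possibly with
disconnected domain. In its polar coordinates, a point over the vertex diagonal at which precisely
the edges in `J` are collapsed is given by the positions `u` of the vertices, with `δ u = 0` on `J`,
and by a multiray `θ`. Here `δ` (`coboundary`) takes the differences of a potential along the edges
in `J`; its image consists of the vectors that are orthogonal to the cycles of `Γ_J`. A solution on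
`θ` is a vector `(c_j θ_j)` in this image. The point lies in the configuration space if and only if
`θ` is a limit of multirays that contain a solution with positive `c` (`mem_conf_iff`). Coordinate
changes of the blow-up are smooth by Hadamard's lemma (`exists_polar_change`), and the blow-up is
compact because unit spheres are (`DiagBlowup.compactSpace`).

*Smooth points.* Let `I` be a nonempty proper subset of `J`. A nonzero solution with nonnegative `c`
and zero set `I` is the velocity of a path from the given point into the stratum of `I`
(`exists_path`, `mem_closure_stratum`). Conversely, at a limit of points of that stratum, the
normalized distances along the edges converge to a nonzero nonnegative solution that vanishes on `I`
(`direction_mem_degenerateSet`). A positive solution that is not unique up to scaling can be moved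
along another solution until a component vanishes (`exists_degenerate_of_not_isRigid`). The points
of a stratum outside the singular part are therefore those whose multiray is rigid: it has a positive
solution, and any other solution, of whatever signs, is a multiple of it (`mem_smoothStratum_iff`).
Since signs do not matter here, replacing rays by lines in the definition of the singular part does
not remove rigid multirays. Rigidity is equivalent to the uniqueness of the normalized positive
solution (`existsUnique_isSolution_iff`).

*Collars.* Near a rigid multiray the solution, normalized by a linear functional, solves a linear
system of maximal rank, so it extends to a smooth function of all nearby multirays
(`IsRigid.exists_contDiffAt_solution`). Conversely, every potential `u` with `δ u` near a positive
solution provides a multiray. Hence the smooth part has collar coordinates `(t, h)` near a boundary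
point: `h` is a potential subject to one linear normalization, which determines the multiray by `δ h`
and also the base point, and the edges in `J` have the differences `t` times the normalized solution
(`exists_collarChart`). These are charts of a manifold with boundary, and they express the
diffeomorphism of the collar as the identity (`exists_partialDiffeomorph`). On a stratum the multiray
and the base point vary independently, which makes the blow-down map a submersion
(`exists_chartedSpace_image`).

*Codimension.* Every limit multiray `θ` contains a nonzero solution with nonnegative `c`. If `I` is
its zero set, then `θ` is determined by its restriction to `I`, which is again a limit multiray, and
by the solution up to scaling, which lies in the space of differences vanishing on `I`
(`smoothlyCovered_faceSet`). Induction on `J` shows that the limit multirays, together with the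
positions with `J` collapsed, have codimension one. If `θ` is not rigid, `I` can be chosen nonempty,
and the restriction to `I` costs a second dimension (`codimAtLeast_sing`).
-/

/-! ### Difference quotients of smooth maps -/

section Hadamard

variable {E G : Type*} [NormedAddCommGroup E] [NormedSpace ℝ E] [NormedAddCommGroup G]
  [NormedSpace ℝ G]

/-- Integrals over `[0, 1]` of a function depending smoothly on a parameter are smooth.
The integral is a convolution with the indicator function of `[0, 1]`, evaluated at `0`. -/
theorem contDiffOn_setIntegral_unitInterval [CompleteSpace G] {S : Set E} (hS : IsOpen S)
    {f : E → ℝ → G} (hf : ∀ p ∈ S, ∀ t : ℝ, |t| < 3 → ContDiffAt ℝ ∞ (Function.uncurry f) (p, t)) :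
    ContDiffOn ℝ ∞ (fun p => ∫ t in Icc (0 : ℝ) 1, f p t) S := by
  classical
  -- A cutoff makes the integrand compactly supported; it is `1` on `[-1, 0]`, where the
  -- convolution at `0` evaluates it.
  let χ : ContDiffBump (0 : ℝ) := ⟨1, 2, one_pos, one_lt_two⟩
  let g : E → ℝ → G := fun p s => χ s • f p (-s)
  have hg : ContDiffOn ℝ ∞ (Function.uncurry g) (S ×ˢ univ) := by
    rintro ⟨p, s⟩ ⟨hp, -⟩
    apply ContDiffAt.contDiffWithinAt
    by_cases hs : |s| < 3
    · have h1 : ContDiffAt ℝ ∞ (fun q : E × ℝ => χ q.2) (p, s) :=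
        (χ.contDiff (n := ⊤)).contDiffAt.comp _ contDiffAt_snd
      have h2 : ContDiffAt ℝ ∞ (fun q : E × ℝ => Function.uncurry f (q.1, -q.2)) (p, s) :=
        ContDiffAt.comp (p, s) (hf p hp (-s) (by rwa [abs_neg]))
          (contDiffAt_fst.prodMk contDiffAt_snd.neg)
      exact h1.smul h2
    · have : Function.uncurry g =ᶠ[𝓝 (p, s)] fun _ => 0 := by
        have ho : IsOpen {q : E × ℝ | 2 < |q.2|} :=
          isOpen_lt continuous_const (continuous_abs.comp continuous_snd)
        filter_upwards [ho.mem_nhds (show (2 : ℝ) < |s| by linarith)] with q hq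
        have : χ q.2 = 0 := χ.zero_of_le_dist (by simpa [Real.dist_eq] using le_of_lt hq)
        simp [Function.uncurry, g, this]
      exact contDiffAt_const.congr_of_eventuallyEq this
  have hconv := MeasureTheory.contDiffOn_convolution_right_with_param (𝕜 := ℝ) (n := ⊤)
    (μ := (MeasureTheory.volume : MeasureTheory.Measure ℝ))
    (f := (Icc (0 : ℝ) 1).indicator fun _ => (1 : ℝ))
    (ContinuousLinearMap.lsmul ℝ ℝ : ℝ →L[ℝ] G →L[ℝ] G) (g := g) hS
    (isCompact_closedBall (0 : ℝ) 2) (fun p x _ hx => by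
      have : χ x = 0 := χ.zero_of_le_dist (by
        simp only [Metric.mem_closedBall, not_le] at hx; exact hx.le)
      simp [g, this])
    (MeasureTheory.Integrable.locallyIntegrable
      ((MeasureTheory.integrable_indicator_iff measurableSet_Icc).2 (by simp)))
    hg
  have h0 := hconv.comp (contDiffOn_id.prodMk (contDiffOn_const (c := (0 : ℝ))))
    (s := S) (fun p hp => ⟨hp, mem_univ _⟩)
  refine h0.congr fun p _ => ?_
  simp only [Function.comp_def, MeasureTheory.convolution, zero_sub]
  rw [← MeasureTheory.integral_indicator measurableSet_Icc]
  refine MeasureTheory.integral_congr_ae (Filter.Eventually.of_forall fun t => ?_)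
  by_cases ht : t ∈ Icc (0 : ℝ) 1
  · have : χ (-t) = 1 := χ.one_of_mem_closedBall (by
      simp only [Metric.mem_closedBall, Real.dist_eq, sub_zero, abs_neg]
      rw [abs_of_nonneg ht.1]; exact ht.2)
    simp [ht, g, this]
  · simp [ht]

/-- Hadamard's lemma: `ψ (a + r v) - ψ a` is `r` times a smooth function of `(a, v, r)`. -/
theorem exists_contDiffAt_slope [CompleteSpace G] {Ω : Set E} (hΩ : IsOpen Ω) {ψ : E → G}
    (hψ : ContDiffOn ℝ ∞ ψ Ω) {a₀ : E} (ha₀ : a₀ ∈ Ω) (v₀ : E) :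
    ∃ g : E × E × ℝ → G, ContDiffAt ℝ ∞ g (a₀, v₀, 0) ∧
      ∀ᶠ p in 𝓝 ((a₀, v₀, 0) : E × E × ℝ),
        ψ (p.1 + p.2.2 • p.2.1) - ψ p.1 = p.2.2 • g p ∧
        (p.2.2 = 0 → g p = fderiv ℝ ψ p.1 p.2.1) := by
  obtain ⟨ε, hε, hball⟩ := Metric.isOpen_iff.1 hΩ a₀ ha₀
  -- On `S` the segments `a + t r v` with `|t| < 3` stay in the ball: `ε / 2 + 3 ε / 8 < ε`.
  let S : Set (E × E × ℝ) := {p | ‖p.1 - a₀‖ < ε / 2 ∧ |p.2.2| * ‖p.2.1‖ < ε / 8}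
  have hS : IsOpen S :=
    (isOpen_lt (f := fun p : E × E × ℝ => ‖p.1 - a₀‖) (by fun_prop) continuous_const).inter
      (isOpen_lt (f := fun p : E × E × ℝ => |p.2.2| * ‖p.2.1‖) (by fun_prop) continuous_const)
  have hmem : ∀ p ∈ S, ∀ t : ℝ, |t| < 3 → p.1 + (t * p.2.2) • p.2.1 ∈ Ω := by
    intro p hp t ht
    apply hball
    rw [Metric.mem_ball, dist_eq_norm]
    have h1 : ‖(t * p.2.2) • p.2.1‖ ≤ 3 * (ε / 8) := by
      rw [norm_smul, Real.norm_eq_abs, abs_mul, mul_assoc]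
      exact mul_le_mul ht.le hp.2.le (by positivity) (by norm_num)
    calc ‖p.1 + (t * p.2.2) • p.2.1 - a₀‖ = ‖(p.1 - a₀) + (t * p.2.2) • p.2.1‖ := by
          congr 1; abel
      _ ≤ ‖p.1 - a₀‖ + ‖(t * p.2.2) • p.2.1‖ := norm_add_le _ _
      _ < ε := by linarith [hp.1]
  have hdψ : ContDiffOn ℝ ∞ (fderiv ℝ ψ) Ω := hψ.fderiv_of_isOpen hΩ (by simp)
  let f : E × E × ℝ → ℝ → G := fun p t => fderiv ℝ ψ (p.1 + (t * p.2.2) • p.2.1) p.2.1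
  have hf : ∀ p ∈ S, ∀ t : ℝ, |t| < 3 → ContDiffAt ℝ ∞ (Function.uncurry f) (p, t) := by
    intro p hp t ht
    have h1 : ContDiffAt ℝ ∞ (fderiv ℝ ψ) (p.1 + (t * p.2.2) • p.2.1) :=
      hdψ.contDiffAt (hΩ.mem_nhds (hmem p hp t ht))
    have h2 : ContDiffAt ℝ ∞ (fun q : (E × E × ℝ) × ℝ =>
        q.1.1 + (q.2 * q.1.2.2) • q.1.2.1) (p, t) := by
      apply ContDiff.contDiffAt; fun_prop
    have h3 : ContDiffAt ℝ ∞ (fun q : (E × E × ℝ) × ℝ => q.1.2.1) (p, t) := by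
      apply ContDiff.contDiffAt; fun_prop
    exact (ContDiffAt.comp (p, t) h1 h2).clm_apply h3
  have hG := contDiffOn_setIntegral_unitInterval hS hf
  have hp₀ : ((a₀, v₀, 0) : E × E × ℝ) ∈ S := by
    simp only [S, mem_ofPred_eq, sub_self, norm_zero, abs_zero, zero_mul]
    constructor <;> positivity
  refine ⟨fun p => ∫ t in Icc (0 : ℝ) 1, f p t, hG.contDiffAt (hS.mem_nhds hp₀), ?_⟩
  filter_upwards [hS.mem_nhds hp₀] with p hp
  have h01 : ∀ t ∈ Icc (0 : ℝ) 1, |t| < 3 := fun t ht => by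
    rw [abs_of_nonneg ht.1]; linarith [ht.2]
  refine ⟨?_, fun h0 => ?_⟩
  · have hderiv : ∀ t ∈ uIcc (0 : ℝ) 1,
        HasDerivAt (fun t : ℝ => ψ (p.1 + (t * p.2.2) • p.2.1)) (p.2.2 • f p t) t := by
      intro t ht
      rw [uIcc_of_le zero_le_one] at ht
      have hd : HasFDerivAt ψ (fderiv ℝ ψ (p.1 + (t * p.2.2) • p.2.1))
          (p.1 + (t * p.2.2) • p.2.1) :=
        ((hψ.contDiffAt (hΩ.mem_nhds (hmem p hp t (h01 t ht)))).differentiableAt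
          (by simp)).hasFDerivAt
      have hl : HasDerivAt (fun t : ℝ => p.1 + (t * p.2.2) • p.2.1) (p.2.2 • p.2.1) t := by
        simpa using (((hasDerivAt_id t).mul_const p.2.2).smul_const p.2.1).const_add p.1
      simpa [f, Function.comp_def] using hd.comp_hasDerivAt t hl
    have hcont : ContinuousOn (fun t => p.2.2 • f p t) (uIcc (0 : ℝ) 1) := by
      rw [uIcc_of_le zero_le_one]
      intro t ht
      have : ContinuousAt (Function.uncurry f ∘ fun t : ℝ => (p, t)) t :=
        ContinuousAt.comp (hf p hp t (h01 t ht)).continuousAt (by fun_prop)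
      exact (this.const_smul p.2.2).continuousWithinAt
    have := intervalIntegral.integral_eq_sub_of_hasDerivAt hderiv hcont.intervalIntegrable
    rw [intervalIntegral.integral_smul, intervalIntegral.integral_of_le zero_le_one,
      ← MeasureTheory.integral_Icc_eq_integral_Ioc] at this
    simpa using this.symm
  · simp [f, h0]

end Hadamard

/-! ### Sets covered by countably many smooth images of Euclidean spaces -/

section SmoothlyCovered

variable {W W' : Type*} [NormedAddCommGroup W] [NormedSpace ℝ W]
  [NormedAddCommGroup W'] [NormedSpace ℝ W']

/-- The set `A` is covered by countably many smooth images of Euclidean spaces of dimension at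
most `d - c` (so it is empty if `d < c`). -/
def SmoothlyCovered (A : Set W) (d c : ℕ) : Prop :=
  ∃ T : Set (Σ m : ℕ, EuclideanSpace ℝ (Fin m) → W), T.Countable ∧
    (∀ s ∈ T, s.1 + c ≤ d ∧ ContDiff ℝ ∞ s.2) ∧ A ⊆ ⋃ s ∈ T, range s.2

/-- An open subset of a Euclidean space is a countable union of balls, and balls are smooth images
of the whole space. -/
theorem exists_countable_cover_of_isOpen {m : ℕ} {U : Set (EuclideanSpace ℝ (Fin m))}
    (hU : IsOpen U) :
    ∃ T : Set (EuclideanSpace ℝ (Fin m) → EuclideanSpace ℝ (Fin m)), T.Countable ∧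
      (∀ g ∈ T, ContDiff ℝ ∞ g ∧ range g ⊆ U) ∧ U ⊆ ⋃ g ∈ T, range g := by
  have h : ∀ x ∈ U, ∃ ε > 0, Metric.ball x ε ⊆ U := Metric.isOpen_iff.1 hU
  choose! ε hε hball using h
  obtain ⟨t, htU, htc, hcov⟩ := TopologicalSpace.countable_cover_nhdsWithin
    (s := U) (f := fun x => Metric.ball x (ε x))
    (fun x hx => mem_nhdsWithin_of_mem_nhds (Metric.ball_mem_nhds x (hε x hx)))
  have hrange : ∀ x ∈ U, range (OpenPartialHomeomorph.univBall x (ε x)) = Metric.ball x (ε x) := by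
    intro x hx
    rw [← image_univ, ← OpenPartialHomeomorph.univBall_source x (ε x),
      OpenPartialHomeomorph.image_source_eq_target,
      OpenPartialHomeomorph.univBall_target _ (hε x hx)]
  refine ⟨(fun x => ⇑(OpenPartialHomeomorph.univBall x (ε x))) '' t, htc.image _, ?_, ?_⟩
  · rintro _ ⟨x, hx, rfl⟩
    exact ⟨OpenPartialHomeomorph.contDiff_univBall, (hrange x (htU hx)).trans_subset
      (hball x (htU hx))⟩
  · intro y hy
    obtain ⟨x, hx, hyx⟩ := mem_iUnion₂.1 (hcov hy)
    exact mem_iUnion₂.2 ⟨_, mem_image_of_mem _ hx, (hrange x (htU hx)).symm ▸ hyx⟩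

namespace SmoothlyCovered

variable {A B : Set W} {d c : ℕ}

theorem mono (h : SmoothlyCovered B d c) (hAB : A ⊆ B) : SmoothlyCovered A d c := by
  obtain ⟨T, h1, h2, h3⟩ := h
  exact ⟨T, h1, h2, hAB.trans h3⟩

theorem of_le (h : SmoothlyCovered A d c) {d' c' : ℕ} (hd : ∀ m, m + c ≤ d → m + c' ≤ d') :
    SmoothlyCovered A d' c' := by
  obtain ⟨T, h1, h2, h3⟩ := h
  exact ⟨T, h1, fun s hs => ⟨hd _ (h2 s hs).1, (h2 s hs).2⟩, h3⟩

theorem iUnion {ι : Sort*} [Countable ι] {A : ι → Set W} (h : ∀ i, SmoothlyCovered (A i) d c) :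
    SmoothlyCovered (⋃ i, A i) d c := by
  choose T h1 h2 h3 using h
  refine ⟨⋃ i, T i, countable_iUnion h1, fun s hs => ?_, iUnion_subset fun i => (h3 i).trans ?_⟩
  · obtain ⟨i, hi⟩ := mem_iUnion.1 hs
    exact h2 i s hi
  · exact biUnion_subset_biUnion_left (subset_iUnion T i)

theorem biUnion {ι : Type*} {t : Set ι} (ht : t.Countable) {A : ι → Set W}
    (h : ∀ i ∈ t, SmoothlyCovered (A i) d c) : SmoothlyCovered (⋃ i ∈ t, A i) d c := by
  have := ht.to_subtype
  rw [biUnion_eq_iUnion]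
  exact iUnion fun i => h i i.2

theorem image_of_isOpen {m : ℕ} (hm : m + c ≤ d) {U : Set (EuclideanSpace ℝ (Fin m))}
    (hU : IsOpen U) {f : EuclideanSpace ℝ (Fin m) → W} (hf : ContDiffOn ℝ ∞ f U) :
    SmoothlyCovered (f '' U) d c := by
  obtain ⟨T, h1, h2, h3⟩ := exists_countable_cover_of_isOpen hU
  refine ⟨(fun g => ⟨m, f ∘ g⟩) '' T, h1.image _, ?_, ?_⟩
  · rintro _ ⟨g, hg, rfl⟩
    exact ⟨hm, contDiffOn_univ.1 (hf.comp (h2 g hg).1.contDiffOn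
      fun x _ => (h2 g hg).2 (mem_range_self x))⟩
  · rintro _ ⟨x, hx, rfl⟩
    obtain ⟨g, hg, y, rfl⟩ := mem_iUnion₂.1 (h3 hx)
    exact mem_iUnion₂.2 ⟨_, mem_image_of_mem _ hg, y, rfl⟩

theorem image (h : SmoothlyCovered A d c) {U : Set W} (hU : IsOpen U) {f : W → W'}
    (hf : ContDiffOn ℝ ∞ f U) : SmoothlyCovered (f '' (A ∩ U)) d c := by
  obtain ⟨T, h1, h2, h3⟩ := h
  have key : SmoothlyCovered (⋃ s ∈ T, (f ∘ s.2) '' (s.2 ⁻¹' U)) d c :=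
    biUnion h1 fun s hs => image_of_isOpen (h2 s hs).1 (hU.preimage (h2 s hs).2.continuous)
      (hf.comp (h2 s hs).2.contDiffOn fun x hx => hx)
  refine key.mono ?_
  rintro _ ⟨x, ⟨hx, hxU⟩, rfl⟩
  obtain ⟨s, hs, y, rfl⟩ := mem_iUnion₂.1 (h3 hx)
  exact mem_iUnion₂.2 ⟨s, hs, y, hxU, rfl⟩

theorem image_of_contDiff (h : SmoothlyCovered A d c) {f : W → W'} (hf : ContDiff ℝ ∞ f) :
    SmoothlyCovered (f '' A) d c := by
  simpa using h.image isOpen_univ hf.contDiffOn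

theorem prod {A' : Set W'} {d' c' : ℕ} (h : SmoothlyCovered A d c)
    (h' : SmoothlyCovered A' d' c') : SmoothlyCovered (A ×ˢ A') (d + d') (c + c') := by
  obtain ⟨T, h1, h2, h3⟩ := h
  obtain ⟨T', h1', h2', h3'⟩ := h'
  let e (m m' : ℕ) : EuclideanSpace ℝ (Fin (m + m')) ≃L[ℝ]
      EuclideanSpace ℝ (Fin m) × EuclideanSpace ℝ (Fin m') :=
    ContinuousLinearEquiv.ofFinrankEq (by simp)
  refine ⟨(fun p : (Σ m : ℕ, EuclideanSpace ℝ (Fin m) → W) ×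
      (Σ m : ℕ, EuclideanSpace ℝ (Fin m) → W') =>
      ⟨p.1.1 + p.2.1, Prod.map p.1.2 p.2.2 ∘ e p.1.1 p.2.1⟩) '' (T ×ˢ T'), (h1.prod h1').image _,
      ?_, ?_⟩
  · rintro _ ⟨⟨s, s'⟩, ⟨hs, hs'⟩, rfl⟩
    refine ⟨?_, ((h2 s hs).2.prodMap (h2' s' hs').2).comp (e s.1 s'.1).contDiff⟩
    have := (h2 s hs).1
    have := (h2' s' hs').1
    dsimp only at *
    omega
  · rintro ⟨x, x'⟩ ⟨hx, hx'⟩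
    obtain ⟨s, hs, y, rfl⟩ := mem_iUnion₂.1 (h3 hx)
    obtain ⟨s', hs', y', rfl⟩ := mem_iUnion₂.1 (h3' hx')
    exact mem_iUnion₂.2 ⟨_, mem_image_of_mem _ (mk_mem_prod hs hs'), (e s.1 s'.1).symm (y, y'),
      by simp⟩

theorem univ_of_finiteDimensional [FiniteDimensional ℝ W] (hd : Module.finrank ℝ W + c ≤ d) :
    SmoothlyCovered (univ : Set W) d c := by
  let e : EuclideanSpace ℝ (Fin (Module.finrank ℝ W)) ≃L[ℝ] W :=
    ContinuousLinearEquiv.ofFinrankEq (by simp)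
  refine ⟨{⟨_, e⟩}, countable_singleton _, ?_, ?_⟩
  · rintro _ rfl
    exact ⟨hd, e.contDiff⟩
  · simp [e.surjective.range_eq]

/-- Up to positive scaling a vector space of dimension `m` is covered by smooth images of spaces of
dimension `m - 1`: the affine hyperplanes where some coordinate is `1` or `-1`. -/
theorem exists_slice (W : Type*) [NormedAddCommGroup W] [NormedSpace ℝ W]
    [FiniteDimensional ℝ W] :
    ∃ B : Set W, SmoothlyCovered B (Module.finrank ℝ W) 1 ∧
      ∀ w : W, w ≠ 0 → ∃ r : ℝ, 0 < r ∧ r • w ∈ B := by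
  let b := Module.finBasis ℝ W
  let H : Fin (Module.finrank ℝ W) × Bool → Set W := fun p =>
    {w | b.coord p.1 w = if p.2 then 1 else -1}
  refine ⟨⋃ p, H p, iUnion fun p => ?_, fun w hw => ?_⟩
  · have hne : b.coord p.1 ≠ 0 := fun h => by
      have := congrArg (fun f => f (b p.1)) h
      simp at this
    have hrank : Module.finrank ℝ (LinearMap.ker (b.coord p.1)) + 1 = Module.finrank ℝ W := by
      have := Module.Dual.finrank_ker_add_one_of_ne_zero hne
      omega
    have h1 : SmoothlyCovered (univ : Set (LinearMap.ker (b.coord p.1)))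
        (Module.finrank ℝ W) 1 := univ_of_finiteDimensional hrank.le
    let v : W := (if p.2 then (1 : ℝ) else -1) • b p.1
    have hv : b.coord p.1 v = if p.2 then 1 else -1 := by simp only [v]; split_ifs <;> simp
    refine (h1.image_of_contDiff (f := fun x => (x : W) + v)
      ((LinearMap.ker (b.coord p.1)).subtypeL.contDiff.add contDiff_const)).mono ?_
    intro w hw
    refine ⟨⟨w - v, ?_⟩, mem_univ _, by simp⟩
    rw [LinearMap.mem_ker, map_sub, hv]
    exact sub_eq_zero.2 hw
  · obtain ⟨i, hi⟩ : ∃ i, b.coord i w ≠ 0 := by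
      by_contra! h
      exact hw (b.forall_coord_eq_zero_iff.1 h)
    refine ⟨|b.coord i w|⁻¹, by positivity, mem_iUnion.2 ⟨(i, decide (0 < b.coord i w)), ?_⟩⟩
    rcases hi.lt_or_gt with h | h
    · simp only [H, mem_ofPred_eq, map_smul, smul_eq_mul, abs_of_neg h, h.not_gt, decide_false]
      simp only [Bool.false_eq_true, if_false]
      field_simp
    · simp only [H, mem_ofPred_eq, map_smul, smul_eq_mul, abs_of_pos h, h, decide_true, if_true]
      field_simp

end SmoothlyCovered

end SmoothlyCovered

/-- A product `ℝ × W` is a Euclidean space whose first coordinate is the factor `ℝ`. -/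
theorem exists_continuousLinearEquiv_euclideanSpace (W : Type*) [NormedAddCommGroup W]
    [NormedSpace ℝ W] [FiniteDimensional ℝ W] (d : ℕ) [NeZero d]
    (hd : Module.finrank ℝ W = d - 1) :
    ∃ Φ : (ℝ × W) ≃L[ℝ] EuclideanSpace ℝ (Fin d), ∀ w, Φ w 0 = w.1 := by
  obtain ⟨m, rfl⟩ : ∃ m, d = m + 1 := ⟨d - 1, (Nat.succ_pred_eq_of_pos (NeZero.pos d)).symm⟩
  let ψ : W ≃ₗ[ℝ] (Fin m → ℝ) := LinearEquiv.ofFinrankEq _ _ (by simpa using hd)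
  let Φ : (ℝ × W) ≃ₗ[ℝ] EuclideanSpace ℝ (Fin (m + 1)) :=
    ((LinearEquiv.refl ℝ ℝ).prodCongr ψ).trans
      ((Fin.consLinearEquiv ℝ (fun _ : Fin (m + 1) => ℝ)).trans
        (WithLp.linearEquiv 2 ℝ (Fin (m + 1) → ℝ)).symm)
  exact ⟨Φ.toContinuousLinearEquiv, fun w => rfl⟩

/-! ### Charts with disconnected domains -/

section FiniteChart

variable {n : ℕ} {M : Type*} [TopologicalSpace M]
  [ChartedSpace (EuclideanSpace ℝ (Fin n)) M] [IsManifold (𝓡 n) ∞ M]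

open Classical in
/-- Two charts with disjoint domains and disjoint images form a single chart. -/
theorem disjointUnion_mem_maximalAtlas
    {φ ψ : OpenPartialHomeomorph M (EuclideanSpace ℝ (Fin n))}
    (hφ : φ ∈ IsManifold.maximalAtlas (𝓡 n) ∞ M) (hψ : ψ ∈ IsManifold.maximalAtlas (𝓡 n) ∞ M)
    (hs : Disjoint φ.source ψ.source) (ht : Disjoint φ.target ψ.target) :
    φ.disjointUnion ψ hs ht ∈ IsManifold.maximalAtlas (𝓡 n) ∞ M := by
  refine OpenPartialHomeomorph.mem_maximalAtlas_of_contMDiffOn _ ?_ ?_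
  · rintro x (hx | hx) <;> apply ContMDiffAt.contMDiffWithinAt
    · refine (contMDiffAt_of_mem_maximalAtlas hφ hx).congr_of_eventuallyEq ?_
      filter_upwards [φ.open_source.mem_nhds hx] with y hy
      exact piecewise_eq_of_mem _ _ _ hy
    · refine (contMDiffAt_of_mem_maximalAtlas hψ hx).congr_of_eventuallyEq ?_
      filter_upwards [ψ.open_source.mem_nhds hx] with y hy
      exact piecewise_eq_of_notMem _ _ _ (hs.notMem_of_mem_right hy)
  · rintro x (hx | hx) <;> apply ContMDiffAt.contMDiffWithinAt
    · refine (contMDiffAt_symm_of_mem_maximalAtlas hφ hx).congr_of_eventuallyEq ?_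
      filter_upwards [φ.open_target.mem_nhds hx] with y hy
      exact piecewise_eq_of_mem _ _ _ hy
    · refine (contMDiffAt_symm_of_mem_maximalAtlas hψ hx).congr_of_eventuallyEq ?_
      filter_upwards [ψ.open_target.mem_nhds hx] with y hy
      exact piecewise_eq_of_notMem _ _ _ (ht.notMem_of_mem_right hy)

theorem restr_mem_maximalAtlas_of_isOpen
    {φ : OpenPartialHomeomorph M (EuclideanSpace ℝ (Fin n))}
    (hφ : φ ∈ IsManifold.maximalAtlas (𝓡 n) ∞ M) {s : Set M} (hs : IsOpen s) :
    φ.restrOpen s hs ∈ IsManifold.maximalAtlas (𝓡 n) ∞ M := by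
  refine OpenPartialHomeomorph.mem_maximalAtlas_of_contMDiffOn _ ?_ ?_
  · exact (contMDiffOn_of_mem_maximalAtlas hφ).mono inter_subset_left
  · exact (contMDiffOn_symm_of_mem_maximalAtlas hφ).mono inter_subset_left

theorem trans_addRight_mem_maximalAtlas
    {φ : OpenPartialHomeomorph M (EuclideanSpace ℝ (Fin n))}
    (hφ : φ ∈ IsManifold.maximalAtlas (𝓡 n) ∞ M) (v : EuclideanSpace ℝ (Fin n)) :
    φ.transHomeomorph (Homeomorph.addRight v) ∈ IsManifold.maximalAtlas (𝓡 n) ∞ M := by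
  have hadd : ∀ v : EuclideanSpace ℝ (Fin n), ContMDiff (𝓡 n) (𝓡 n) ∞ fun x => x + v := fun v =>
    (contDiff_id.add contDiff_const).contMDiff
  refine OpenPartialHomeomorph.mem_maximalAtlas_of_contMDiffOn _ ?_ ?_
  · exact (hadd v).comp_contMDiffOn (contMDiffOn_of_mem_maximalAtlas hφ)
  · exact (contMDiffOn_symm_of_mem_maximalAtlas hφ).comp (hadd (-v)).contMDiffOn
      (fun x hx => hx)

/-- Every finite set of points of a Hausdorff manifold of positive dimension lies in the domain of
a single chart. -/
theorem exists_chart_of_finite [T2Space M] [Nonempty M] [NeZero n] {s : Set M} (hs : s.Finite) :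
    ∃ φ ∈ IsManifold.maximalAtlas (𝓡 n) ∞ M, s ⊆ φ.source := by
  classical
  induction s, hs using Set.Finite.induction_on with
  | empty =>
    obtain ⟨x⟩ := ‹Nonempty M›
    exact ⟨chartAt _ x, IsManifold.chart_mem_maximalAtlas x, empty_subset _⟩
  | @insert x s hx hs ih =>
    obtain ⟨φ, hφ, hsφ⟩ := ih
    obtain ⟨U, V, hU, hV, hsU, hxV, hUV⟩ : SeparatedNhds s {x} :=
      SeparatedNhds.of_isCompact_isCompact hs.isCompact isCompact_singleton (by simpa using hx)
    obtain ⟨R, hR⟩ := (hs.image φ).isBounded.exists_norm_le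
    have hR' : ∀ y ∈ s, ‖φ y‖ ≤ R := fun y hy => hR _ (mem_image_of_mem _ hy)
    let ψ := chartAt (EuclideanSpace ℝ (Fin n)) x
    have hψ : ψ ∈ IsManifold.maximalAtlas (𝓡 n) ∞ M := IsManifold.chart_mem_maximalAtlas x
    have : Nonempty (Fin n) := ⟨⟨0, NeZero.pos n⟩⟩
    -- The chart at `x` is restricted to a unit ball and translated to the centre `v`, which is so far
    -- away that its image does not meet the ball of radius `R + 1`.
    obtain ⟨v, hv⟩ := NormedSpace.exists_lt_norm ℝ (EuclideanSpace ℝ (Fin n)) (R + 1 + 1)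
    let A := φ.source ∩ φ ⁻¹' Metric.ball 0 (R + 1)
    have hA : IsOpen A := φ.isOpen_inter_preimage Metric.isOpen_ball
    let B := ψ.source ∩ ψ ⁻¹' Metric.ball (ψ x) 1
    have hB : IsOpen B := ψ.isOpen_inter_preimage Metric.isOpen_ball
    let φ' := φ.restrOpen (U ∩ A) (hU.inter hA)
    let ψ' := (ψ.restrOpen (V ∩ B) (hV.inter hB)).transHomeomorph
      (Homeomorph.addRight (v - ψ x))
    have hφ' := restr_mem_maximalAtlas_of_isOpen hφ (hU.inter hA)
    have hψ' := trans_addRight_mem_maximalAtlas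
      (restr_mem_maximalAtlas_of_isOpen hψ (hV.inter hB)) (v - ψ x)
    have hdis : Disjoint φ'.source ψ'.source :=
      hUV.mono (fun y hy => hy.2.1) (fun y hy => hy.2.1)
    have hdis' : Disjoint φ'.target ψ'.target := by
      rw [Set.disjoint_left]
      intro z hz hz'
      have h1 : ‖z‖ < R + 1 := by
        have h := (φ'.map_target hz).2.2.2
        have e : φ (φ'.symm z) = z := φ'.right_inv hz
        simpa [e] using h
      have h2 : ‖z - v‖ < 1 := by
        have h := (ψ'.map_target hz').2.2.2
        have e : ψ (ψ'.symm z) + (v - ψ x) = z := ψ'.right_inv hz'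
        rw [mem_preimage, Metric.mem_ball, dist_eq_norm] at h
        have e' : z - v = ψ (ψ'.symm z) - ψ x :=
          (congrArg (· - v) e).symm.trans (by abel)
        rwa [e']
      have h3 : ‖v‖ ≤ ‖z‖ + ‖z - v‖ := by
        have := norm_sub_le z (z - v)
        simpa using this
      linarith
    refine ⟨φ'.disjointUnion ψ' hdis hdis', disjointUnion_mem_maximalAtlas hφ' hψ' hdis hdis', ?_⟩
    rintro y (rfl | hy)
    · exact Or.inr ⟨mem_chart_source _ _, hxV rfl, mem_chart_source _ _,
        Metric.mem_ball_self one_pos⟩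
    · refine Or.inl ⟨hsφ hy, hsU hy, hsφ hy, ?_⟩
      have := hR' y hy
      simp only [mem_preimage, Metric.mem_ball, dist_zero_right]
      linarith

end FiniteChart

/-! ### Polar coordinates on the blow-up of the diagonal -/

/-- The Euclidean space `ℝⁿ`. -/
abbrev Euc (n : ℕ) : Type := EuclideanSpace ℝ (Fin n)

namespace DiagBlowup

variable {n : ℕ} {M : Type*} [TopologicalSpace M] [ChartedSpace (EuclideanSpace ℝ (Fin n)) M]
  {φ φ' : OpenPartialHomeomorph M (EuclideanSpace ℝ (Fin n))}

/-- The domain of the polar coordinates associated with the chart `φ`. -/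
def polarDom (φ : OpenPartialHomeomorph M (EuclideanSpace ℝ (Fin n))) : Set (DiagBlowup n M) :=
  blowdown ⁻¹' (φ.source ×ˢ φ.source)

/-- The range of the polar coordinates associated with the chart `φ`. -/
def polarRange (φ : OpenPartialHomeomorph M (EuclideanSpace ℝ (Fin n))) :
    Set (Euc n × Euc n × ℝ) :=
  {p | p.1 ∈ φ.target ∧ p.1 + p.2.2 • p.2.1 ∈ φ.target ∧ ‖p.2.1‖ = 1 ∧ 0 ≤ p.2.2}

theorem polar_inl (q : {q : M × M // q.1 ≠ q.2}) :
    polar φ (Sum.inl q : DiagBlowup n M) =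
      (φ q.1.1, ‖φ q.1.2 - φ q.1.1‖⁻¹ • (φ q.1.2 - φ q.1.1), ‖φ q.1.2 - φ q.1.1‖) := rfl

/-- The coordinates of a tangent vector with respect to the chart `φ`. -/
noncomputable def tangentCoord (φ : OpenPartialHomeomorph M (EuclideanSpace ℝ (Fin n))) (x : M)
    (v : TangentSpace (𝓡 n) x) : Euc n :=
  mfderiv (𝓡 n) 𝓘(ℝ, Euc n) φ x v

theorem tangentCoord_smul (x : M) (c : ℝ) (v : TangentSpace (𝓡 n) x) :
    tangentCoord φ x (c • v) = c • tangentCoord φ x v :=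
  map_smul (mfderiv (𝓡 n) 𝓘(ℝ, Euc n) φ x) c v

theorem polar_inr (r : Σ x : M, Module.Ray ℝ (TangentSpace (𝓡 n) x)) :
    polar φ (Sum.inr r : DiagBlowup n M) =
      (φ r.1, ‖tangentCoord φ r.1 r.2.someVector‖⁻¹ • tangentCoord φ r.1 r.2.someVector, 0) := rfl

theorem polar_fst (z : DiagBlowup n M) : (polar φ z).1 = φ z.blowdown.1 := by
  rcases z with q | r <;> rfl

theorem polar_radius (z : DiagBlowup n M) :
    (polar φ z).2.2 = ‖φ z.blowdown.2 - φ z.blowdown.1‖ := by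
  rcases z with q | r
  · rfl
  · rw [polar_inr]
    simp [blowdown]

theorem polar_radius_nonneg (z : DiagBlowup n M) : 0 ≤ (polar φ z).2.2 := by
  rw [polar_radius]; exact norm_nonneg _

theorem polar_radius_eq_zero_iff {z : DiagBlowup n M} (hz : z ∈ polarDom φ) :
    (polar φ z).2.2 = 0 ↔ z.blowdown.1 = z.blowdown.2 := by
  rw [polar_radius, norm_eq_zero, sub_eq_zero]
  exact ⟨fun h => (φ.injOn hz.2 hz.1 h).symm, fun h => by rw [h]⟩

theorem polar_add_smul (z : DiagBlowup n M) :
    (polar φ z).1 + (polar φ z).2.2 • (polar φ z).2.1 = φ z.blowdown.2 := by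
  rcases z with q | r
  · rw [polar_inl]
    by_cases h : φ q.1.2 - φ q.1.1 = 0
    · simp only [blowdown, h]
      simpa using (sub_eq_zero.1 h).symm
    · have : ‖φ q.1.2 - φ q.1.1‖ ≠ 0 := norm_ne_zero_iff.2 h
      simp [blowdown, smul_smul, this]
  · rw [polar_inr]
    simp [blowdown]

theorem blowdown_eq {z : DiagBlowup n M} (hz : z ∈ polarDom φ) :
    z.blowdown = (φ.symm (polar φ z).1, φ.symm ((polar φ z).1 + (polar φ z).2.2 • (polar φ z).2.1))
      := by
  rw [polar_add_smul, polar_fst, φ.left_inv hz.1, φ.left_inv hz.2]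

theorem mdifferentiable_of_mem_maximalAtlas
    (hφ : φ ∈ IsManifold.maximalAtlas (𝓡 n) ∞ M) : φ.MDifferentiable (𝓡 n) (𝓡 n) :=
  ⟨(contMDiffOn_of_mem_maximalAtlas hφ).mdifferentiableOn (by simp),
    (contMDiffOn_symm_of_mem_maximalAtlas hφ).mdifferentiableOn (by simp)⟩

theorem tangentCoord_injective (hφ : φ ∈ IsManifold.maximalAtlas (𝓡 n) ∞ M) {x : M}
    (hx : x ∈ φ.source) : Function.Injective (tangentCoord φ x) :=
  (mdifferentiable_of_mem_maximalAtlas hφ).mfderiv_injective hx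

theorem tangentCoord_surjective (hφ : φ ∈ IsManifold.maximalAtlas (𝓡 n) ∞ M) {x : M}
    (hx : x ∈ φ.source) : Function.Surjective (tangentCoord φ x) :=
  (mdifferentiable_of_mem_maximalAtlas hφ).mfderiv_surjective hx

theorem tangentCoord_someVector_ne_zero (hφ : φ ∈ IsManifold.maximalAtlas (𝓡 n) ∞ M)
    {x : M} (r : Module.Ray ℝ (TangentSpace (𝓡 n) x)) (hx : x ∈ φ.source) :
    tangentCoord φ x r.someVector ≠ 0 := by
  intro h
  exact r.someVector_ne_zero (tangentCoord_injective hφ hx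
    (h.trans (map_zero (mfderiv (𝓡 n) 𝓘(ℝ, Euc n) φ x)).symm))

theorem norm_polar_direction (hφ : φ ∈ IsManifold.maximalAtlas (𝓡 n) ∞ M)
    {z : DiagBlowup n M} (hz : z ∈ polarDom φ) : ‖(polar φ z).2.1‖ = 1 := by
  rcases z with q | r
  · have : φ q.1.2 - φ q.1.1 ≠ 0 := fun h => q.2 (φ.injOn hz.2 hz.1 (sub_eq_zero.1 h)).symm
    rw [polar_inl]
    exact norm_smul_inv_norm this
  · rw [polar_inr]
    exact norm_smul_inv_norm (tangentCoord_someVector_ne_zero hφ r.2 hz.1)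

theorem polar_mem_polarRange (hφ : φ ∈ IsManifold.maximalAtlas (𝓡 n) ∞ M)
    {z : DiagBlowup n M} (hz : z ∈ polarDom φ) : polar φ z ∈ polarRange φ := by
  refine ⟨?_, ?_, norm_polar_direction hφ hz, polar_radius_nonneg z⟩
  · rw [polar_fst]; exact φ.map_source hz.1
  · rw [polar_add_smul]; exact φ.map_source hz.2

theorem polar_injOn (hφ : φ ∈ IsManifold.maximalAtlas (𝓡 n) ∞ M) :
    InjOn (polar φ) (polarDom φ : Set (DiagBlowup n M)) := by
  intro z hz z' hz' h
  have hb : z.blowdown = z'.blowdown := by rw [blowdown_eq hz, blowdown_eq hz', h]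
  rcases z with q | ⟨x, r⟩ <;> rcases z' with q' | ⟨x', r'⟩
  · exact congrArg Sum.inl (Subtype.ext hb)
  · exact absurd ((congrArg Prod.fst hb).trans (congrArg Prod.snd hb).symm) q.2
  · exact absurd ((congrArg Prod.fst hb).symm.trans (congrArg Prod.snd hb)) q'.2
  · obtain rfl : x = x' := congrArg Prod.fst hb
    have h1 := congrArg (fun p => p.2.1) h
    simp only [polar_inr] at h1
    have hw := tangentCoord_someVector_ne_zero hφ r hz.1
    have hw' := tangentCoord_someVector_ne_zero hφ r' hz.1
    have h2 : ‖tangentCoord φ x r.someVector‖⁻¹ • r.someVector =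
        ‖tangentCoord φ x r'.someVector‖⁻¹ • r'.someVector := by
      apply tangentCoord_injective hφ (show x ∈ φ.source from hz.1)
      rw [tangentCoord_smul, tangentCoord_smul]
      exact h1
    have h3 : SameRay ℝ r.someVector r'.someVector := by
      refine Or.inr (Or.inr ⟨_, _, ?_, ?_, h2⟩)
      · exact inv_pos.2 (norm_pos_iff.2 hw)
      · exact inv_pos.2 (norm_pos_iff.2 hw')
    have h4 : r = r' := by
      rw [← r.someVector_ray, ← r'.someVector_ray]
      exact (ray_eq_iff _ _).2 h3
    rw [h4]

theorem exists_polar_eq (hφ : φ ∈ IsManifold.maximalAtlas (𝓡 n) ∞ M) {p : Euc n × Euc n × ℝ}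
    (hp : p ∈ polarRange φ) : ∃ z ∈ (polarDom φ : Set (DiagBlowup n M)), polar φ z = p := by
  obtain ⟨a, θ, r⟩ := p
  obtain ⟨ha, hb, hθ, hr⟩ := hp
  dsimp only at ha hb hθ hr
  -- For `r = 0` the point is a ray, otherwise a pair of distinct points.
  rcases hr.eq_or_lt with rfl | hr
  · have hx := φ.map_target ha
    obtain ⟨v, hv⟩ := tangentCoord_surjective hφ hx θ
    have hv0 : v ≠ 0 := by
      rintro rfl
      have hv' : (0 : Euc n) = θ :=
        (map_zero (mfderiv (𝓡 n) 𝓘(ℝ, Euc n) φ (φ.symm a))).symm.trans hv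
      rw [← hv', norm_zero] at hθ
      exact zero_ne_one hθ
    let R : Module.Ray ℝ (TangentSpace (𝓡 n) (φ.symm a)) := rayOfNeZero ℝ v hv0
    refine ⟨Sum.inr ⟨φ.symm a, R⟩, ⟨hx, hx⟩, ?_⟩
    have hray : SameRay ℝ v R.someVector :=
      (ray_eq_iff hv0 R.someVector_ne_zero).1 R.someVector_ray.symm
    obtain ⟨c, hc, hcv⟩ := hray.exists_pos_left hv0 R.someVector_ne_zero
    have hw : tangentCoord φ (φ.symm a) R.someVector = c • θ := by
      rw [← hcv, tangentCoord_smul, hv]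
    rw [polar_inr]
    dsimp only
    rw [hw, φ.right_inv ha, norm_smul, hθ, Real.norm_of_nonneg hc.le, mul_one, smul_smul,
      inv_mul_cancel₀ hc.ne', one_smul]
  · have hne : φ.symm a ≠ φ.symm (a + r • θ) := by
      intro h
      have h' := φ.symm.injOn ha hb h
      have : r • θ = 0 := by simpa using h'
      rcases smul_eq_zero.1 this with h | h
      · exact hr.ne' h
      · rw [h, norm_zero] at hθ; exact zero_ne_one hθ
    refine ⟨Sum.inl ⟨(φ.symm a, φ.symm (a + r • θ)), hne⟩,
      ⟨φ.map_target ha, φ.map_target hb⟩, ?_⟩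
    rw [polar_inl]
    dsimp only
    rw [φ.right_inv ha, φ.right_inv hb, add_sub_cancel_left, norm_smul, hθ,
      Real.norm_of_nonneg hr.le, mul_one, smul_smul, inv_mul_cancel₀ hr.ne', one_smul]

/-- The change of polar coordinates extends to a smooth map on a neighbourhood of any point of
the range.  At a point of the boundary the extension is obtained from Hadamard's lemma. -/
theorem exists_polar_change [IsManifold (𝓡 n) ∞ M] (hφ : φ ∈ IsManifold.maximalAtlas (𝓡 n) ∞ M)
    (hφ' : φ' ∈ IsManifold.maximalAtlas (𝓡 n) ∞ M) {z₀ : DiagBlowup n M}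
    (hz₀ : z₀ ∈ polarDom φ) (hz₀' : z₀ ∈ polarDom φ') :
    ∃ τ : Euc n × Euc n × ℝ → Euc n × Euc n × ℝ, ContDiffAt ℝ ∞ τ (polar φ z₀) ∧
      ∀ᶠ p in 𝓝 (polar φ z₀), ∀ z : DiagBlowup n M, z ∈ polarDom φ → polar φ z = p →
        z ∈ polarDom φ' ∧ polar φ' z = τ p := by
  let Ω : Set (Euc n) := φ.target ∩ φ.symm ⁻¹' φ'.source
  have hΩ : IsOpen Ω := φ.isOpen_inter_preimage_symm φ'.open_source
  obtain ⟨ψ, hψdef⟩ : ∃ ψ : Euc n → Euc n, ψ = φ' ∘ φ.symm := ⟨_, rfl⟩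
  have hψ : ContDiffOn ℝ ∞ ψ Ω := by
    rw [← contMDiffOn_iff_contDiffOn, hψdef]
    exact (contMDiffOn_of_mem_maximalAtlas hφ').comp
      ((contMDiffOn_symm_of_mem_maximalAtlas hφ).mono inter_subset_left) inter_subset_right
  have hψφ : ∀ x ∈ φ.source, ψ (φ x) = φ' x := fun x hx => by simp [hψdef, φ.left_inv hx]
  have hmemΩ : ∀ x ∈ φ.source, φ x ∈ Ω ↔ x ∈ φ'.source := fun x hx => by
    simp [Ω, φ.left_inv hx, φ.map_source hx]
  have hev1 : ∀ᶠ p : Euc n × Euc n × ℝ in 𝓝 (polar φ z₀), p.1 ∈ Ω := by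
    apply (continuous_fst.continuousAt (x := polar φ z₀)).eventually
    apply hΩ.mem_nhds
    rw [polar_fst]
    exact (hmemΩ _ hz₀.1).2 hz₀'.1
  have hadd : Continuous fun p : Euc n × Euc n × ℝ => p.1 + p.2.2 • p.2.1 := by fun_prop
  have hp2 : (polar φ z₀).1 + (polar φ z₀).2.2 • (polar φ z₀).2.1 ∈ Ω := by
    rw [polar_add_smul]
    exact (hmemΩ _ hz₀.2).2 hz₀'.2
  have hev2 : ∀ᶠ p : Euc n × Euc n × ℝ in 𝓝 (polar φ z₀), p.1 + p.2.2 • p.2.1 ∈ Ω :=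
    hadd.continuousAt.eventually (hΩ.mem_nhds hp2)
  have hψa : ContDiffAt ℝ ∞ ψ (polar φ z₀).1 :=
    hψ.contDiffAt (hΩ.mem_nhds hev1.self_of_nhds)
  have hdom : ∀ z : DiagBlowup n M, z ∈ polarDom φ → (polar φ z).1 ∈ Ω →
      (polar φ z).1 + (polar φ z).2.2 • (polar φ z).2.1 ∈ Ω → z ∈ polarDom φ' := by
    intro z hz h1 h2
    rw [polar_fst, hmemΩ _ hz.1] at h1
    rw [polar_add_smul, hmemΩ _ hz.2] at h2
    exact ⟨h1, h2⟩
  by_cases h0 : (polar φ z₀).2.2 = 0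
  · -- near a ray of the diagonal
    obtain ⟨g, hg, hgev⟩ := exists_contDiffAt_slope hΩ hψ hev1.self_of_nhds (polar φ z₀).2.1
    have hp₀ : ((polar φ z₀).1, (polar φ z₀).2.1, (0 : ℝ)) = polar φ z₀ := by rw [← h0]
    rw [hp₀] at hg hgev
    -- the chain rule: the differential of the coordinate change maps ray coordinates to
    -- ray coordinates
    have hinr : ∀ x : M, ∀ r : Module.Ray ℝ (TangentSpace (𝓡 n) x), x ∈ φ.source →
        x ∈ φ'.source →
        tangentCoord φ' x r.someVector =
          fderiv ℝ ψ (φ x) (tangentCoord φ x r.someVector) := by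
      intro x r hx hx'
      have hev : φ' =ᶠ[𝓝 x] ψ ∘ φ := by
        filter_upwards [φ.open_source.mem_nhds hx] with y hy using (hψφ y hy).symm
      have hψx : DifferentiableAt ℝ ψ (φ x) :=
        (hψ.contDiffAt (hΩ.mem_nhds ((hmemΩ x hx).2 hx'))).differentiableAt (by simp)
      unfold tangentCoord
      rw [hev.mfderiv_eq, mfderiv_comp (I' := 𝓘(ℝ, Euc n)) x hψx.mdifferentiableAt
        ((mdifferentiable_of_mem_maximalAtlas hφ).mdifferentiableAt hx), mfderiv_eq_fderiv]
      rfl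
    have hg0 : g (polar φ z₀) ≠ 0 := by
      rw [hgev.self_of_nhds.2 h0]
      rcases z₀ with q | ⟨x, r⟩
      · exact absurd ((polar_radius_eq_zero_iff hz₀).1 h0) q.2
      · rw [polar_inr]
        dsimp only
        rw [map_smul, ← hinr x r hz₀.1 hz₀'.1]
        have hw := tangentCoord_someVector_ne_zero hφ r hz₀.1
        have hw' := tangentCoord_someVector_ne_zero hφ' r hz₀'.1
        exact smul_ne_zero (inv_ne_zero (norm_ne_zero_iff.2 hw)) hw'
    -- `ψ (a + r θ) - ψ a = r g`, so that the new direction is `g / ‖g‖` and the new radius `r ‖g‖`,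
    -- also for `r = 0`
    refine ⟨fun p => (ψ p.1, ‖g p‖⁻¹ • g p, p.2.2 * ‖g p‖), ?_, ?_⟩
    · have hn : ContDiffAt ℝ ∞ (fun p => ‖g p‖) (polar φ z₀) := hg.norm ℝ hg0
      refine ContDiffAt.prodMk (ContDiffAt.comp _ hψa contDiffAt_fst)
        (ContDiffAt.prodMk ((hn.inv (norm_ne_zero_iff.2 hg0)).smul hg) (ContDiffAt.mul ?_ hn))
      exact contDiffAt_snd.comp _ contDiffAt_snd
    · filter_upwards [hev1, hev2, hgev, hg.continuousAt.eventually_ne hg0] with p h1 h2 h3 h4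
      rintro z hz rfl
      have hz' := hdom z hz h1 h2
      refine ⟨hz', ?_⟩
      have e := h3.1
      rw [polar_add_smul, polar_fst, hψφ _ hz.1, hψφ _ hz.2] at e
      rcases z with q | ⟨x, r⟩
      · have hr : 0 < (polar φ (Sum.inl q : DiagBlowup n M)).2.2 :=
          lt_of_le_of_ne (polar_radius_nonneg _)
            fun h => q.2 ((polar_radius_eq_zero_iff hz).1 h.symm)
        have e' : φ' q.1.2 - φ' q.1.1 = (polar φ (Sum.inl q : DiagBlowup n M)).2.2 •
            g (polar φ (Sum.inl q : DiagBlowup n M)) := e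
        rw [polar_inl (φ := φ'), e', norm_smul, Real.norm_of_nonneg hr.le]
        refine Prod.ext (hψφ _ hz.1).symm (Prod.ext ?_ rfl)
        dsimp only
        rw [smul_smul]
        congr 1
        field_simp
      · have hr : (polar φ (Sum.inr ⟨x, r⟩ : DiagBlowup n M)).2.2 = 0 := rfl
        rw [h3.2 hr, hr, zero_mul, polar_inr (φ := φ')]
        refine Prod.ext (hψφ _ hz.1).symm (Prod.ext ?_ rfl)
        have hw := tangentCoord_someVector_ne_zero hφ r hz.1
        rw [polar_inr]
        dsimp only
        rw [map_smul, ← hinr x r hz.1 hz'.1, norm_smul, norm_inv, norm_norm, mul_inv, inv_inv,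
          smul_smul, mul_right_comm, mul_inv_cancel₀ (norm_ne_zero_iff.2 hw), one_mul]
  · -- away from the diagonal
    let d : Euc n × Euc n × ℝ → Euc n := fun p => ψ (p.1 + p.2.2 • p.2.1) - ψ p.1
    have hd : ContDiffAt ℝ ∞ d (polar φ z₀) := by
      refine ContDiffAt.sub (ContDiffAt.comp (polar φ z₀)
        (hψ.contDiffAt (hΩ.mem_nhds hp2)) ?_) (ContDiffAt.comp _ hψa contDiffAt_fst)
      apply ContDiff.contDiffAt; fun_prop
    have hdz : ∀ z : DiagBlowup n M, z ∈ polarDom φ →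
        d (polar φ z) = φ' z.blowdown.2 - φ' z.blowdown.1 := by
      intro z hz
      simp only [d]
      rw [polar_add_smul, polar_fst, hψφ _ hz.1, hψφ _ hz.2]
    have hd0 : d (polar φ z₀) ≠ 0 := by
      rw [hdz _ hz₀, sub_ne_zero]
      exact fun h => h0 ((polar_radius_eq_zero_iff hz₀).2 (φ'.injOn hz₀'.2 hz₀'.1 h).symm)
    refine ⟨fun p => (ψ p.1, ‖d p‖⁻¹ • d p, ‖d p‖), ?_, ?_⟩
    · have hn : ContDiffAt ℝ ∞ (fun p => ‖d p‖) (polar φ z₀) := hd.norm ℝ hd0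
      exact ContDiffAt.prodMk (ContDiffAt.comp _ hψa contDiffAt_fst)
        (ContDiffAt.prodMk ((hn.inv (norm_ne_zero_iff.2 hd0)).smul hd) hn)
    · filter_upwards [hev1, hev2, hd.continuousAt.eventually_ne hd0] with p h1 h2 h3
      rintro z hz rfl
      refine ⟨hdom z hz h1 h2, ?_⟩
      have e := hdz z hz
      rcases z with q | ⟨x, r⟩
      · rw [polar_inl (φ := φ'), e]
        exact Prod.ext (hψφ _ hz.1).symm rfl
      · rw [e] at h3
        exact absurd (sub_self _) h3

theorem continuous_blowdown : Continuous (blowdown : DiagBlowup n M → M × M) :=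
  continuous_def.2 fun O hO => TopologicalSpace.isOpen_generateFrom_of_mem (Or.inl ⟨O, hO, rfl⟩)

theorem isOpen_polarDom : IsOpen (polarDom φ : Set (DiagBlowup n M)) :=
  (φ.open_source.prod φ.open_source).preimage continuous_blowdown

/-- Polar coordinates are a topological embedding of their open domain. -/
theorem nhds_eq_comap_polar [IsManifold (𝓡 n) ∞ M]
    (hφ : φ ∈ IsManifold.maximalAtlas (𝓡 n) ∞ M) {z₀ : DiagBlowup n M}
    (hz₀ : z₀ ∈ polarDom φ) :
    𝓝 z₀ = Filter.comap (polar φ) (𝓝 (polar φ z₀)) ⊓ Filter.principal (polarDom φ) := by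
  apply le_antisymm
  · refine le_inf ?_ (Filter.le_principal_iff.2 (isOpen_polarDom.mem_nhds hz₀))
    rw [← Filter.map_le_iff_le_comap]
    intro V hV
    obtain ⟨V', hV'V, hV', hmem⟩ := mem_nhds_iff.1 hV
    have ho : IsOpen {z : DiagBlowup n M | z.blowdown ∈ φ.source ×ˢ φ.source ∧ polar φ z ∈ V'} :=
      TopologicalSpace.isOpen_generateFrom_of_mem (Or.inr ⟨φ, hφ, V', hV', rfl⟩)
    exact Filter.mem_map.2 <| Filter.mem_of_superset (ho.mem_nhds ⟨hz₀, hmem⟩) fun z hz => hV'V hz.2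
  · refine le_of_le_of_eq ?_ (TopologicalSpace.nhds_generateFrom (a := z₀)).symm
    refine le_iInf₂ fun s hs => Filter.le_principal_iff.2 ?_
    obtain ⟨hz₀s, ⟨O, hO, rfl⟩ | ⟨φ', hφ', V, hV, rfl⟩⟩ := hs
    -- the preimage of an open subset of `M × M`
    · have hc : ContinuousAt (fun p : Euc n × Euc n × ℝ =>
          (φ.symm p.1, φ.symm (p.1 + p.2.2 • p.2.1))) (polar φ z₀) := by
        have hm := polar_mem_polarRange hφ hz₀
        refine ContinuousAt.prodMk ((φ.continuousAt_symm hm.1).comp continuousAt_fst) ?_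
        exact ContinuousAt.comp (f := fun p : Euc n × Euc n × ℝ => p.1 + p.2.2 • p.2.1)
          (φ.continuousAt_symm hm.2.1) (by fun_prop)
      have h1 := hc.eventually (hO.mem_nhds (by
        change (φ.symm _, φ.symm _) ∈ O
        rw [← blowdown_eq hz₀]; exact hz₀s))
      rw [Filter.mem_inf_principal]
      filter_upwards [Filter.preimage_mem_comap h1] with z hz hzd
      rw [mem_preimage, blowdown_eq hzd]
      exact hz
    -- an open set in another system of polar coordinates
    · obtain ⟨τ, hτ, hev⟩ := exists_polar_change hφ hφ' hz₀ hz₀s.1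
      have h2 := (hev.self_of_nhds z₀ hz₀ rfl).2
      have h1 := hτ.continuousAt.eventually (hV.mem_nhds (show _ ∈ V by
        rw [← h2]; exact hz₀s.2))
      rw [Filter.mem_inf_principal]
      filter_upwards [Filter.preimage_mem_comap h1, Filter.preimage_mem_comap hev]
        with z hz1 hz2 hzd
      obtain ⟨h3, h4⟩ := hz2 z hzd rfl
      exact ⟨h3, by rw [h4]; exact hz1⟩

/-- The blow-up of a compact manifold is compact: for an ultrafilter whose image in `M × M`
converges, the directions in the polar coordinates of a chart around both components of the limit
converge on the unit sphere. -/
theorem compactSpace [IsManifold (𝓡 n) ∞ M] [T2Space M] [CompactSpace M] [NeZero n] :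
    CompactSpace (DiagBlowup n M) := by
  refine ⟨isCompact_iff_ultrafilter_le_nhds.2 fun F _ => ?_⟩
  obtain ⟨⟨x, y⟩, -, hxy⟩ := isCompact_iff_ultrafilter_le_nhds.1
    (isCompact_univ (X := M × M)) (F.map blowdown) (by simp)
  have : Nonempty M := ⟨x⟩
  obtain ⟨φ, hφ, hs⟩ := exists_chart_of_finite (n := n) (s := {x, y}) (toFinite _)
  have hx : x ∈ φ.source := hs (by simp)
  have hy : y ∈ φ.source := hs (by simp)
  have hbd : Filter.Tendsto blowdown (F : Filter (DiagBlowup n M)) (𝓝 (x, y)) := hxy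
  have hdom : ∀ᶠ z in (F : Filter (DiagBlowup n M)), z ∈ polarDom φ :=
    hbd.eventually ((φ.open_source.prod φ.open_source).mem_nhds ⟨hx, hy⟩)
  have h1 : Filter.Tendsto (fun z => φ z.blowdown.1) (F : Filter (DiagBlowup n M)) (𝓝 (φ x)) :=
    (φ.continuousAt hx).tendsto.comp (continuous_fst.continuousAt.tendsto.comp hbd)
  have h2 : Filter.Tendsto (fun z => φ z.blowdown.2) (F : Filter (DiagBlowup n M)) (𝓝 (φ y)) :=
    (φ.continuousAt hy).tendsto.comp (continuous_snd.continuousAt.tendsto.comp hbd)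
  obtain ⟨θ, hθ, hθlim⟩ := isCompact_iff_ultrafilter_le_nhds.1
    (isCompact_sphere (0 : Euc n) 1) (F.map fun z => (polar φ z).2.1) (by
      rw [Filter.le_principal_iff]
      refine Filter.mem_map.2 (Filter.mem_of_superset hdom fun z hz => ?_)
      simpa using norm_polar_direction hφ hz)
  have h3 : Filter.Tendsto (fun z => (polar φ z).2.1) (F : Filter (DiagBlowup n M)) (𝓝 θ) := hθlim
  have h4 : Filter.Tendsto (polar φ) (F : Filter (DiagBlowup n M))
      (𝓝 (φ x, θ, ‖φ y - φ x‖)) := by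
    refine Filter.Tendsto.prodMk_nhds (h1.congr fun z => (polar_fst z).symm)
      (Filter.Tendsto.prodMk_nhds h3 ?_)
    exact (h2.sub h1).norm.congr fun z => (polar_radius z).symm
  -- The limit coordinates lie in the range of the polar coordinates.
  have h5 : φ x + ‖φ y - φ x‖ • θ = φ y := by
    have ha : Filter.Tendsto (fun z => (polar φ z).1 + (polar φ z).2.2 • (polar φ z).2.1)
        (F : Filter (DiagBlowup n M)) (𝓝 (φ x + ‖φ y - φ x‖ • θ)) :=
      ((by fun_prop : Continuous fun p : Euc n × Euc n × ℝ =>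
        p.1 + p.2.2 • p.2.1).tendsto _).comp h4
    exact tendsto_nhds_unique (ha.congr fun z => polar_add_smul z) h2
  obtain ⟨z₀, hz₀, hpz₀⟩ := exists_polar_eq (M := M) hφ (p := (φ x, θ, ‖φ y - φ x‖))
    ⟨φ.map_source hx, by rw [h5]; exact φ.map_source hy, by simpa using hθ, norm_nonneg _⟩
  refine ⟨z₀, mem_univ _, ?_⟩
  rw [nhds_eq_comap_polar hφ hz₀, hpz₀]
  exact le_inf (Filter.map_le_iff_le_comap.1 h4) (Filter.le_principal_iff.2 hdom)

end DiagBlowup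

/-! ### Smooth structures on subsets of a space with a system of charts -/

namespace ChartSystem

variable {n : ℕ} {M Y Z : Type*} [TopologicalSpace M] [ChartedSpace (EuclideanSpace ℝ (Fin n)) M]
  [TopologicalSpace Y] [NormedAddCommGroup Z] [NormedSpace ℝ Z]

/-- A system of charts is smooth if the coordinates are topological embeddings of open sets, and
coordinate changes extend to smooth maps between neighbourhoods in the coordinate space `Z`. -/
structure IsSmooth (S : ChartSystem n M Y Z) : Prop where
  nhds_eq : ∀ φ ∈ IsManifold.maximalAtlas (𝓡 n) ∞ M, ∀ y ∈ S.dom φ,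
    𝓝 y = Filter.comap (S.chart φ) (𝓝 (S.chart φ y)) ⊓ Filter.principal (S.dom φ)
  change : ∀ φ ∈ IsManifold.maximalAtlas (𝓡 n) ∞ M, ∀ φ' ∈ IsManifold.maximalAtlas (𝓡 n) ∞ M,
    ∀ y ∈ S.dom φ, y ∈ S.dom φ' → ∃ τ : Z → Z, ContDiffAt ℝ ∞ τ (S.chart φ y) ∧
      ∀ᶠ y' in 𝓝 y, S.chart φ' y' = τ (S.chart φ y')
  exists_chart : ∀ y, ∃ φ ∈ IsManifold.maximalAtlas (𝓡 n) ∞ M, y ∈ S.dom φ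

variable {S : ChartSystem n M Y Z}
  {V H N : Type*} [NormedAddCommGroup V] [NormedSpace ℝ V] [TopologicalSpace H]
  [TopologicalSpace N] [ChartedSpace H N] {I : ModelWithCorners ℝ V H}
  {φ φ' : OpenPartialHomeomorph M (EuclideanSpace ℝ (Fin n))}

namespace IsSmooth

theorem dom_mem_nhds (hS : S.IsSmooth) (hφ : φ ∈ IsManifold.maximalAtlas (𝓡 n) ∞ M) {y : Y}
    (hy : y ∈ S.dom φ) : S.dom φ ∈ 𝓝 y := by
  rw [hS.nhds_eq φ hφ y hy]
  exact Filter.mem_inf_of_right (Filter.mem_principal_self _)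

theorem isOpen_dom (hS : S.IsSmooth) (hφ : φ ∈ IsManifold.maximalAtlas (𝓡 n) ∞ M) :
    IsOpen (S.dom φ) :=
  isOpen_iff_mem_nhds.2 fun _ hy => hS.dom_mem_nhds hφ hy

theorem continuousAt_chart (hS : S.IsSmooth) (hφ : φ ∈ IsManifold.maximalAtlas (𝓡 n) ∞ M) {y : Y}
    (hy : y ∈ S.dom φ) : ContinuousAt (S.chart φ) y := by
  rw [ContinuousAt, hS.nhds_eq φ hφ y hy]
  exact Filter.tendsto_comap.mono_left inf_le_left

theorem tendsto_nhds_iff (hS : S.IsSmooth) (hφ : φ ∈ IsManifold.maximalAtlas (𝓡 n) ∞ M)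
    {X : Type*} {l : Filter X} {f : X → Y} {y : Y} (hy : y ∈ S.dom φ)
    (hf : ∀ᶠ x in l, f x ∈ S.dom φ) (h : Filter.Tendsto (fun x => S.chart φ (f x)) l
      (𝓝 (S.chart φ y))) : Filter.Tendsto f l (𝓝 y) := by
  rw [hS.nhds_eq φ hφ y hy]
  exact Filter.tendsto_inf.2 ⟨Filter.tendsto_comap_iff.2 h, Filter.tendsto_principal.2 hf⟩

theorem contMDiffAt_change (hS : S.IsSmooth) (hφ : φ ∈ IsManifold.maximalAtlas (𝓡 n) ∞ M)
    (hφ' : φ' ∈ IsManifold.maximalAtlas (𝓡 n) ∞ M) {f : N → Y} {p : N} (hf : ContinuousAt f p)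
    (hp : f p ∈ S.dom φ) (hp' : f p ∈ S.dom φ')
    (h : ContMDiffAt I 𝓘(ℝ, Z) ∞ (S.chart φ ∘ f) p) :
    ContMDiffAt I 𝓘(ℝ, Z) ∞ (S.chart φ' ∘ f) p := by
  obtain ⟨τ, hτ, hev⟩ := hS.change φ hφ φ' hφ' _ hp hp'
  exact (hτ.contMDiffAt.comp p h).congr_of_eventuallyEq (hf.eventually hev)

theorem smooth_of_forall (hS : S.IsSmooth) {f : N → Y}
    (h : ∀ p, ∃ φ ∈ IsManifold.maximalAtlas (𝓡 n) ∞ M, (∀ᶠ x in 𝓝 p, f x ∈ S.dom φ) ∧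
      ContMDiffAt I 𝓘(ℝ, Z) ∞ (S.chart φ ∘ f) p) : S.Smooth I f := by
  have hc : ∀ p, ContinuousAt f p := fun p => by
    obtain ⟨φ, hφ, h1, h2⟩ := h p
    exact hS.tendsto_nhds_iff hφ h1.self_of_nhds h1 h2.continuousAt
  refine ⟨continuous_iff_continuousAt.2 hc, fun φ' hφ' p hp => ?_⟩
  obtain ⟨φ, hφ, h1, h2⟩ := h p
  exact (hS.contMDiffAt_change hφ hφ' (hc p) h1.self_of_nhds hp h2).contMDiffWithinAt

end IsSmooth

/-! ### Codimension -/

theorem CodimAtLeast.mono {A B : Set Y} {d c : ℕ} (h : S.CodimAtLeast B d c) (hAB : A ⊆ B) :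
    S.CodimAtLeast A d c := by
  obtain ⟨T, h1, h2, h3⟩ := h
  exact ⟨T, h1, h2, hAB.trans h3⟩

theorem CodimAtLeast.iUnion {ι : Sort*} [Countable ι] {A : ι → Set Y} {d c : ℕ}
    (h : ∀ i, S.CodimAtLeast (A i) d c) : S.CodimAtLeast (⋃ i, A i) d c := by
  choose T h1 h2 h3 using h
  refine ⟨⋃ i, T i, countable_iUnion h1, fun s hs => ?_, iUnion_subset fun i => (h3 i).trans ?_⟩
  · obtain ⟨i, hi⟩ := mem_iUnion.1 hs
    exact h2 i s hi
  · exact biUnion_subset_biUnion_left (subset_iUnion T i)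

theorem CodimAtLeast.biUnion {ι : Type*} {t : Set ι} (ht : t.Countable) {A : ι → Set Y} {d c : ℕ}
    (h : ∀ i ∈ t, S.CodimAtLeast (A i) d c) : S.CodimAtLeast (⋃ i ∈ t, A i) d c := by
  have := ht.to_subtype
  rw [biUnion_eq_iUnion]
  exact iUnion fun i => h i i.2

/-- A subset of a space with charts has large codimension if it is parametrized smoothly, in the
coordinates of one chart, by a set that is covered by smooth images of Euclidean spaces of small
dimension. -/
theorem IsSmooth.codimAtLeast_image (hS : S.IsSmooth)
    (hφ : φ ∈ IsManifold.maximalAtlas (𝓡 n) ∞ M) {W : Type*} [NormedAddCommGroup W]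
    [NormedSpace ℝ W] {B U : Set W} {d c : ℕ} (hB : SmoothlyCovered B d c) (hU : IsOpen U)
    {f : W → Y} (hf : ∀ x ∈ U, f x ∈ S.dom φ) (hfs : ContDiffOn ℝ ∞ (S.chart φ ∘ f) U) :
    S.CodimAtLeast (f '' (B ∩ U)) d c := by
  obtain ⟨T, h1, h2, h3⟩ := hB
  have key : S.CodimAtLeast (⋃ s ∈ T, (f ∘ s.2) '' (s.2 ⁻¹' U)) d c := by
    refine CodimAtLeast.biUnion h1 fun s hs => ?_
    obtain ⟨T', h1', h2', h3'⟩ :=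
      exists_countable_cover_of_isOpen (hU.preimage (h2 s hs).2.continuous)
    refine ⟨(fun g => ⟨s.1, f ∘ s.2 ∘ g⟩) '' T', h1'.image _, ?_, ?_⟩
    · rintro _ ⟨g, hg, rfl⟩
      have hmem : ∀ x, s.2 (g x) ∈ U := fun x => (h2' g hg).2 (mem_range_self x)
      refine ⟨(h2 s hs).1, hS.smooth_of_forall fun p => ⟨φ, hφ,
        Filter.Eventually.of_forall fun x => hf _ (hmem x), ?_⟩⟩
      have : ContDiff ℝ ∞ ((S.chart φ ∘ f) ∘ s.2 ∘ g) := contDiffOn_univ.1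
        (hfs.comp ((h2 s hs).2.comp (h2' g hg).1).contDiffOn fun x _ => hmem x)
      exact this.contMDiff.contMDiffAt
    · rintro _ ⟨x, hx, rfl⟩
      obtain ⟨g, hg, y, rfl⟩ := mem_iUnion₂.1 (h3' hx)
      exact mem_iUnion₂.2 ⟨_, mem_image_of_mem _ hg, y, rfl⟩
  refine key.mono ?_
  rintro _ ⟨x, ⟨hx, hxU⟩, rfl⟩
  obtain ⟨s, hs, y, rfl⟩ := mem_iUnion₂.1 (h3 hx)
  exact mem_iUnion₂.2 ⟨s, hs, y, hxU, rfl⟩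

/-! ### Charts of subsets -/

variable (S I) in
/-- A chart of a subset `A` of `Y` with model `I`: on the open set `nbhd` the chart is the
restriction of a smooth function `coord` of the ambient coordinates given by `φ`, and its inverse
`param` is smooth in these coordinates. -/
structure SubsetChart (A : Set Y) where
  φ : OpenPartialHomeomorph M (EuclideanSpace ℝ (Fin n))
  nbhd : Set Y
  image : Set V
  coord : Z → V
  param : V → Y
  mem_atlas : φ ∈ IsManifold.maximalAtlas (𝓡 n) ∞ M
  isOpen_nbhd : IsOpen nbhd
  isOpen_image : IsOpen image
  nbhd_subset : nbhd ⊆ S.dom φ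
  coord_mem : ∀ y ∈ A, y ∈ nbhd → coord (S.chart φ y) ∈ image ∩ range I
  param_coord : ∀ y ∈ A, y ∈ nbhd → param (coord (S.chart φ y)) = y
  contDiffAt_coord : ∀ y ∈ A, y ∈ nbhd → ContDiffAt ℝ ∞ coord (S.chart φ y)
  param_mem : ∀ w ∈ image ∩ range I, param w ∈ A ∩ nbhd
  coord_param : ∀ w ∈ image ∩ range I, coord (S.chart φ (param w)) = w
  contDiffWithinAt_param : ∀ w ∈ image ∩ range I,
    ContDiffWithinAt ℝ ∞ (S.chart φ ∘ param) (range I) w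

namespace SubsetChart

variable {A : Set Y}

/-- The point of `A` with given coordinates. -/
noncomputable def paramSubtype (D : S.SubsetChart I A) (y₀ : A) (h : H) : A :=
  open Classical in if hh : D.param (I h) ∈ A then ⟨D.param (I h), hh⟩ else y₀

theorem coe_paramSubtype (D : S.SubsetChart I A) (y₀ : A) {h : H} (hh : I h ∈ D.image) :
    (D.paramSubtype y₀ h : Y) = D.param (I h) := by
  rw [paramSubtype, dif_pos (D.param_mem _ ⟨hh, mem_range_self h⟩).1]

theorem I_symm_coord (D : S.SubsetChart I A) {y : Y} (hy : y ∈ A) (hy' : y ∈ D.nbhd) :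
    I (I.symm (D.coord (S.chart D.φ y))) = D.coord (S.chart D.φ y) :=
  I.right_inv (D.coord_mem y hy hy').2

theorem contDiffWithinAt_param' (hS : S.IsSmooth) (D : S.SubsetChart I A) {w : V}
    (hw : w ∈ D.image ∩ range I) (hφ' : φ' ∈ IsManifold.maximalAtlas (𝓡 n) ∞ M)
    (hd : D.param w ∈ S.dom φ') : ContDiffWithinAt ℝ ∞ (S.chart φ' ∘ D.param) (range I) w := by
  have hd' := D.nbhd_subset (D.param_mem w hw).2
  obtain ⟨τ, hτ, hev⟩ := hS.change _ D.mem_atlas φ' hφ' _ hd' hd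
  have hc : ContinuousWithinAt D.param (range I) w := by
    refine hS.tendsto_nhds_iff D.mem_atlas hd' ?_ (D.contDiffWithinAt_param w hw).continuousWithinAt
    filter_upwards [inter_mem_nhdsWithin (range I) (D.isOpen_image.mem_nhds hw.1)] with x hx
    exact D.nbhd_subset (D.param_mem x ⟨hx.2, hx.1⟩).2
  exact (hτ.comp_contDiffWithinAt w (D.contDiffWithinAt_param w hw)).congr_of_eventuallyEq
    (hc.eventually hev) hev.self_of_nhds

/-- The chart of the subspace `A`. -/
noncomputable def toOpenPartialHomeomorph (hS : S.IsSmooth) (D : S.SubsetChart I A) (y₀ : A) :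
    OpenPartialHomeomorph A H where
  toFun y := I.symm (D.coord (S.chart D.φ y))
  invFun := D.paramSubtype y₀
  source := Subtype.val ⁻¹' D.nbhd
  target := I ⁻¹' D.image
  map_source' y hy := by
    rw [mem_preimage, D.I_symm_coord y.2 hy]
    exact (D.coord_mem y y.2 hy).1
  map_target' h hh := by
    rw [mem_preimage, D.coe_paramSubtype y₀ hh]
    exact (D.param_mem _ ⟨hh, mem_range_self h⟩).2
  left_inv' y hy := by
    apply Subtype.ext
    have := D.I_symm_coord y.2 hy
    rw [D.coe_paramSubtype y₀ (by rw [this]; exact (D.coord_mem y y.2 hy).1), this]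
    exact D.param_coord y y.2 hy
  right_inv' h hh := by
    rw [D.coe_paramSubtype y₀ hh, D.coord_param _ ⟨hh, mem_range_self h⟩, I.left_inv]
  open_source := D.isOpen_nbhd.preimage continuous_subtype_val
  open_target := D.isOpen_image.preimage I.continuous
  continuousOn_toFun y hy := by
    have h1 : ContinuousAt (fun y : A => S.chart D.φ y) y :=
      ContinuousAt.comp (hS.continuousAt_chart D.mem_atlas (D.nbhd_subset hy))
        continuous_subtype_val.continuousAt
    have h2 : ContinuousAt (fun y : A => D.coord (S.chart D.φ y)) y :=
      ContinuousAt.comp (f := fun y : A => S.chart D.φ y)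
        (D.contDiffAt_coord y y.2 hy).continuousAt h1
    exact (I.continuous_symm.continuousAt.comp h2).continuousWithinAt
  continuousOn_invFun h hh := by
    apply ContinuousAt.continuousWithinAt
    rw [Topology.IsInducing.subtypeVal.continuousAt_iff]
    have hhw : I h ∈ D.image ∩ range I := ⟨hh, mem_range_self h⟩
    have hopen := (D.isOpen_image.preimage I.continuous).mem_nhds hh
    have h1 : Subtype.val ∘ D.paramSubtype y₀ =ᶠ[𝓝 h] D.param ∘ I := by
      filter_upwards [hopen] with x hx using D.coe_paramSubtype y₀ hx
    refine ContinuousAt.congr ?_ h1.symm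
    refine hS.tendsto_nhds_iff D.mem_atlas (D.nbhd_subset (D.param_mem _ hhw).2) ?_ ?_
    · filter_upwards [hopen] with x hx
      exact D.nbhd_subset (D.param_mem _ ⟨hx, mem_range_self x⟩).2
    · exact (D.contDiffWithinAt_param _ hhw).continuousWithinAt.tendsto.comp
        (tendsto_nhdsWithin_of_tendsto_nhds_of_eventually_within _ I.continuous.continuousAt
          (Filter.Eventually.of_forall fun x => mem_range_self x))

/-- The charted space structure on `A` given by a family of charts. -/
@[reducible]
noncomputable def chartedSpace (hS : S.IsSmooth) (D : A → S.SubsetChart I A)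
    (hD : ∀ y, (y : Y) ∈ (D y).nbhd) : ChartedSpace H A where
  atlas := range fun y => (D y).toOpenPartialHomeomorph hS y
  chartAt y := (D y).toOpenPartialHomeomorph hS y
  mem_chart_source := hD
  chart_mem_atlas := mem_range_self

end SubsetChart

variable (S I) in
/-- A charted space structure on a subset `A` of `Y` that makes it a smooth manifold with corners
immersed into `Y`, and for which the smoothness of maps into `A` can be tested in the coordinates
of `Y`, because the charts of `A` extend locally to smooth functions of these coordinates. -/
structure IsSmoothSubset (A : Set Y) [ChartedSpace H A] : Prop where
  isManifold : IsManifold I ∞ A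
  immersion : S.Immersion I (Subtype.val : A → Y)
  extChartAt_eq : ∀ y : A, ∀ φ ∈ IsManifold.maximalAtlas (𝓡 n) ∞ M, (y : Y) ∈ S.dom φ →
    ∃ L : Z → V, ContDiffAt ℝ ∞ L (S.chart φ y) ∧
      ∀ᶠ y' in 𝓝 y, extChartAt I y y' = L (S.chart φ y')

variable {A : Set Y}

theorem IsSmoothSubset.contMDiffAt_chart [ChartedSpace H A] (h : S.IsSmoothSubset I A)
    (hS : S.IsSmooth) (hφ : φ ∈ IsManifold.maximalAtlas (𝓡 n) ∞ M) {y : A}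
    (hy : (y : Y) ∈ S.dom φ) :
    ContMDiffAt I 𝓘(ℝ, Z) ∞ (fun y : A => S.chart φ y) y :=
  (h.immersion.1.2 φ hφ y hy).contMDiffAt
    (continuous_subtype_val.continuousAt (hS.dom_mem_nhds hφ hy))

theorem IsSmoothSubset.contMDiffAt_of_chart [ChartedSpace H A] (h : S.IsSmoothSubset I A)
    (hS : S.IsSmooth) {V' H' N' : Type*} [NormedAddCommGroup V'] [NormedSpace ℝ V']
    [TopologicalSpace H'] [TopologicalSpace N'] [ChartedSpace H' N']
    {I' : ModelWithCorners ℝ V' H'}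
    (hφ : φ ∈ IsManifold.maximalAtlas (𝓡 n) ∞ M) {g : N' → A} {p : N'}
    (hp : ∀ᶠ x in 𝓝 p, (g x : Y) ∈ S.dom φ)
    (hg : ContMDiffAt I' 𝓘(ℝ, Z) ∞ (fun x => S.chart φ (g x)) p) :
    ContMDiffAt I' I ∞ g p := by
  have hc : ContinuousAt g p := by
    rw [Topology.IsInducing.subtypeVal.continuousAt_iff]
    exact hS.tendsto_nhds_iff hφ hp.self_of_nhds hp hg.continuousAt
  rw [contMDiffAt_iff_target]
  obtain ⟨L, hL, hev⟩ := h.extChartAt_eq (g p) φ hφ hp.self_of_nhds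
  exact ⟨hc, (hL.contMDiffAt.comp p hg).congr_of_eventuallyEq (hc.eventually hev)⟩

namespace SubsetChart

theorem extChartAt_self (hS : S.IsSmooth) (D : A → S.SubsetChart I A)
    (hD : ∀ y, (y : Y) ∈ (D y).nbhd) (y : A) :
    letI := chartedSpace hS D hD
    extChartAt I y y = (D y).coord (S.chart (D y).φ y) :=
  (D y).I_symm_coord y.2 (hD y)

/-- A family of subset charts around all points of `A` defines a smooth structure on `A`. -/
theorem isSmoothSubset (hS : S.IsSmooth) (D : A → S.SubsetChart I A)
    (hD : ∀ y, (y : Y) ∈ (D y).nbhd) :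
    letI := chartedSpace hS D hD
    S.IsSmoothSubset I A := by
  let := chartedSpace hS D hD
  -- The charts of `A` are restrictions of smooth functions of the ambient coordinates.
  have hext : ∀ y : A, ∀ φ' ∈ IsManifold.maximalAtlas (𝓡 n) ∞ M, (y : Y) ∈ S.dom φ' →
      ∃ L : Z → V, ContDiffAt ℝ ∞ L (S.chart φ' y) ∧
        ∀ᶠ y' in 𝓝 y, extChartAt I y y' = L (S.chart φ' y') := by
    intro y φ' hφ' hy
    obtain ⟨τ, hτ, hev⟩ := hS.change φ' hφ' _ (D y).mem_atlas y hy ((D y).nbhd_subset (hD y))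
    have hL := (D y).contDiffAt_coord y y.2 (hD y)
    rw [hev.self_of_nhds] at hL
    refine ⟨(D y).coord ∘ τ, hL.comp _ hτ, ?_⟩
    filter_upwards [continuous_subtype_val.continuousAt.eventually hev,
      continuous_subtype_val.continuousAt ((D y).isOpen_nbhd.mem_nhds (hD y))] with y' h1 h2
    rw [Function.comp_apply, ← h1]
    exact (D y).I_symm_coord y'.2 h2
  -- A coordinate change is the composition of the smooth `param` of one chart with the smooth `coord`
  -- of the other.
  have hman : IsManifold I ∞ A := by
    refine isManifold_of_contDiffOn I ∞ A ?_
    rintro _ _ ⟨y₁, rfl⟩ ⟨y₂, rfl⟩ w ⟨hw, hwI⟩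
    have h1 : w ∈ (D y₁).image ∩ range I := ⟨by
      have : I (I.symm w) ∈ (D y₁).image := hw.1
      rwa [I.right_inv hwI] at this, hwI⟩
    have hmem : ∀ w' ∈ I.symm ⁻¹' ((D y₁).toOpenPartialHomeomorph hS y₁).symm.source ∩
        range I, (((D y₁).paramSubtype y₁ (I.symm w') : A) : Y) = (D y₁).param w' := by
      intro w' hw'
      have : I (I.symm w') ∈ (D y₁).image := hw'.1
      rw [(D y₁).coe_paramSubtype y₁ this, I.right_inv hw'.2]
    have hnb : (D y₁).param w ∈ (D y₂).nbhd := by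
      have : (((D y₁).paramSubtype y₁ (I.symm w) : A) : Y) ∈ (D y₂).nbhd := hw.2
      rwa [hmem w ⟨hw.1, hwI⟩] at this
    have hA : (D y₁).param w ∈ A := ((D y₁).param_mem w h1).1
    have hsm : ContDiffWithinAt ℝ ∞ ((D y₂).coord ∘ S.chart (D y₂).φ ∘ (D y₁).param) (range I) w :=
      ((D y₂).contDiffAt_coord _ hA hnb).comp_contDiffWithinAt w
        ((D y₁).contDiffWithinAt_param' hS h1 (D y₂).mem_atlas ((D y₂).nbhd_subset hnb))
    refine (hsm.mono inter_subset_right).congr (fun w' hw' => ?_) ?_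
    · have e := hmem w' ⟨hw'.1.1, hw'.2⟩
      have hnb' : (((D y₁).paramSubtype y₁ (I.symm w') : A) : Y) ∈ (D y₂).nbhd := hw'.1.2
      have := (D y₂).I_symm_coord ((D y₁).paramSubtype y₁ (I.symm w')).2 hnb'
      simp only [Function.comp_apply, ← e]
      exact this
    · have e := hmem w ⟨hw.1, hwI⟩
      have hnb' : (((D y₁).paramSubtype y₁ (I.symm w) : A) : Y) ∈ (D y₂).nbhd := hw.2
      have := (D y₂).I_symm_coord ((D y₁).paramSubtype y₁ (I.symm w)).2 hnb'
      simp only [Function.comp_apply, ← e]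
      exact this
  have hchart : ∀ φ' ∈ IsManifold.maximalAtlas (𝓡 n) ∞ M, ∀ y : A, (y : Y) ∈ S.dom φ' →
      ContMDiffAt I 𝓘(ℝ, Z) ∞ (fun y : A => S.chart φ' y) y := by
    intro φ' hφ' y hy
    rw [contMDiffAt_iff]
    refine ⟨ContinuousAt.comp (hS.continuousAt_chart hφ' hy)
      continuous_subtype_val.continuousAt, ?_⟩
    have e0 : extChartAt I y y = (D y).coord (S.chart (D y).φ y) := extChartAt_self hS D hD y
    rw [e0]
    have hw := (D y).coord_mem y y.2 (hD y)
    have hp := (D y).param_coord y y.2 (hD y)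
    refine ((D y).contDiffWithinAt_param' hS hw hφ' (by rwa [hp])).congr_of_eventuallyEq_of_mem
      ?_ hw.2
    filter_upwards [inter_mem_nhdsWithin (range I) ((D y).isOpen_image.mem_nhds hw.1)] with w hw'
    have h1 : I (I.symm w) ∈ (D y).image := by rw [I.right_inv hw'.1]; exact hw'.2
    change S.chart φ' (((D y).paramSubtype y (I.symm w) : A) : Y) = _
    rw [(D y).coe_paramSubtype y h1, I.right_inv hw'.1]
    rfl
  refine ⟨hman, ⟨⟨continuous_subtype_val, fun φ' hφ' y hy =>
    (hchart φ' hφ' y hy).contMDiffWithinAt⟩, fun φ' hφ' y hy => ?_⟩, hext⟩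
  obtain ⟨L, hL, hev⟩ := hext y φ' hφ' hy
  have h1 : MDifferentiableAt I 𝓘(ℝ, Z) (fun y : A => S.chart φ' y) y :=
    (hchart φ' hφ' y hy).mdifferentiableAt (by simp)
  have h2 : MDifferentiableAt 𝓘(ℝ, Z) 𝓘(ℝ, V) L (S.chart φ' y) :=
    (hL.differentiableAt (by simp)).mdifferentiableAt
  have h3 : mfderiv I 𝓘(ℝ, V) (extChartAt I y) y =
      (mfderiv 𝓘(ℝ, Z) 𝓘(ℝ, V) L (S.chart φ' y)).comp
        (mfderiv I 𝓘(ℝ, Z) (fun y : A => S.chart φ' y) y) := by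
    rw [← mfderiv_comp y h2 h1]
    exact Filter.EventuallyEq.mfderiv_eq hev
  -- A chart of `A` factors through the ambient coordinates, and its differential is injective.
  have h4 : Function.Injective (mfderiv I 𝓘(ℝ, V) (extChartAt I y) y) :=
    (isInvertible_mfderiv_extChartAt (I := I) (mem_extChartAt_source y)).injective
  rw [h3] at h4
  exact Function.Injective.of_comp h4

/-- A chart of `A` near a point is a chart of any set that agrees with `A` near this point. -/
theorem exists_of_inter_eq (hS : S.IsSmooth) {A' : Set Y} (D : S.SubsetChart I A) {Ω : Set Y}
    (hΩ : IsOpen Ω) (hAA' : A ∩ Ω = A' ∩ Ω) :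
    ∃ D' : S.SubsetChart I A', D'.nbhd = D.nbhd ∩ Ω ∧ D'.φ = D.φ ∧ D'.coord = D.coord := by
  have hmem : ∀ y ∈ A', y ∈ Ω → y ∈ A := fun y hy hy' => (hAA'.symm.subset ⟨hy, hy'⟩).1
  have hmem' : ∀ y ∈ A, y ∈ Ω → y ∈ A' := fun y hy hy' => (hAA'.subset ⟨hy, hy'⟩).1
  have hc : ContinuousOn D.param (D.image ∩ range I) := by
    intro w hw
    refine ContinuousWithinAt.mono (t := range I) ?_ inter_subset_right
    refine hS.tendsto_nhds_iff D.mem_atlas (D.nbhd_subset (D.param_mem w hw).2) ?_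
      (D.contDiffWithinAt_param w hw).continuousWithinAt
    filter_upwards [inter_mem_nhdsWithin (range I) (D.isOpen_image.mem_nhds hw.1)] with x hx
    exact D.nbhd_subset (D.param_mem x ⟨hx.2, hx.1⟩).2
  obtain ⟨O, hO, hOeq⟩ := (continuousOn_iff'.1 hc) Ω hΩ
  have hOm : ∀ w ∈ D.image ∩ range I, w ∈ O ↔ D.param w ∈ Ω := fun w hw =>
    ⟨fun h => (hOeq.symm.subset ⟨h, hw⟩).1, fun h => (hOeq.subset ⟨h, hw⟩).1⟩
  refine ⟨{
    φ := D.φ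
    nbhd := D.nbhd ∩ Ω
    image := D.image ∩ O
    coord := D.coord
    param := D.param
    mem_atlas := D.mem_atlas
    isOpen_nbhd := D.isOpen_nbhd.inter hΩ
    isOpen_image := D.isOpen_image.inter hO
    nbhd_subset := inter_subset_left.trans D.nbhd_subset
    coord_mem := fun y hy hy' => ?_
    param_coord := fun y hy hy' => D.param_coord y (hmem y hy hy'.2) hy'.1
    contDiffAt_coord := fun y hy hy' => D.contDiffAt_coord y (hmem y hy hy'.2) hy'.1
    param_mem := fun w hw => ?_
    coord_param := fun w hw => D.coord_param w ⟨hw.1.1, hw.2⟩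
    contDiffWithinAt_param := fun w hw => D.contDiffWithinAt_param w ⟨hw.1.1, hw.2⟩ },
    rfl, rfl, rfl⟩
  · have h := D.coord_mem y (hmem y hy hy'.2) hy'.1
    refine ⟨⟨h.1, (hOm _ h).2 ?_⟩, h.2⟩
    rw [D.param_coord y (hmem y hy hy'.2) hy'.1]
    exact hy'.2
  · have h := D.param_mem w ⟨hw.1.1, hw.2⟩
    have h' := (hOm w ⟨hw.1.1, hw.2⟩).1 hw.1.2
    exact ⟨hmem' _ h.1 h', h.2, h'⟩

end SubsetChart

/-- A set with charts modelled on a Euclidean space around all its points is a submanifold. -/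
theorem IsSmooth.isSubmanifold (hS : S.IsSmooth) {d : ℕ}
    (h : ∀ y ∈ A, ∃ D : S.SubsetChart (𝓡 d) A, y ∈ D.nbhd) : S.IsSubmanifold A d := by
  choose D hD using fun y : A => h y y.2
  let := SubsetChart.chartedSpace hS D hD
  have key := SubsetChart.isSmoothSubset hS D hD
  exact ⟨this, key.isManifold, key.immersion⟩

end ChartSystem

/-! ### The coordinates on the base and on its blow-up -/

namespace RibbonGraph

variable {F : Type*} [Finite F] {Γ : RibbonGraph F} {n : ℕ} {M : Type*} [TopologicalSpace M]
  {φ φ' : OpenPartialHomeomorph M (EuclideanSpace ℝ (Fin n))}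

variable (Γ n) in
/-- The coordinate space of the blow-up of `X_Γ`. -/
abbrev BlowupCoord : Type _ := (Γ.Edge → Euc n × Euc n × ℝ) × (Γ.Leaf → Euc n)

variable (Γ n) in
/-- The coordinate space of `X_Γ`. -/
abbrev BaseCoord : Type _ := (Γ.Edge → Euc n × Euc n) × (Γ.Leaf → Euc n)

theorem baseCharts_chart (x : Γ.X M) :
    (Γ.baseCharts n M).chart φ x = (fun l => (φ (x.1 l).1, φ (x.1 l).2), fun s => φ (x.2 s)) := rfl

variable [ChartedSpace (EuclideanSpace ℝ (Fin n)) M]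

theorem blowupCharts_chart (y : Γ.Xtilde n M) :
    (Γ.blowupCharts n M).chart φ y = (fun l => (y.1 l).polar φ, fun s => φ (y.2 s)) := rfl

theorem continuous_blowdown :
    Continuous (blowdown : Γ.Xtilde n M → Γ.X M) := by
  refine Continuous.prodMk (continuous_pi fun l => ?_) continuous_snd
  exact DiagBlowup.continuous_blowdown.comp ((continuous_apply l).comp continuous_fst)

/-- The neighbourhoods of a point of a product of a finite family of spaces, embedded by maps `f`
defined on open subsets. -/
theorem nhds_pi_eq_comap {ι : Type*} [Finite ι] {X Z : ι → Type*} [∀ i, TopologicalSpace (X i)]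
    [∀ i, TopologicalSpace (Z i)] {f : ∀ i, X i → Z i} {s : ∀ i, Set (X i)} {x : ∀ i, X i}
    (h : ∀ i, 𝓝 (x i) = Filter.comap (f i) (𝓝 (f i (x i))) ⊓ Filter.principal (s i)) :
    𝓝 x = Filter.comap (fun x i => f i (x i)) (𝓝 fun i => f i (x i)) ⊓
      Filter.principal {x | ∀ i, x i ∈ s i} := by
  have h1 : Filter.principal {x : ∀ i, X i | ∀ i, x i ∈ s i} =
      ⨅ i, Filter.principal (Function.eval i ⁻¹' s i) := by
    rw [Filter.iInf_principal]
    congr 1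
    ext y
    simp
  rw [nhds_pi, nhds_pi, Filter.pi, Filter.pi, Filter.comap_iInf, h1, ← iInf_inf_eq]
  refine iInf_congr fun i => ?_
  rw [h i, Filter.comap_inf, Filter.comap_principal, Filter.comap_comap, Filter.comap_comap]
  rfl

theorem nhds_prod_eq_comap {X X' Z Z' : Type*} [TopologicalSpace X]
    [TopologicalSpace X'] [TopologicalSpace Z] [TopologicalSpace Z'] {f : X → Z} {f' : X' → Z'}
    {s : Set X} {s' : Set X'} {x : X × X'}
    (h : 𝓝 x.1 = Filter.comap f (𝓝 (f x.1)) ⊓ Filter.principal s)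
    (h' : 𝓝 x.2 = Filter.comap f' (𝓝 (f' x.2)) ⊓ Filter.principal s') :
    𝓝 x = Filter.comap (fun x => (f x.1, f' x.2)) (𝓝 (f x.1, f' x.2)) ⊓
      Filter.principal {x | x.1 ∈ s ∧ x.2 ∈ s'} := by
  rw [nhds_prod_eq, nhds_prod_eq, Filter.prod_eq_inf, Filter.prod_eq_inf, h, h']
  simp only [Filter.comap_inf, Filter.comap_principal, Filter.comap_comap]
  have h1 : Filter.principal {x : X × X' | x.1 ∈ s ∧ x.2 ∈ s'} =
      Filter.principal (Prod.fst ⁻¹' s) ⊓ Filter.principal (Prod.snd ⁻¹' s') := by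
    rw [Filter.inf_principal]; rfl
  rw [h1, inf_inf_inf_comm]
  rfl

theorem exists_chart_of_dom_base [IsManifold (𝓡 n) ∞ M] [T2Space M] [NeZero n] (x : Γ.X M) :
    ∃ φ ∈ IsManifold.maximalAtlas (𝓡 n) ∞ M, x ∈ (Γ.baseCharts n M).dom φ := by
  have hM : Nonempty M := by
    obtain ⟨f⟩ := Γ.exists_flag
    by_cases hf : Γ.opp f = f
    · exact ⟨x.2 ⟨f, hf⟩⟩
    · exact ⟨(x.1 ⟨_, f, hf, rfl⟩).1⟩
  obtain ⟨φ, hφ, hs⟩ := exists_chart_of_finite (n := n) (M := M)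
    (s := range (fun l => (x.1 l).1) ∪ range (fun l => (x.1 l).2) ∪ range x.2)
    (((finite_range _).union (finite_range _)).union (finite_range _))
  exact ⟨φ, hφ, fun l => ⟨hs (Or.inl (Or.inl ⟨l, rfl⟩)), hs (Or.inl (Or.inr ⟨l, rfl⟩))⟩,
    fun s => hs (Or.inr ⟨s, rfl⟩)⟩

/-- The change between two charts of `M`, near a point. -/
theorem exists_chart_change (hφ : φ ∈ IsManifold.maximalAtlas (𝓡 n) ∞ M)
    (hφ' : φ' ∈ IsManifold.maximalAtlas (𝓡 n) ∞ M) {x : M} (hx : x ∈ φ.source)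
    (hx' : x ∈ φ'.source) :
    ContDiffAt ℝ ∞ (φ' ∘ φ.symm) (φ x) ∧ ∀ᶠ x' in 𝓝 x, φ' x' = (φ' ∘ φ.symm) (φ x') := by
  constructor
  · rw [← contMDiffAt_iff_contDiffAt]
    refine ContMDiffAt.comp (φ x) ?_ (contMDiffAt_symm_of_mem_maximalAtlas hφ (φ.map_source hx))
    rw [φ.left_inv hx]
    exact contMDiffAt_of_mem_maximalAtlas hφ' hx'
  · filter_upwards [φ.open_source.mem_nhds hx] with x' h
    rw [Function.comp_apply, φ.left_inv h]

variable (Γ n M) in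
theorem isSmooth_baseCharts [IsManifold (𝓡 n) ∞ M] [T2Space M] [NeZero n] :
    (Γ.baseCharts n M).IsSmooth where
  nhds_eq φ hφ x hx := by
    refine nhds_prod_eq_comap (f := fun (a : Γ.Edge → M × M) l => (φ (a l).1, φ (a l).2))
      (f' := fun (b : Γ.Leaf → M) s => φ (b s)) (s := {a | ∀ l, a l ∈ φ.source ×ˢ φ.source})
      (s' := {b | ∀ s, b s ∈ φ.source})
      (nhds_pi_eq_comap (f := fun _ (a : M × M) => (φ a.1, φ a.2)) fun l => ?_)
      (nhds_pi_eq_comap (f := fun _ => φ) fun s => φ.nhds_eq_comap_inf_principal (hx.2 s))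
    exact nhds_prod_eq_comap (φ.nhds_eq_comap_inf_principal (hx.1 l).1)
      (φ.nhds_eq_comap_inf_principal (hx.1 l).2)
  change φ hφ φ' hφ' x hx hx' := by
    let σ : Euc n → Euc n := φ' ∘ φ.symm
    refine ⟨fun z => (fun l => (σ (z.1 l).1, σ (z.1 l).2), fun s => σ (z.2 s)), ?_, ?_⟩
    · refine ContDiffAt.prodMk (contDiffAt_pi.2 fun l => ContDiffAt.prodMk ?_ ?_)
        (contDiffAt_pi.2 fun s => ?_)
      · exact ContDiffAt.comp (𝕜 := ℝ) (f := fun z : Γ.BaseCoord n => (z.1 l).1)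
          ((Γ.baseCharts n M).chart φ x)
          (exists_chart_change hφ hφ' (hx.1 l).1 (hx'.1 l).1).1
          (by apply ContDiff.contDiffAt; fun_prop)
      · exact ContDiffAt.comp (𝕜 := ℝ) (f := fun z : Γ.BaseCoord n => (z.1 l).2)
          ((Γ.baseCharts n M).chart φ x)
          (exists_chart_change hφ hφ' (hx.1 l).2 (hx'.1 l).2).1
          (by apply ContDiff.contDiffAt; fun_prop)
      · exact ContDiffAt.comp (𝕜 := ℝ) (f := fun z : Γ.BaseCoord n => z.2 s)
          ((Γ.baseCharts n M).chart φ x)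
          (exists_chart_change hφ hφ' (hx.2 s) (hx'.2 s)).1
          (by apply ContDiff.contDiffAt; fun_prop)
    · have h1 : ∀ᶠ x' : Γ.X M in 𝓝 x, ∀ l, φ' (x'.1 l).1 = σ (φ (x'.1 l).1) :=
        Filter.eventually_all.2 fun l => (by fun_prop : ContinuousAt
          (fun x : Γ.X M => (x.1 l).1) x).eventually
            (exists_chart_change hφ hφ' (hx.1 l).1 (hx'.1 l).1).2
      have h2 : ∀ᶠ x' : Γ.X M in 𝓝 x, ∀ l, φ' (x'.1 l).2 = σ (φ (x'.1 l).2) :=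
        Filter.eventually_all.2 fun l => (by fun_prop : ContinuousAt
          (fun x : Γ.X M => (x.1 l).2) x).eventually
            (exists_chart_change hφ hφ' (hx.1 l).2 (hx'.1 l).2).2
      have h3 : ∀ᶠ x' : Γ.X M in 𝓝 x, ∀ s, φ' (x'.2 s) = σ (φ (x'.2 s)) :=
        Filter.eventually_all.2 fun s => (by fun_prop : ContinuousAt
          (fun x : Γ.X M => x.2 s) x).eventually
            (exists_chart_change hφ hφ' (hx.2 s) (hx'.2 s)).2
      filter_upwards [h1, h2, h3] with x' h1 h2 h3
      rw [baseCharts_chart, baseCharts_chart]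
      simp only [h1, h2, h3]
  exists_chart := exists_chart_of_dom_base

variable (Γ n M) in
theorem isSmooth_blowupCharts [IsManifold (𝓡 n) ∞ M] [T2Space M] [NeZero n] :
    (Γ.blowupCharts n M).IsSmooth where
  nhds_eq φ hφ y hy := by
    exact nhds_prod_eq_comap
      (f := fun (a : Γ.Edge → DiagBlowup n M) l => (a l).polar φ)
      (f' := fun (b : Γ.Leaf → M) s => φ (b s)) (s := {a | ∀ l, a l ∈ DiagBlowup.polarDom φ})
      (s' := {b | ∀ s, b s ∈ φ.source})
      (nhds_pi_eq_comap (f := fun _ (a : DiagBlowup n M) => a.polar φ) fun l =>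
        DiagBlowup.nhds_eq_comap_polar hφ (hy.1 l))
      (nhds_pi_eq_comap (f := fun _ => φ) fun s => φ.nhds_eq_comap_inf_principal (hy.2 s))
  change φ hφ φ' hφ' y hy hy' := by
    let σ : Euc n → Euc n := φ' ∘ φ.symm
    choose τ hτ hev using fun l => DiagBlowup.exists_polar_change hφ hφ' (hy.1 l) (hy'.1 l)
    refine ⟨fun z => (fun l => τ l (z.1 l), fun s => σ (z.2 s)), ?_, ?_⟩
    · refine ContDiffAt.prodMk (contDiffAt_pi.2 fun l => ?_) (contDiffAt_pi.2 fun s => ?_)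
      · exact ContDiffAt.comp (f := fun z : Γ.BlowupCoord n => z.1 l) _ (hτ l)
          (by apply ContDiff.contDiffAt; fun_prop)
      · exact ContDiffAt.comp (𝕜 := ℝ) (f := fun z : Γ.BlowupCoord n => z.2 s)
          ((Γ.blowupCharts n M).chart φ y)
          (exists_chart_change hφ hφ' (hy.2 s) (hy'.2 s)).1
          (by apply ContDiff.contDiffAt; fun_prop)
    · have h1 : ∀ᶠ y' : Γ.Xtilde n M in 𝓝 y, ∀ l, (y'.1 l).polar φ' = τ l ((y'.1 l).polar φ) := by
        refine Filter.eventually_all.2 fun l => ?_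
        have hc : ContinuousAt (fun y : Γ.Xtilde n M => y.1 l) y := by fun_prop
        have h4 := hc.eventually (DiagBlowup.isOpen_polarDom.mem_nhds (hy.1 l))
        have h5 : ContinuousAt (fun z : DiagBlowup n M => z.polar φ) (y.1 l) := by
          rw [ContinuousAt, DiagBlowup.nhds_eq_comap_polar hφ (hy.1 l)]
          exact Filter.tendsto_comap.mono_left inf_le_left
        filter_upwards [h4, hc.eventually (h5.eventually (hev l))] with y' h6 h7
        exact (h7 _ h6 rfl).2
      have h3 : ∀ᶠ y' : Γ.Xtilde n M in 𝓝 y, ∀ s, φ' (y'.2 s) = σ (φ (y'.2 s)) :=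
        Filter.eventually_all.2 fun s => (by fun_prop : ContinuousAt
          (fun y : Γ.Xtilde n M => y.2 s) y).eventually
            (exists_chart_change hφ hφ' (hy.2 s) (hy'.2 s)).2
      filter_upwards [h1, h3] with y' h1 h3
      rw [blowupCharts_chart, blowupCharts_chart]
      simp only [h1, h3]
  exists_chart y := exists_chart_of_dom_base (blowdown y)

end RibbonGraph

/-! ### Cycles and potentials -/

namespace RibbonGraph

variable {F : Type*} [Finite F] {Γ : RibbonGraph F}

noncomputable instance : Fintype Γ.Vert := Fintype.ofFinite _

namespace EdgeOrientation

variable (o : Γ.EdgeOrientation) (n : ℕ) (J : Finset Γ.Edge)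

/-- The differences of a potential along the edges in `J`. -/
noncomputable def coboundary : (Γ.Vert → Euc n) →L[ℝ] (J → Euc n) where
  toFun u j := u (o.head j.1) - u (o.tail j.1)
  map_add' u v := by
    funext j
    simp only [Pi.add_apply]
    abel
  map_smul' c u := by
    funext j
    simp only [Pi.smul_apply, smul_sub, RingHom.id_apply]
  cont := by fun_prop

variable {n J}

@[simp]
theorem coboundary_apply (u : Γ.Vert → Euc n) (j : J) :
    o.coboundary n J u j = u (o.head j.1) - u (o.tail j.1) := rfl

/-- An integral 1-chain of `Γ_J` with boundary `w - v`. -/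
def IsChain (v w : Γ.Vert) (c : J → ℤ) : Prop :=
  open Classical in
  ∀ x : Γ.Vert, ∑ j : J, c j * ((if o.head j.1 = x then 1 else 0) -
    (if o.tail j.1 = x then 1 else 0)) = (if w = x then 1 else 0) - (if v = x then 1 else 0)

variable {o}

theorem IsChain.add {v w x : Γ.Vert} {c c' : J → ℤ} (h : o.IsChain v w c)
    (h' : o.IsChain w x c') : o.IsChain v x (c + c') := fun y => by
  simp only [Pi.add_apply, add_mul, Finset.sum_add_distrib, h y, h' y]
  ring

theorem IsChain.neg {v w : Γ.Vert} {c : J → ℤ} (h : o.IsChain v w c) : o.IsChain w v (-c) :=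
  fun y => by
    simp only [Pi.neg_apply, neg_mul, Finset.sum_neg_distrib, h y]
    ring

theorem isChain_zero (v : Γ.Vert) : o.IsChain v v (0 : J → ℤ) := fun y => by simp

open Classical in
theorem isChain_single (j : J) : o.IsChain (o.tail j.1) (o.head j.1) (Pi.single j 1) := fun y => by
  rw [Finset.sum_eq_single j]
  · simp
  · intro i _ hi
    simp [Pi.single_eq_of_ne hi]
  · simp

theorem isChain_self_iff (v : Γ.Vert) (c : J → ℤ) : o.IsChain v v c ↔ o.IsCycle J c := by
  simp [IsChain, IsCycle]

/-- Stokes' theorem for 1-chains. -/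
theorem IsChain.sum_smul {v w : Γ.Vert} {c : J → ℤ} (h : o.IsChain v w c)
    (u : Γ.Vert → Euc n) : ∑ j, c j • o.coboundary n J u j = u w - u v := by
  classical
  have hu : ∀ v, u v = ∑ x, (if v = x then (1 : ℤ) else 0) • u x := fun v => by
    rw [Finset.sum_eq_single v] <;> simp +contextual [eq_comm]
  calc ∑ j, c j • o.coboundary n J u j
      = ∑ j, c j • (∑ x, ((if o.head j.1 = x then (1 : ℤ) else 0) -
          (if o.tail j.1 = x then (1 : ℤ) else 0)) • u x) := by
        refine Finset.sum_congr rfl fun j _ => ?_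
        rw [coboundary_apply, hu (o.head j.1), hu (o.tail j.1), ← Finset.sum_sub_distrib]
        simp only [sub_smul]
    _ = ∑ x, (∑ j, c j * ((if o.head j.1 = x then (1 : ℤ) else 0) -
          (if o.tail j.1 = x then (1 : ℤ) else 0))) • u x := by
        simp only [Finset.smul_sum, Finset.sum_smul, smul_smul]
        exact Finset.sum_comm
    _ = ∑ x, (((if w = x then (1 : ℤ) else 0) - (if v = x then (1 : ℤ) else 0))) • u x := by
        refine Finset.sum_congr rfl fun x _ => ?_
        congr 1
        convert h x
    _ = u w - u v := by
        rw [hu w, hu v, ← Finset.sum_sub_distrib]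
        simp only [sub_smul]

variable (o J) in
/-- Two vertices are connected by a path of edges in `J`. -/
def Joined : Γ.Vert → Γ.Vert → Prop :=
  Relation.EqvGen fun v w => ∃ j : J, o.tail j.1 = v ∧ o.head j.1 = w

theorem Joined.exists_isChain {v w : Γ.Vert} (h : o.Joined J v w) :
    ∃ c : J → ℤ, o.IsChain v w c := by
  classical
  induction h with
  | rel v w h =>
    obtain ⟨j, rfl, rfl⟩ := h
    exact ⟨_, isChain_single j⟩
  | refl v => exact ⟨0, isChain_zero v⟩
  | symm v w _ ih => exact ih.imp' (fun c => -c) fun c hc => hc.neg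
  | trans u v w _ _ ih ih' =>
    obtain ⟨c, hc⟩ := ih
    obtain ⟨c', hc'⟩ := ih'
    exact ⟨_, hc.add hc'⟩

theorem joined_tail_head (j : J) : o.Joined J (o.tail j.1) (o.head j.1) :=
  Relation.EqvGen.rel _ _ ⟨j, rfl, rfl⟩

variable (o n J) in
/-- The cycle equations say that `x` is the coboundary of a potential. -/
theorem cycleSpace_eq_range :
    o.cycleSpace n J = (LinearMap.range (o.coboundary n J).toLinearMap : Set (J → Euc n)) := by
  classical
  ext x
  constructor
  · intro hx
    -- The potential at `v` is the sum of `x` along a path from the root of the component of `v`.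
    let s : Setoid Γ.Vert := ⟨o.Joined J, Relation.EqvGen.is_equivalence _⟩
    let root : Γ.Vert → Γ.Vert := fun v => (Quotient.mk s v).out
    have hroot : ∀ v, o.Joined J (root v) v := fun v => Quotient.exact (s := s) (Quotient.out_eq _)
    choose c hc using fun v => (hroot v).exists_isChain
    refine ⟨fun v => ∑ j, c v j • x j, ?_⟩
    funext j
    have hr : root (o.head j.1) = root (o.tail j.1) := by
      have : Quotient.mk s (o.head j.1) = Quotient.mk s (o.tail j.1) :=
        Quotient.sound (Relation.EqvGen.symm _ _ (joined_tail_head j))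
      simp only [root, this]
    have hcyc : o.IsCycle J (c (o.tail j.1) + Pi.single j 1 + -c (o.head j.1)) := by
      rw [← isChain_self_iff (root (o.tail j.1))]
      have := (hc (o.head j.1)).neg
      rw [hr] at this
      exact ((hc _).add (isChain_single j)).add this
    have := hx _ hcyc
    simp only [Pi.add_apply, Pi.neg_apply, add_smul, neg_smul, Finset.sum_add_distrib,
      Finset.sum_neg_distrib] at this
    have h1 : ∑ i, (Pi.single j 1 : J → ℤ) i • x i = x j := by
      rw [Finset.sum_eq_single j] <;> simp +contextual [Pi.single_eq_of_ne]
    rw [h1, ← sub_eq_add_neg, sub_eq_zero] at this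
    simp only [ContinuousLinearMap.coe_coe, coboundary_apply, ← this]
    abel
  · rintro ⟨u, rfl⟩ c hc
    rw [← isChain_self_iff (Classical.arbitrary Γ.Vert)] at hc
    exact (hc.sum_smul u).trans (sub_self _)

variable (n) in
/-- If `Γ_J` is connected, a potential on its vertices is determined up to its value at `a` by its
coboundary, through a linear formula. -/
theorem exists_potential (a : Γ.Vert) (h : ∀ v ∈ o.vertOf J, o.Joined J a v) :
    ∃ s : (J → Euc n) →L[ℝ] (Γ.Vert → Euc n),
      (∀ u, ∀ v ∈ o.vertOf J, s (o.coboundary n J u) v = u v - u a) ∧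
      ∀ x, ∀ v ∉ o.vertOf J, s x v = 0 := by
  classical
  choose! c hc using fun v hv => (h v hv).exists_isChain
  let s : (J → Euc n) →L[ℝ] (Γ.Vert → Euc n) := ContinuousLinearMap.pi fun v =>
    if v ∈ o.vertOf J then
      ∑ j, c v j • (ContinuousLinearMap.proj j : (J → Euc n) →L[ℝ] Euc n) else 0
  refine ⟨s, fun u v hv => ?_, fun x v hv => ?_⟩
  · simp only [s, ContinuousLinearMap.coe_pi', if_pos hv]
    rw [← (hc v hv).sum_smul u]
    simp
  · simp [s, if_neg hv]

theorem tail_mem_vertOf {j : Γ.Edge} (hj : j ∈ J) : o.tail j ∈ o.vertOf J :=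
  ⟨j, hj, Or.inl rfl⟩

theorem head_mem_vertOf {j : Γ.Edge} (hj : j ∈ J) : o.head j ∈ o.vertOf J :=
  ⟨j, hj, Or.inr rfl⟩

/-! ### Rigid multirays -/

variable (o) in
/-- The coefficients `c` for which the vectors `c j • θ j` satisfy the cycle equations. -/
noncomputable def rays (θ : J → Euc n) : Submodule ℝ (J → ℝ) :=
  (LinearMap.range (o.coboundary n J).toLinearMap).comap
    (LinearMap.pi fun j => (LinearMap.proj j : (J → ℝ) →ₗ[ℝ] ℝ).smulRight (θ j))

theorem mem_rays {θ : J → Euc n} {c : J → ℝ} :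
    c ∈ o.rays θ ↔ ∃ u, ∀ j, o.coboundary n J u j = c j • θ j := by
  constructor
  · rintro ⟨u, hu⟩
    exact ⟨u, fun j => congrFun hu j⟩
  · rintro ⟨u, hu⟩
    exact ⟨u, funext hu⟩

variable (o) in
/-- The multiray `θ` contains a solution of the cycle equations with positive coefficients, and
this solution is unique up to scaling, even without positivity. -/
def IsRigid (θ : J → Euc n) : Prop :=
  ∃ c ∈ o.rays θ, (∀ j, 0 < c j) ∧ ∀ c' ∈ o.rays θ, ∃ t : ℝ, c' = t • c

variable (o n J) in
/-- The multirays, represented by unit vectors, that contain a solution of the cycle equations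
with positive coefficients. -/
def directionSet : Set (J → Euc n) :=
  {θ | (∀ j, ‖θ j‖ = 1) ∧ ∃ c ∈ o.rays θ, ∀ j, 0 < c j}

variable (o n J) in
/-- The multirays that contain a nonzero solution of the cycle equations with nonnegative coefficients
that vanish on the edges in `I`. The coefficients are normalized to have sum `1`. -/
def degenerateSet (I : Finset Γ.Edge) : Set (J → Euc n) :=
  {θ | ∃ c ∈ stdSimplex ℝ J, (∀ j : J, j.1 ∈ I → c j = 0) ∧ c ∈ o.rays θ}

variable (o n J) in
/-- The coefficients vary in the standard simplex, which is compact. -/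
theorem isClosed_degenerateSet (I : Finset Γ.Edge) : IsClosed (o.degenerateSet n J I) := by
  let K : Set (J → ℝ) := stdSimplex ℝ J
  have hK : CompactSpace K := isCompact_iff_compactSpace.1 (isCompact_stdSimplex ℝ J)
  let C : Set (K × (J → Euc n)) :=
    {p | (∀ j : J, j.1 ∈ I → p.1.1 j = 0) ∧
      (fun j => p.1.1 j • p.2 j) ∈ LinearMap.range (o.coboundary n J).toLinearMap}
  have hcont : ∀ j, Continuous fun p : K × (J → Euc n) => p.1.1 j := fun j =>
    (continuous_apply j).comp (continuous_subtype_val.comp continuous_fst)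
  have hC : IsClosed C := by
    refine IsClosed.inter ?_ ?_
    · have : {p : K × (J → Euc n) | ∀ j : J, j.1 ∈ I → p.1.1 j = 0} =
          ⋂ (j : J) (_ : j.1 ∈ I), {p | p.1.1 j = 0} := by ext; simp
      change IsClosed {p : K × (J → Euc n) | ∀ j : J, j.1 ∈ I → p.1.1 j = 0}
      rw [this]
      exact isClosed_iInter fun j => isClosed_iInter fun _ =>
        isClosed_eq (hcont j) continuous_const
    · exact (LinearMap.range (o.coboundary n J).toLinearMap).closed_of_finiteDimensional.preimage
        (f := fun p : K × (J → Euc n) => fun j => p.1.1 j • p.2 j)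
        (continuous_pi fun j => (hcont j).smul ((continuous_apply j).comp continuous_snd))
  have : o.degenerateSet n J I = Prod.snd '' C := by
    ext θ
    constructor
    · rintro ⟨c, hc, h0, hr⟩
      exact ⟨(⟨c, hc⟩, θ), ⟨h0, hr⟩, rfl⟩
    · rintro ⟨⟨c, θ⟩, ⟨h0, hr⟩, rfl⟩
      exact ⟨c.1, c.2, h0, hr⟩
  rw [this]
  exact isClosedMap_snd_of_compactSpace _ hC

theorem exists_mem_stdSimplex_smul {c : J → ℝ} (hc : ∀ j, 0 ≤ c j) (hc' : ∃ j, 0 < c j) :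
    ∃ t : ℝ, 0 < t ∧ t • c ∈ stdSimplex ℝ J := by
  obtain ⟨j, hj⟩ := hc'
  have hs : 0 < ∑ i, c i := Finset.sum_pos' (fun i _ => hc i) ⟨j, Finset.mem_univ _, hj⟩
  refine ⟨(∑ i, c i)⁻¹, inv_pos.2 hs, fun i => ?_, ?_⟩
  · exact mul_nonneg (inv_nonneg.2 hs.le) (hc i)
  · simp only [Pi.smul_apply, smul_eq_mul, ← Finset.mul_sum]
    exact inv_mul_cancel₀ hs.ne'

variable (o n) in
theorem closure_directionSet_subset (hJ : J.Nonempty) :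
    closure (o.directionSet n J) ⊆ o.degenerateSet n J ∅ := by
  refine closure_minimal ?_ (o.isClosed_degenerateSet n J ∅)
  rintro θ ⟨-, c, hc, hpos⟩
  obtain ⟨j, hj⟩ := hJ
  obtain ⟨t, -, ht⟩ := exists_mem_stdSimplex_smul (fun j => (hpos j).le) ⟨⟨j, hj⟩, hpos _⟩
  exact ⟨t • c, ht, by simp, Submodule.smul_mem _ _ hc⟩

theorem norm_eq_one_of_mem_closure {θ : J → Euc n} (h : θ ∈ closure (o.directionSet n J)) (j : J) :
    ‖θ j‖ = 1 := by
  have : IsClosed {θ : J → Euc n | ‖θ j‖ = 1} := isClosed_eq (by fun_prop) continuous_const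
  exact closure_minimal (fun θ hθ => hθ.1 j) this h

theorem restrict_mem_rays {I : Finset Γ.Edge} (hIJ : I ⊆ J) {θ : J → Euc n} {c : J → ℝ}
    (hc : c ∈ o.rays θ) :
    (fun i : I => c ⟨i.1, hIJ i.2⟩) ∈ o.rays fun i : I => θ ⟨i.1, hIJ i.2⟩ := by
  obtain ⟨u, hu⟩ := mem_rays.1 hc
  exact mem_rays.2 ⟨u, fun i => hu ⟨i.1, hIJ i.2⟩⟩

theorem restrict_mem_closure_directionSet {I : Finset Γ.Edge} (hIJ : I ⊆ J) {θ : J → Euc n}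
    (h : θ ∈ closure (o.directionSet n J)) :
    (fun i : I => θ ⟨i.1, hIJ i.2⟩) ∈ closure (o.directionSet n I) := by
  refine map_mem_closure (f := fun (θ : J → Euc n) (i : I) => θ ⟨i.1, hIJ i.2⟩) (by fun_prop) h ?_
  rintro θ ⟨h1, c, hc, hpos⟩
  exact ⟨fun i => h1 _, _, restrict_mem_rays hIJ hc, fun i => hpos _⟩

/-- A multiray that is a limit of directions of solutions is rigid, or else it contains a nonzero
solution with some vanishing components: two independent positive solutions have a nonnegative
combination on the boundary of the positive orthant. -/
theorem exists_degenerate_of_not_isRigid (hJ : J.Nonempty) {θ : J → Euc n}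
    (h : θ ∈ closure (o.directionSet n J)) (hθ : ¬ o.IsRigid θ) :
    ∃ c ∈ o.rays θ, (∀ j, 0 ≤ c j) ∧ (∃ j, c j = 0) ∧ ∃ j, 0 < c j := by
  obtain ⟨c, ⟨hc0, hc1⟩, -, hc⟩ := o.closure_directionSet_subset n hJ h
  have hex : ∃ j, 0 < c j := by
    by_contra! hcon
    have : ∑ j, c j ≤ 0 := Finset.sum_nonpos fun j _ => hcon j
    linarith
  by_cases h0 : ∃ j, c j = 0
  · exact ⟨c, hc, hc0, h0, hex⟩
  have hpos : ∀ j, 0 < c j := fun j => lt_of_le_of_ne (hc0 j) fun h => h0 ⟨j, h.symm⟩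
  obtain ⟨c', hc', hcc'⟩ : ∃ c' ∈ o.rays θ, ∀ t : ℝ, c' ≠ t • c := by
    by_contra! hcon
    exact hθ ⟨c, hc, hpos, hcon⟩
  -- after a change of sign, `c'` has a positive component
  obtain ⟨d, hd, hdc, i, hi⟩ : ∃ d ∈ o.rays θ, (∀ t : ℝ, d ≠ t • c) ∧ ∃ i, 0 < d i := by
    by_cases hp : ∃ i, 0 < c' i
    · exact ⟨c', hc', hcc', hp⟩
    · push Not at hp
      refine ⟨-c', Submodule.neg_mem _ hc', fun t ht => hcc' (-t) ?_, ?_⟩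
      · rw [neg_smul, ← ht, neg_neg]
      · by_contra! hcon
        refine hcc' 0 (funext fun j => ?_)
        have h1 := hcon j
        simp only [Pi.neg_apply] at h1
        simpa using le_antisymm (hp j) (by linarith)
  obtain ⟨k, hk, hmin⟩ := Finset.exists_min_image (Finset.univ.filter fun j => 0 < d j)
    (fun j => c j / d j) ⟨i, by simpa using hi⟩
  have hdk : 0 < d k := by simpa using hk
  -- the largest multiple of `d` that can be subtracted from `c` without leaving the orthant
  let s := c k / d k
  have hs : 0 < s := div_pos (hpos k) hdk
  have hnn : ∀ j, 0 ≤ (c - s • d) j := by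
    intro j
    simp only [Pi.sub_apply, Pi.smul_apply, smul_eq_mul, sub_nonneg]
    rcases le_or_gt (d j) 0 with hj | hj
    · exact (mul_nonpos_of_nonneg_of_nonpos hs.le hj).trans (hpos j).le
    · have := hmin j (by simpa using hj)
      rwa [le_div_iff₀ hj] at this
  refine ⟨c - s • d, Submodule.sub_mem _ hc (Submodule.smul_mem _ _ hd), hnn, ⟨k, ?_⟩, ?_⟩
  · simp [s, hdk.ne']
  · by_contra! hcon
    refine hdc s⁻¹ ?_
    have : c - s • d = 0 := funext fun j => le_antisymm (hcon j) (hnn j)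
    rw [sub_eq_zero.1 this, smul_smul, inv_mul_cancel₀ hs.ne', one_smul]

/-- A rigid multiray admits no degenerate solution, even after changes of signs. -/
theorem IsRigid.notMem_degenerateSet {θ θ' : J → Euc n} (h : o.IsRigid θ)
    (hθ' : ∀ j, ∃ ε : ℝ, θ' j = ε • θ j ∧ ε ≠ 0) {I : Finset Γ.Edge} {i : J} (hi : i.1 ∈ I) :
    θ' ∉ o.degenerateSet n J I := by
  rintro ⟨c', ⟨-, hc1⟩, hI, hc'⟩
  obtain ⟨c, hc, hpos, huniq⟩ := h
  choose ε hε hε0 using hθ'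
  obtain ⟨u, hu⟩ := mem_rays.1 hc'
  obtain ⟨t, ht⟩ := huniq (fun j => c' j * ε j)
    (mem_rays.2 ⟨u, fun j => by rw [hu, hε, smul_smul]⟩)
  have h1 := congrFun ht i
  rw [hI i hi, zero_mul, Pi.smul_apply, smul_eq_mul] at h1
  have ht0 : t = 0 := (mul_eq_zero.1 h1.symm).resolve_right (hpos i).ne'
  have : ∀ j, c' j = 0 := fun j => by
    have := congrFun ht j
    rw [ht0, zero_smul] at this
    exact (mul_eq_zero.1 this).resolve_right (hε0 j)
  simp [this] at hc1

/-- The graph `Γ_J` is connected if it has a rigid multiray, as otherwise the solutions could be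
scaled on the components separately. -/
theorem IsRigid.joined {θ : J → Euc n} (h : o.IsRigid θ) {a v : Γ.Vert} (ha : a ∈ o.vertOf J)
    (hv : v ∈ o.vertOf J) : o.Joined J a v := by
  classical
  obtain ⟨c, hc, hpos, huniq⟩ := h
  obtain ⟨u, hu⟩ := mem_rays.1 hc
  have hth : ∀ j : J, o.Joined J a (o.tail j.1) ↔ o.Joined J a (o.head j.1) := fun j =>
    ⟨fun h => h.trans _ _ _ (joined_tail_head j),
      fun h => h.trans _ _ _ ((joined_tail_head j).symm _ _)⟩
  -- the solution `c` on the component of `a`, and zero on the other components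
  let c' : J → ℝ := fun j => if o.Joined J a (o.tail j.1) then c j else 0
  have hc' : c' ∈ o.rays θ := by
    refine mem_rays.2 ⟨fun v => if o.Joined J a v then u v else 0, fun j => ?_⟩
    have := hu j
    rw [coboundary_apply] at this
    by_cases hj : o.Joined J a (o.tail j.1)
    · simp [c', hj, (hth j).1 hj, this]
    · have hj' : ¬ o.Joined J a (o.head j.1) := fun h => hj ((hth j).2 h)
      simp [c', hj, hj']
  obtain ⟨t, ht⟩ := huniq c' hc'
  have hmem : ∀ w ∈ o.vertOf J, ∃ j : J, o.Joined J a (o.tail j.1) ↔ o.Joined J a w := by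
    rintro w ⟨j, hj, rfl | rfl⟩
    · exact ⟨⟨j, hj⟩, Iff.rfl⟩
    · exact ⟨⟨j, hj⟩, hth ⟨j, hj⟩⟩
  obtain ⟨i, hi⟩ := hmem a ha
  obtain ⟨j, hj⟩ := hmem v hv
  have h1 := congrFun ht i
  have hia : o.Joined J a (o.tail i.1) := hi.2 (Relation.EqvGen.refl _)
  simp only [c', if_pos hia, Pi.smul_apply, smul_eq_mul] at h1
  have ht1 : t = 1 := by
    have := (hpos i).ne'
    field_simp at h1
    exact h1.symm
  have h2 := congrFun ht j
  rw [ht1, one_smul] at h2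
  by_contra hcon
  have hjn : ¬ o.Joined J a (o.tail j.1) := fun h => hcon (hj.1 h)
  simp only [c', if_neg hjn] at h2
  exact (hpos j).ne h2

end EdgeOrientation

end RibbonGraph

/-! ### Positions in the coordinates of the blow-up -/

namespace RibbonGraph

variable {F : Type*} [Finite F] {Γ : RibbonGraph F} {o : Γ.EdgeOrientation} {n : ℕ}
  {M : Type*} [TopologicalSpace M] [ChartedSpace (EuclideanSpace ℝ (Fin n)) M]
  {φ : OpenPartialHomeomorph M (EuclideanSpace ℝ (Fin n))} {J : Finset Γ.Edge}

namespace EdgeOrientation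

variable (o) in
/-- The coordinates `z` are those of a configuration of vertices with positions `u`. -/
def IsPosition (z : Γ.BlowupCoord n) (u : Γ.Vert → Euc n) : Prop :=
  (∀ l, (z.1 l).1 = u (o.tail l) ∧ (z.1 l).1 + (z.1 l).2.2 • (z.1 l).2.1 = u (o.head l)) ∧
    ∀ s : Γ.Leaf, z.2 s = u (Γ.vert s.1)

variable (Γ) in
/-- The edge of a flag that is not a leaf. -/
def _root_.RibbonGraph.edgeOf (f : F) (h : Γ.opp f ≠ f) : Γ.Edge := ⟨{f, Γ.opp f}, f, h, rfl⟩

open Classical in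
variable (o) in
/-- The position of a flag, read off from the coordinates of its edge or leaf. -/
noncomputable def flagCoord (z : Γ.BlowupCoord n) (f : F) : Euc n :=
  if h : Γ.opp f = f then z.2 ⟨f, h⟩
  else if o.out (Γ.edgeOf f h) = f then (z.1 (Γ.edgeOf f h)).1
  else (z.1 (Γ.edgeOf f h)).1 + (z.1 (Γ.edgeOf f h)).2.2 • (z.1 (Γ.edgeOf f h)).2.1

theorem out_edgeOf (f : F) (h : Γ.opp f ≠ f) :
    o.out (Γ.edgeOf f h) = f ∨ o.out (Γ.edgeOf f h) = Γ.opp f :=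
  o.out_mem (Γ.edgeOf f h)

theorem vert_cases {P : Γ.Vert → Prop} (ht : ∀ l, P (o.tail l)) (hh : ∀ l, P (o.head l))
    (hs : ∀ s : Γ.Leaf, P (Γ.vert s.1)) (v : Γ.Vert) : P v := by
  obtain ⟨f, rfl⟩ : ∃ f, Γ.vert f = v := Quotient.exists_rep v
  by_cases h : Γ.opp f = f
  · exact hs ⟨f, h⟩
  · rcases out_edgeOf (o := o) f h with hl | hl
    · have := ht (Γ.edgeOf f h)
      rwa [tail, hl] at this
    · have := hh (Γ.edgeOf f h)
      rwa [head, hl, Γ.opp_opp] at this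

theorem IsPosition.flagCoord {z : Γ.BlowupCoord n} {u : Γ.Vert → Euc n} (h : o.IsPosition z u)
    (f : F) : o.flagCoord z f = u (Γ.vert f) := by
  unfold EdgeOrientation.flagCoord
  split_ifs with hf hl
  · exact h.2 _
  · rw [(h.1 _).1, tail, hl]
  · rw [(h.1 _).2, head]
    rw [(out_edgeOf f hf).resolve_left hl, Γ.opp_opp]

variable (o) in
/-- The positions of the vertices, as a polynomial function of the coordinates. -/
noncomputable def posCoord (z : Γ.BlowupCoord n) (v : Γ.Vert) : Euc n :=
  o.flagCoord z (Quotient.out (s := Equiv.Perm.SameCycle.setoid Γ.next) v)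

theorem IsPosition.posCoord {z : Γ.BlowupCoord n} {u : Γ.Vert → Euc n} (h : o.IsPosition z u) :
    o.posCoord z = u := by
  funext v
  rw [EdgeOrientation.posCoord, h.flagCoord]
  exact congrArg u (Quotient.out_eq (s := Equiv.Perm.SameCycle.setoid Γ.next) v)

variable (o n) in
theorem contDiff_posCoord :
    ContDiff ℝ ∞ (o.posCoord : Γ.BlowupCoord n → Γ.Vert → Euc n) := by
  refine contDiff_pi.2 fun v => ?_
  unfold posCoord flagCoord
  split_ifs <;> fun_prop

theorem isPosition_of_blowdown_eq {y : Γ.Xtilde n M} {p : Γ.Vert → M}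
    (h : blowdown y = o.reorder (p ∘ Γ.vert)) :
    o.IsPosition ((Γ.blowupCharts n M).chart φ y) (φ ∘ p) := by
  have h1 : ∀ l, (y.1 l).blowdown = (p (o.tail l), p (o.head l)) := fun l =>
    congrFun (congrArg Prod.fst h) l
  have h2 : ∀ s : Γ.Leaf, y.2 s = p (Γ.vert s.1) := fun s => congrFun (congrArg Prod.snd h) s
  refine ⟨fun l => ⟨?_, ?_⟩, fun s => congrArg φ (h2 s)⟩
  · rw [blowupCharts_chart, DiagBlowup.polar_fst, h1]; rfl
  · rw [blowupCharts_chart, DiagBlowup.polar_add_smul, h1]; rfl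

theorem mem_source_of_blowdown_eq {y : Γ.Xtilde n M} {p : Γ.Vert → M}
    (h : blowdown y = o.reorder (p ∘ Γ.vert)) (hy : y ∈ (Γ.blowupCharts n M).dom φ)
    (v : Γ.Vert) : p v ∈ φ.source := by
  have h1 : ∀ l, (y.1 l).blowdown = (p (o.tail l), p (o.head l)) := fun l =>
    congrFun (congrArg Prod.fst h) l
  have h2 : ∀ s : Γ.Leaf, y.2 s = p (Γ.vert s.1) := fun s => congrFun (congrArg Prod.snd h) s
  refine vert_cases (o := o) (P := fun v => p v ∈ φ.source) (fun l => ?_) (fun l => ?_)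
    (fun s => ?_) v
  · have := (hy.1 l).1
    change (y.1 l).blowdown.1 ∈ φ.source at this
    rwa [h1] at this
  · have := (hy.1 l).2
    change (y.1 l).blowdown.2 ∈ φ.source at this
    rwa [h1] at this
  · rw [← h2]; exact hy.2 s

theorem IsPosition.blowdown_eq {y : Γ.Xtilde n M} (hy : y ∈ (Γ.blowupCharts n M).dom φ)
    {u : Γ.Vert → Euc n} (h : o.IsPosition ((Γ.blowupCharts n M).chart φ y) u) :
    blowdown y = o.reorder ((φ.symm ∘ u) ∘ Γ.vert) := by
  refine Prod.ext (funext fun l => ?_) (funext fun s => ?_)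
  · refine (DiagBlowup.blowdown_eq (hy.1 l)).trans ?_
    have := h.1 l
    rw [blowupCharts_chart] at this
    dsimp only at this
    rw [this.2, this.1]
    rfl
  · have := h.2 s
    rw [blowupCharts_chart] at this
    dsimp only at this
    exact (φ.left_inv (hy.2 s)).symm.trans (congrArg φ.symm this)

theorem mem_vertexDiagonal_iff {y : Γ.Xtilde n M} (hy : y ∈ (Γ.blowupCharts n M).dom φ) :
    blowdown y ∈ o.vertexDiagonal M ↔
      ∃ u, o.IsPosition ((Γ.blowupCharts n M).chart φ y) u := by
  constructor
  · rintro ⟨_, ⟨p, rfl⟩, hp⟩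
    exact ⟨φ ∘ p, isPosition_of_blowdown_eq hp.symm⟩
  · rintro ⟨u, hu⟩
    exact ⟨_, ⟨_, rfl⟩, (hu.blowdown_eq hy).symm⟩

end EdgeOrientation

variable (Γ) in
/-- The range of the coordinates on the blow-up given by the chart `φ`. -/
def chartRange (φ : OpenPartialHomeomorph M (EuclideanSpace ℝ (Fin n))) :
    Set (Γ.BlowupCoord n) :=
  {z | (∀ l, z.1 l ∈ DiagBlowup.polarRange φ) ∧ ∀ s, z.2 s ∈ φ.target}

theorem chart_mem_chartRange (hφ : φ ∈ IsManifold.maximalAtlas (𝓡 n) ∞ M) {y : Γ.Xtilde n M}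
    (hy : y ∈ (Γ.blowupCharts n M).dom φ) : (Γ.blowupCharts n M).chart φ y ∈ Γ.chartRange φ :=
  ⟨fun l => DiagBlowup.polar_mem_polarRange hφ (hy.1 l), fun s => φ.map_source (hy.2 s)⟩

theorem exists_chart_eq (hφ : φ ∈ IsManifold.maximalAtlas (𝓡 n) ∞ M) {z : Γ.BlowupCoord n}
    (hz : z ∈ Γ.chartRange φ) :
    ∃ y ∈ (Γ.blowupCharts n M).dom φ, (Γ.blowupCharts n M).chart φ y = z := by
  choose y hy hyz using fun l => DiagBlowup.exists_polar_eq (M := M) hφ (hz.1 l)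
  refine ⟨(y, fun s => φ.symm (z.2 s)), ⟨hy, fun s => φ.map_target (hz.2 s)⟩, ?_⟩
  exact Prod.ext (funext hyz) (funext fun s => φ.right_inv (hz.2 s))

theorem chart_injOn (hφ : φ ∈ IsManifold.maximalAtlas (𝓡 n) ∞ M) :
    InjOn ((Γ.blowupCharts n M).chart φ) ((Γ.blowupCharts n M).dom φ) := by
  intro y hy y' hy' h
  refine Prod.ext (funext fun l => ?_) (funext fun s => ?_)
  · exact DiagBlowup.polar_injOn hφ (hy.1 l) (hy'.1 l) (congrFun (congrArg Prod.fst h) l)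
  · exact φ.injOn (hy.2 s) (hy'.2 s) (congrFun (congrArg Prod.snd h) s)

/-- The point with given coordinates. -/
noncomputable def pointOf [Nonempty (Γ.Xtilde n M)]
    (φ : OpenPartialHomeomorph M (EuclideanSpace ℝ (Fin n))) (z : Γ.BlowupCoord n) :
    Γ.Xtilde n M :=
  Function.invFunOn ((Γ.blowupCharts n M).chart φ) ((Γ.blowupCharts n M).dom φ) z

section pointOf

variable [Nonempty (Γ.Xtilde n M)]

theorem pointOf_mem (hφ : φ ∈ IsManifold.maximalAtlas (𝓡 n) ∞ M) {z : Γ.BlowupCoord n}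
    (hz : z ∈ Γ.chartRange φ) : (pointOf φ z : Γ.Xtilde n M) ∈ (Γ.blowupCharts n M).dom φ :=
  Function.invFunOn_mem (exists_chart_eq hφ hz)

theorem chart_pointOf (hφ : φ ∈ IsManifold.maximalAtlas (𝓡 n) ∞ M) {z : Γ.BlowupCoord n}
    (hz : z ∈ Γ.chartRange φ) : (Γ.blowupCharts n M).chart φ (pointOf φ z) = z :=
  Function.invFunOn_eq (exists_chart_eq hφ hz)

theorem pointOf_chart (hφ : φ ∈ IsManifold.maximalAtlas (𝓡 n) ∞ M) {y : Γ.Xtilde n M}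
    (hy : y ∈ (Γ.blowupCharts n M).dom φ) : pointOf φ ((Γ.blowupCharts n M).chart φ y) = y :=
  (chart_injOn hφ).leftInvOn_invFunOn hy

end pointOf

theorem mem_edgeStratum_iff {y : Γ.Xtilde n M} (hy : y ∈ (Γ.blowupCharts n M).dom φ) :
    blowdown y ∈ edgeStratum M J ↔
      ∀ l, (((Γ.blowupCharts n M).chart φ y).1 l).2.2 = 0 ↔ l ∈ J :=
  forall_congr' fun l => iff_congr (DiagBlowup.polar_radius_eq_zero_iff (hy.1 l)).symm Iff.rfl

/-- The components at the edges in `J` of the multiray of `y` in the coordinates given by `φ`. -/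
noncomputable def direction (φ : OpenPartialHomeomorph M (EuclideanSpace ℝ (Fin n)))
    (J : Finset Γ.Edge) (y : Γ.Xtilde n M) : J → Euc n :=
  fun j => (((Γ.blowupCharts n M).chart φ y).1 j.1).2.1

theorem norm_direction (hφ : φ ∈ IsManifold.maximalAtlas (𝓡 n) ∞ M) {y : Γ.Xtilde n M}
    (hy : y ∈ (Γ.blowupCharts n M).dom φ) (j : J) : ‖direction φ J y j‖ = 1 :=
  (((chart_mem_chartRange hφ hy).1 j.1)).2.2.1

theorem eq_direction_of_smul {r : ℝ} (hr : 0 < r) {θ v : Euc n} (hθ : ‖θ‖ = 1) (h : r • θ = v) :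
    r = ‖v‖ ∧ θ = ‖v‖⁻¹ • v := by
  have h1 : r = ‖v‖ := by rw [← h, norm_smul, hθ, mul_one, Real.norm_of_nonneg hr.le]
  refine ⟨h1, ?_⟩
  rw [← h1, ← h, smul_smul, inv_mul_cancel₀ hr.ne', one_smul]

theorem EdgeOrientation.IsPosition.radius_smul {z : Γ.BlowupCoord n} {u : Γ.Vert → Euc n}
    (h : o.IsPosition z u) (l : Γ.Edge) :
    (z.1 l).2.2 • (z.1 l).2.1 = u (o.head l) - u (o.tail l) := by
  rw [← (h.1 l).2, ← (h.1 l).1, add_sub_cancel_left]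

/-- The coordinates of the configuration with positions `u` and given polar coordinates of the
differences. -/
def EdgeOrientation.coordOf (o : Γ.EdgeOrientation) (u : Γ.Vert → Euc n) (θ : Γ.Edge → Euc n)
    (r : Γ.Edge → ℝ) : Γ.BlowupCoord n :=
  (fun l => (u (o.tail l), θ l, r l), fun s => u (Γ.vert s.1))

theorem EdgeOrientation.isPosition_coordOf {u : Γ.Vert → Euc n} {θ : Γ.Edge → Euc n}
    {r : Γ.Edge → ℝ} (h : ∀ l, r l • θ l = u (o.head l) - u (o.tail l)) :
    o.IsPosition (o.coordOf u θ r) u :=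
  ⟨fun l => ⟨rfl, by simp [coordOf, h]⟩, fun s => rfl⟩

theorem EdgeOrientation.coordOf_mem_chartRange {N : Type*} [TopologicalSpace N]
    {φ : OpenPartialHomeomorph N (Euc n)} {u : Γ.Vert → Euc n} {θ : Γ.Edge → Euc n}
    {r : Γ.Edge → ℝ} (h : ∀ l, r l • θ l = u (o.head l) - u (o.tail l))
    (hu : ∀ v, u v ∈ φ.target) (hθ : ∀ l, ‖θ l‖ = 1) (hr : ∀ l, 0 ≤ r l) :
    o.coordOf u θ r ∈ Γ.chartRange φ :=
  ⟨fun l => ⟨hu _, by simp [coordOf, h, hu], hθ l, hr l⟩, fun s => hu _⟩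

theorem EdgeOrientation.IsPosition.mem_target {N : Type*} [TopologicalSpace N]
    {φ : OpenPartialHomeomorph N (Euc n)} {z : Γ.BlowupCoord n} {u : Γ.Vert → Euc n}
    (h : o.IsPosition z u) (hz : z ∈ Γ.chartRange φ) (v : Γ.Vert) : u v ∈ φ.target := by
  refine vert_cases (o := o) (P := fun v => u v ∈ φ.target) (fun l => ?_) (fun l => ?_)
    (fun s => ?_) v
  · rw [← (h.1 l).1]; exact (hz.1 l).1
  · rw [← (h.1 l).2]; exact (hz.1 l).2.1
  · rw [← h.2 s]; exact hz.2 s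

/-- A point over the locus where the edges in `J` are collapsed can be moved along a nonnegative
solution of the cycle equations for its multiray, so that only the edges where the solution
vanishes remain collapsed and the multiray does not change. -/
theorem exists_path [IsManifold (𝓡 n) ∞ M] [T2Space M] [NeZero n]
    (hφ : φ ∈ IsManifold.maximalAtlas (𝓡 n) ∞ M) {y : Γ.Xtilde n M}
    (hy : y ∈ (Γ.blowupCharts n M).dom φ)
    (hyJ : blowdown y ∈ o.vertexDiagonal M ∩ edgeStratum M J) {I : Finset Γ.Edge} (hIJ : I ⊆ J)
    {c : J → ℝ} (hc : c ∈ o.rays (direction φ J y)) (hc0 : ∀ j, 0 ≤ c j)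
    (hcI : ∀ j, c j = 0 ↔ j.1 ∈ I) :
    ∃ Y : ℝ → Γ.Xtilde n M, Filter.Tendsto Y (𝓝[>] 0) (𝓝 y) ∧
      ∀ᶠ t in 𝓝[>] (0 : ℝ), Y t ∈ (Γ.blowupCharts n M).dom φ ∧
        blowdown (Y t) ∈ o.vertexDiagonal M ∩ edgeStratum M I ∧
        direction φ J (Y t) = direction φ J y := by
  classical
  have : Nonempty (Γ.Xtilde n M) := ⟨y⟩
  have hzr := chart_mem_chartRange (Γ := Γ) hφ hy
  obtain ⟨u₀, hu₀⟩ := (EdgeOrientation.mem_vertexDiagonal_iff hy).1 hyJ.1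
  have hJ := (mem_edgeStratum_iff hy).1 hyJ.2
  obtain ⟨h, hh⟩ := EdgeOrientation.mem_rays.1 hc
  have hdir : ∀ j : J, direction φ J y j = (((Γ.blowupCharts n M).chart φ y).1 j.1).2.1 :=
    fun j => rfl
  obtain ⟨z, hz⟩ : ∃ z, z = (Γ.blowupCharts n M).chart φ y := ⟨_, rfl⟩
  simp only [← hz] at hzr hu₀ hJ hdir
  -- The positions move linearly along a potential `h` of the solution. On the edges in `J` the rays
  -- are kept and the radii are `t c_j`; on the others rays and radii are those of the difference `d`.
  let u : ℝ → Γ.Vert → Euc n := fun t => u₀ + t • h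
  have hu : Continuous u := by fun_prop
  have huv : ∀ v, Continuous fun t => u t v := fun v => (continuous_apply v).comp hu
  let d : ℝ → Γ.Edge → Euc n := fun t l => u t (o.head l) - u t (o.tail l)
  have hd : ∀ l, Continuous fun t => d t l := fun l => (huv _).sub (huv _)
  let θ : ℝ → Γ.Edge → Euc n := fun t l =>
    if l ∈ J then (z.1 l).2.1 else ‖d t l‖⁻¹ • d t l
  let r : ℝ → Γ.Edge → ℝ := fun t l => if hl : l ∈ J then t * c ⟨l, hl⟩ else ‖d t l‖
  have hd0 : ∀ l, d 0 l = (z.1 l).2.2 • (z.1 l).2.1 := fun l => by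
    simp only [d, u, zero_smul, add_zero]
    exact (hu₀.radius_smul l).symm
  have hdJ : ∀ t, ∀ j : J, d t j.1 = (t * c j) • (z.1 j.1).2.1 := fun t j => by
    have h1 := hh j
    rw [EdgeOrientation.coboundary_apply] at h1
    have h2 := hu₀.radius_smul j.1
    rw [(hJ j.1).2 j.2, zero_smul] at h2
    have h3 : h (o.head j.1) - h (o.tail j.1) = c j • (z.1 j.1).2.1 := by rw [← hdir]; exact h1
    calc d t j.1 = (u₀ (o.head j.1) - u₀ (o.tail j.1)) +
          t • (h (o.head j.1) - h (o.tail j.1)) := by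
            simp only [d, u, Pi.add_apply, Pi.smul_apply, smul_sub]; abel
      _ = (t * c j) • (z.1 j.1).2.1 := by rw [← h2, zero_add, h3, smul_smul]
  have hrpos : ∀ l, l ∉ J → 0 < (z.1 l).2.2 := fun l hl =>
    lt_of_le_of_ne (hzr.1 l).2.2.2 fun h => hl ((hJ l).1 h.symm)
  have hd0ne : ∀ l, l ∉ J → d 0 l ≠ 0 := fun l hl => by
    rw [hd0]
    refine smul_ne_zero (hrpos l hl).ne' fun h => ?_
    have := (hzr.1 l).2.2.1
    rw [h, norm_zero] at this
    exact zero_ne_one this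
  let zt : ℝ → Γ.BlowupCoord n := fun t => o.coordOf (u t) (θ t) (r t)
  have hev : ∀ᶠ t in 𝓝[>] (0 : ℝ), 0 < t ∧ (∀ l, l ∉ J → d t l ≠ 0) ∧ ∀ v, u t v ∈ φ.target := by
    refine (eventually_mem_nhdsWithin).and
      (Filter.Eventually.filter_mono nhdsWithin_le_nhds (Filter.Eventually.and ?_ ?_))
    · refine Filter.eventually_all.2 fun l => ?_
      by_cases hl : l ∈ J
      · exact Filter.Eventually.of_forall fun t h => absurd hl h
      · filter_upwards [(hd l).continuousAt.eventually_ne (hd0ne l hl)] with t ht _ using ht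
    · refine Filter.eventually_all.2 fun v => (huv v).continuousAt.eventually
        (φ.open_target.mem_nhds ?_)
      simpa [u] using hu₀.mem_target hzr v
  have hsm : ∀ t l, (l ∉ J → d t l ≠ 0) → r t l • θ t l = d t l := by
    intro t l hl
    by_cases hlJ : l ∈ J
    · simp only [r, θ, dif_pos hlJ, if_pos hlJ]
      exact (hdJ t ⟨l, hlJ⟩).symm
    · simp only [r, θ, dif_neg hlJ, if_neg hlJ, smul_smul]
      rw [mul_inv_cancel₀ (norm_ne_zero_iff.2 (hl hlJ)), one_smul]
  have hztr : ∀ᶠ t in 𝓝[>] (0 : ℝ), 0 < t ∧ (∀ l, l ∉ J → d t l ≠ 0) ∧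
      zt t ∈ Γ.chartRange φ := by
    filter_upwards [hev] with t ⟨ht, hne, htar⟩
    refine ⟨ht, hne, EdgeOrientation.coordOf_mem_chartRange (fun l => hsm t l (hne l)) htar
      (fun l => ?_) (fun l => ?_)⟩
    · by_cases hl : l ∈ J
      · simp only [θ, if_pos hl]; exact (hzr.1 l).2.2.1
      · simp only [θ, if_neg hl]; exact norm_smul_inv_norm (hne l hl)
    · by_cases hl : l ∈ J
      · simp only [r, dif_pos hl]; exact mul_nonneg ht.le (hc0 _)
      · simp only [r, dif_neg hl]; exact norm_nonneg _
  refine ⟨fun t => pointOf φ (zt t), ?_, ?_⟩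
  · refine (isSmooth_blowupCharts Γ n M).tendsto_nhds_iff hφ hy ?_ ?_
    · filter_upwards [hztr] with t ht using pointOf_mem hφ ht.2.2
    · rw [← hz]
      have hlim : Filter.Tendsto zt (𝓝[>] 0) (𝓝 z) := by
        refine Filter.Tendsto.mono_left ?_ nhdsWithin_le_nhds
        refine Filter.Tendsto.prodMk_nhds (tendsto_pi_nhds.2 fun l => ?_)
          (tendsto_pi_nhds.2 fun s => ?_)
        · have h1 : Filter.Tendsto (fun t => u t (o.tail l)) (𝓝 0) (𝓝 (z.1 l).1) := by
            rw [(hu₀.1 l).1]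
            have := (huv (o.tail l)).tendsto 0
            simpa [u] using this
          refine Filter.Tendsto.prodMk_nhds h1 (Filter.Tendsto.prodMk_nhds ?_ ?_)
          · by_cases hl : l ∈ J
            · simp only [θ, if_pos hl]; exact tendsto_const_nhds
            · simp only [θ, if_neg hl]
              rw [(eq_direction_of_smul (hrpos l hl) (hzr.1 l).2.2.1 (hd0 l).symm).2]
              exact ((hd l).tendsto 0).norm.inv₀ (norm_ne_zero_iff.2 (hd0ne l hl)) |>.smul
                ((hd l).tendsto 0)
          · by_cases hl : l ∈ J
            · simp only [r, dif_pos hl]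
              rw [(hJ l).2 hl]
              have : Continuous fun t : ℝ => t * c ⟨l, hl⟩ := by fun_prop
              simpa using this.tendsto 0
            · simp only [r, dif_neg hl]
              rw [(eq_direction_of_smul (hrpos l hl) (hzr.1 l).2.2.1 (hd0 l).symm).1]
              exact ((hd l).tendsto 0).norm
        · rw [hu₀.2 s]
          have := (huv (Γ.vert s.1)).tendsto 0
          simpa [u] using this
      refine hlim.congr' ?_
      filter_upwards [hztr] with t ht using (chart_pointOf hφ ht.2.2).symm
  · filter_upwards [hztr] with t ⟨ht, hne, htr⟩
    have hmem := pointOf_mem (M := M) hφ htr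
    have hch := chart_pointOf (M := M) hφ htr
    refine ⟨hmem, ⟨(EdgeOrientation.mem_vertexDiagonal_iff hmem).2 ⟨u t, ?_⟩,
      (mem_edgeStratum_iff hmem).2 fun l => ?_⟩, funext fun j => ?_⟩
    · rw [hch]
      exact EdgeOrientation.isPosition_coordOf fun l => hsm t l (hne l)
    · rw [hch]
      change r t l = 0 ↔ l ∈ I
      by_cases hl : l ∈ J
      · simp only [r, dif_pos hl, mul_eq_zero, ht.ne', false_or]
        exact hcI _
      · simp only [r, dif_neg hl, norm_eq_zero]
        exact ⟨fun h => absurd h (hne l hl), fun h => absurd (hIJ h) hl⟩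
    · rw [direction, hch]
      change θ t j.1 = _
      simp only [θ, if_pos j.2]
      exact (hdir j).symm

end RibbonGraph

/-! ### The strata of the configuration space -/

theorem mem_closure_inter_of_isOpen {X : Type*} [TopologicalSpace X] {s U : Set X} {x : X}
    (h : x ∈ closure s) (hU : IsOpen U) (hx : x ∈ U) : x ∈ closure (s ∩ U) := by
  rw [inter_comm]
  exact hU.inter_closure ⟨hx, h⟩

namespace DiagBlowup

variable {n : ℕ} {M : Type*} [TopologicalSpace M] [ChartedSpace (EuclideanSpace ℝ (Fin n)) M]
  {φ : OpenPartialHomeomorph M (EuclideanSpace ℝ (Fin n))}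

/-- Two rays on the same line have opposite or equal directions in polar coordinates. -/
theorem exists_smul_of_unorient_eq (hφ : φ ∈ IsManifold.maximalAtlas (𝓡 n) ∞ M)
    {z z' : DiagBlowup n M} (hz : z ∈ polarDom φ) (h : z.unorient = z'.unorient) :
    z.blowdown = z'.blowdown ∧ ∃ ε : ℝ, (polar φ z').2.1 = ε • (polar φ z).2.1 ∧ ε ≠ 0 := by
  rcases z with q | ⟨x, r⟩ <;> rcases z' with q' | ⟨x', r'⟩
  · obtain rfl : q = q' := Sum.inl.inj h
    exact ⟨rfl, 1, by rw [one_smul], one_ne_zero⟩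
  · cases h
  · cases h
  · obtain ⟨hx, h2⟩ := Sigma.mk.inj_iff.1 (Sum.inr.inj h)
    dsimp only at hx
    subst hx
    refine ⟨rfl, ?_⟩
    obtain ⟨a, ha⟩ := (Projectivization.mk_eq_mk_iff' _ _ _ _ _).1 (eq_of_heq h2)
    have hv := congrArg (tangentCoord φ x) ha
    rw [tangentCoord_smul] at hv
    have hw : tangentCoord φ x r.someVector ≠ 0 := tangentCoord_someVector_ne_zero hφ r hz.1
    have hw' : tangentCoord φ x r'.someVector ≠ 0 := tangentCoord_someVector_ne_zero hφ r' hz.1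
    have ha0 : a ≠ 0 := by
      rintro rfl
      rw [zero_smul] at hv
      exact hw hv.symm
    rw [polar_inr, polar_inr]
    dsimp only
    refine ⟨‖tangentCoord φ x r'.someVector‖⁻¹ * ‖tangentCoord φ x r.someVector‖ * a⁻¹, ?_, ?_⟩
    · rw [smul_smul]
      conv_rhs => rw [← hv, smul_smul]
      congr 1
      have := norm_ne_zero_iff.2 hw
      rw [hv]
      field_simp
    · have h1 := norm_ne_zero_iff.2 hw
      have h2 := norm_ne_zero_iff.2 hw'
      positivity

end DiagBlowup

namespace RibbonGraph

variable {F : Type*} [Finite F] {Γ : RibbonGraph F} {o : Γ.EdgeOrientation} {n : ℕ}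
  {M : Type*} [TopologicalSpace M] [ChartedSpace (EuclideanSpace ℝ (Fin n)) M]
  {φ : OpenPartialHomeomorph M (EuclideanSpace ℝ (Fin n))} {I J : Finset Γ.Edge}

theorem exists_mem_edgeStratum {N : Type*} (x : Γ.X N) :
    ∃ J : Finset Γ.Edge, x ∈ edgeStratum N J := by
  classical
  exact ⟨Finset.univ.filter fun l => (x.1 l).1 = (x.1 l).2, fun l => by simp⟩

theorem eq_of_mem_edgeStratum {N : Type*} {x : Γ.X N} (h : x ∈ edgeStratum N I)
    (h' : x ∈ edgeStratum N J) :
    I = J :=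
  Finset.ext fun l => (h l).symm.trans (h' l)

theorem mem_edgeStratum_empty {N : Type*} {x : Γ.X N} :
    x ∈ edgeStratum N ∅ ↔ x ∉ Γ.edgeDiagonal N := by
  simp [edgeStratum, edgeDiagonal]

theorem isClosed_collapsed [T2Space M] (l : Γ.Edge) :
    IsClosed {y : Γ.Xtilde n M | ((blowdown y).1 l).1 = ((blowdown y).1 l).2} := by
  have h : Continuous fun y : Γ.Xtilde n M => (blowdown y).1 l :=
    (continuous_apply l).comp (continuous_fst.comp continuous_blowdown)
  exact isClosed_eq (continuous_fst.comp h) (continuous_snd.comp h)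

namespace EdgeOrientation

variable (o M) in
theorem isClosed_vertexDiagonal [T2Space M] [CompactSpace M] : IsClosed (o.vertexDiagonal M) := by
  have h : Continuous fun p : Γ.Vert → M => o.reorder (p ∘ Γ.vert) := by
    refine Continuous.prodMk (continuous_pi fun l => ?_) (continuous_pi fun s => continuous_apply _)
    exact (continuous_apply _).prodMk (continuous_apply _)
  have : o.vertexDiagonal M = range fun p : Γ.Vert → M => o.reorder (p ∘ Γ.vert) := by
    ext x
    constructor
    · rintro ⟨_, ⟨p, rfl⟩, rfl⟩
      exact ⟨p, rfl⟩
    · rintro ⟨p, rfl⟩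
      exact ⟨_, ⟨p, rfl⟩, rfl⟩
  rw [this]
  exact (isCompact_range h).isClosed

variable (o n M) in
theorem conf_subset [T2Space M] [CompactSpace M] :
    o.conf n M ⊆ blowdown ⁻¹' o.vertexDiagonal M :=
  closure_minimal (fun _ h => h.1)
    ((o.isClosed_vertexDiagonal M).preimage continuous_blowdown)

variable (o n M) in
theorem stratum_empty [T2Space M] [CompactSpace M] :
    o.stratum n M ∅ = blowdown ⁻¹' (o.vertexDiagonal M \ Γ.edgeDiagonal M) := by
  ext y
  constructor
  · rintro ⟨h1, h2⟩
    exact ⟨o.conf_subset n M h1, mem_edgeStratum_empty.1 h2⟩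
  · intro h
    exact ⟨subset_closure h, mem_edgeStratum_empty.2 h.2⟩

variable (o n M) in
theorem isClosed_conf : IsClosed (o.conf n M) := isClosed_closure

variable (o n M) in
theorem closure_stratum_subset (I : Finset Γ.Edge) : closure (o.stratum n M I) ⊆ o.conf n M :=
  closure_minimal inter_subset_left (o.isClosed_conf n M)

/-- The collapsed edges remain collapsed in the limit. -/
theorem subset_of_mem_closure [T2Space M] {y : Γ.Xtilde n M} (h : y ∈ closure (o.stratum n M I))
    (hy : blowdown y ∈ edgeStratum M J) : I ⊆ J := fun l hl =>
  (hy l).1 (closure_minimal (fun _ h => (h.2 l).2 hl) (isClosed_collapsed l) h)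

theorem mem_sing_of_mem_closure {y : Γ.Xtilde n M} (hy : blowdown y ∈ edgeStratum M J)
    (hI : I.Nonempty) (hIJ : I ⊂ J) (h : y ∈ closure (o.stratum n M I)) : y ∈ o.sing n M := by
  have hc := o.closure_stratum_subset n M I h
  refine ⟨hc, y, ?_, rfl⟩
  simp only [sing', mem_iUnion]
  exact ⟨J, I, hI, hIJ, ⟨hc, hy⟩, h⟩

/-- Near a smooth point of a stratum, the smooth part meets only this stratum and the open one. -/
theorem eventually_mem_stratum [T2Space M] {y₀ : Γ.Xtilde n M} (hy₀ : y₀ ∈ o.smoothStratum n M J) :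
    ∀ᶠ y in 𝓝 y₀, ∀ I : Finset Γ.Edge, I.Nonempty → y ∈ o.stratum n M I → I = J := by
  refine Filter.eventually_all.2 fun I => ?_
  by_cases hI : I.Nonempty ∧ I ≠ J
  · have : y₀ ∉ closure (o.stratum n M I) := fun h =>
      hy₀.2 (mem_sing_of_mem_closure hy₀.1.2 hI.1 (Finset.ssubset_iff_subset_ne.2
        ⟨subset_of_mem_closure h hy₀.1.2, hI.2⟩) h)
    filter_upwards [isClosed_closure.isOpen_compl.mem_nhds this] with y hy _ hyI
    exact absurd (subset_closure hyI) hy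
  · refine Filter.Eventually.of_forall fun y h _ => ?_
    by_contra hcon
    exact hI ⟨h, hcon⟩

variable [IsManifold (𝓡 n) ∞ M] [T2Space M] [NeZero n]

theorem continuousAt_direction (hφ : φ ∈ IsManifold.maximalAtlas (𝓡 n) ∞ M) {y : Γ.Xtilde n M}
    (hy : y ∈ (Γ.blowupCharts n M).dom φ) : ContinuousAt (direction φ J) y := by
  have h := (isSmooth_blowupCharts Γ n M).continuousAt_chart hφ hy
  have h2 : Continuous fun (z : Γ.BlowupCoord n) (j : J) => (z.1 j.1).2.1 := by fun_prop
  exact ContinuousAt.comp (g := fun (z : Γ.BlowupCoord n) (j : J) => (z.1 j.1).2.1)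
    h2.continuousAt h

theorem blowdown_eq_of_unorient_eq {y y' : Γ.Xtilde n M}
    (h : unorient y = unorient y') : blowdown y = blowdown y' := by
  have hs : y.2 = y'.2 := (Prod.ext_iff.1 h).2
  obtain ⟨φ, hφ, hy⟩ := (isSmooth_blowupCharts Γ n M).exists_chart y
  exact Prod.ext (funext fun l => (DiagBlowup.exists_smul_of_unorient_eq hφ (hy.1 l)
    (congrFun (congrArg Prod.fst h) l)).1) hs

variable [CompactSpace M]

/-- The points of the configuration space over the locus where precisely the edges in `J` are
collapsed: their multirays are the limits of directions of solutions of the cycle equations. -/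
theorem mem_conf_iff (hφ : φ ∈ IsManifold.maximalAtlas (𝓡 n) ∞ M) {y : Γ.Xtilde n M}
    (hy : y ∈ (Γ.blowupCharts n M).dom φ)
    (hyJ : blowdown y ∈ o.vertexDiagonal M ∩ edgeStratum M J) :
    y ∈ o.conf n M ↔ direction φ J y ∈ closure (o.directionSet n J) := by
  constructor
  -- In the open stratum, the distances along the edges are the coefficients of a solution.
  · intro h
    have h1 : y ∈ closure (o.stratum n M ∅ ∩ (Γ.blowupCharts n M).dom φ) := by
      rw [stratum_empty]
      exact mem_closure_inter_of_isOpen h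
        ((isSmooth_blowupCharts Γ n M).isOpen_dom hφ) hy
    refine closure_mono ?_ (mem_closure_image (continuousAt_direction hφ hy) h1)
    rintro _ ⟨y', ⟨hy', hd⟩, rfl⟩
    obtain ⟨u, hu⟩ := (mem_vertexDiagonal_iff hd).1 (o.conf_subset n M hy'.1)
    have hr := (mem_edgeStratum_iff hd).1 hy'.2
    refine ⟨fun j => norm_direction hφ hd j, fun j => (((Γ.blowupCharts n M).chart φ y').1 j.1).2.2,
      mem_rays.2 ⟨u, fun j => ?_⟩, fun j => ?_⟩
    · exact (hu.radius_smul j.1).symm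
    · refine lt_of_le_of_ne (DiagBlowup.polar_radius_nonneg _) fun h => ?_
      exact Finset.notMem_empty _ ((hr j.1).1 h.symm)
  · intro h
    have hne := mem_closure_iff_nhdsWithin_neBot.1 h
    have : Nonempty (Γ.Xtilde n M) := ⟨y⟩
    classical
    have hzr := chart_mem_chartRange (Γ := Γ) hφ hy
    obtain ⟨u₀, hu₀⟩ := (mem_vertexDiagonal_iff hy).1 hyJ.1
    have hJ := (mem_edgeStratum_iff hy).1 hyJ.2
    have hdir : ∀ j : J, direction φ J y j = (((Γ.blowupCharts n M).chart φ y).1 j.1).2.1 :=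
      fun j => rfl
    obtain ⟨z, hz⟩ : ∃ z, z = (Γ.blowupCharts n M).chart φ y := ⟨_, rfl⟩
    simp only [← hz] at hzr hu₀ hJ hdir
    -- the point with the same base point and with a given multiray
    let Z : (J → Euc n) → Γ.BlowupCoord n := fun θ =>
      o.coordOf u₀ (fun l => if hl : l ∈ J then θ ⟨l, hl⟩ else (z.1 l).2.1) fun l => (z.1 l).2.2
    have hsm : ∀ θ : J → Euc n, ∀ l, (z.1 l).2.2 •
        (if hl : l ∈ J then θ ⟨l, hl⟩ else (z.1 l).2.1) = u₀ (o.head l) - u₀ (o.tail l) := by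
      intro θ l
      rw [← hu₀.radius_smul l]
      by_cases hl : l ∈ J
      · rw [(hJ l).2 hl, zero_smul, zero_smul]
      · rw [dif_neg hl]
    have hZr : ∀ θ : J → Euc n, (∀ j, ‖θ j‖ = 1) → Z θ ∈ Γ.chartRange φ := by
      intro θ hθ
      refine coordOf_mem_chartRange (hsm θ) (hu₀.mem_target hzr) (fun l => ?_)
        fun l => (hzr.1 l).2.2.2
      by_cases hl : l ∈ J
      · rw [dif_pos hl]; exact hθ _
      · rw [dif_neg hl]; exact (hzr.1 l).2.2.1
    have hZ : Continuous Z := by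
      refine Continuous.prodMk (continuous_pi fun l => ?_) continuous_const
      refine Continuous.prodMk continuous_const (Continuous.prodMk ?_ continuous_const)
      by_cases hl : l ∈ J
      · simp only [dif_pos hl]; fun_prop
      · simp only [dif_neg hl]; fun_prop
    have hZy : Z (direction φ J y) = z := by
      refine Prod.ext (funext fun l => ?_) (funext fun s => (hu₀.2 s).symm)
      refine Prod.ext (hu₀.1 l).1.symm (Prod.ext ?_ rfl)
      change (if hl : l ∈ J then direction φ J y ⟨l, hl⟩ else (z.1 l).2.1) = _
      by_cases hl : l ∈ J
      · rw [dif_pos hl, hdir]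
      · rw [dif_neg hl]
    have hlim : Filter.Tendsto (fun θ => (pointOf φ (Z θ) : Γ.Xtilde n M))
        (𝓝[o.directionSet n J] (direction φ J y)) (𝓝 y) := by
      refine (isSmooth_blowupCharts Γ n M).tendsto_nhds_iff hφ hy ?_ ?_
      · filter_upwards [self_mem_nhdsWithin] with θ hθ using pointOf_mem hφ (hZr θ hθ.1)
      · rw [← hz]
        have h1 : Filter.Tendsto Z (𝓝[o.directionSet n J] (direction φ J y)) (𝓝 z) := by
          have := (hZ.tendsto (direction φ J y)).mono_left (nhdsWithin_le_nhds
            (s := o.directionSet n J))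
          rwa [hZy] at this
        refine h1.congr' ?_
        filter_upwards [self_mem_nhdsWithin] with θ hθ using (chart_pointOf hφ (hZr θ hθ.1)).symm
    refine (o.isClosed_conf n M).mem_of_tendsto hlim ?_
    filter_upwards [self_mem_nhdsWithin] with θ hθ
    have hmem := pointOf_mem (M := M) hφ (hZr θ hθ.1)
    have hch := chart_pointOf (M := M) hφ (hZr θ hθ.1)
    have hθeq : direction φ J (pointOf φ (Z θ) : Γ.Xtilde n M) = θ := by
      funext j
      rw [direction, hch]
      exact dif_pos j.2
    have hbl : blowdown (pointOf φ (Z θ) : Γ.Xtilde n M) ∈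
        o.vertexDiagonal M ∩ edgeStratum M J := by
      refine ⟨(mem_vertexDiagonal_iff hmem).2 ⟨u₀, ?_⟩, (mem_edgeStratum_iff hmem).2 ?_⟩
      · rw [hch]; exact isPosition_coordOf (hsm θ)
      · rw [hch]; exact hJ
    -- A multiray that contains a positive solution is a limit of points of the open stratum.
    obtain ⟨c, hc, hpos⟩ := hθ.2
    rw [← hθeq] at hc
    obtain ⟨Y, hY, hev⟩ := exists_path hφ hmem hbl (Finset.empty_subset J) hc
      (fun j => (hpos j).le) fun j => ⟨fun h => absurd h (hpos j).ne',
        fun h => absurd h (Finset.notMem_empty _)⟩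
    refine mem_closure_of_tendsto hY ?_
    filter_upwards [hev] with t ht
    exact ⟨ht.2.1.1, mem_edgeStratum_empty.1 ht.2.1.2⟩

/-- A nonnegative solution on the multiray of `y` is the velocity of a path from `y` into the stratum
of its zero set. -/
theorem mem_closure_stratum (hφ : φ ∈ IsManifold.maximalAtlas (𝓡 n) ∞ M) {y : Γ.Xtilde n M}
    (hy : y ∈ (Γ.blowupCharts n M).dom φ) (hyJ : y ∈ o.stratum n M J) (hIJ : I ⊆ J)
    {c : J → ℝ} (hc : c ∈ o.rays (direction φ J y)) (hc0 : ∀ j, 0 ≤ c j)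
    (hcI : ∀ j, c j = 0 ↔ j.1 ∈ I) : y ∈ closure (o.stratum n M I) := by
  have hyJ' : blowdown y ∈ o.vertexDiagonal M ∩ edgeStratum M J :=
    ⟨o.conf_subset n M hyJ.1, hyJ.2⟩
  obtain ⟨Y, hY, hev⟩ := exists_path hφ hy hyJ' hIJ hc hc0 hcI
  refine mem_closure_of_tendsto hY ?_
  filter_upwards [hev] with t ⟨h1, h2, h3⟩
  refine ⟨(mem_conf_iff hφ h1 h2).2 ?_, h2.2⟩
  have : direction φ I (Y t) = fun i : I => direction φ J y ⟨i.1, hIJ i.2⟩ :=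
    funext fun i => congrFun h3 ⟨i.1, hIJ i.2⟩
  rw [this]
  exact restrict_mem_closure_directionSet hIJ ((mem_conf_iff hφ hy hyJ').1 hyJ.1)

/-- Conversely, a limit of points of the stratum of `I` has a nonzero nonnegative solution that
vanishes on `I`: the limit of the normalized distances along the edges. -/
theorem direction_mem_degenerateSet (hφ : φ ∈ IsManifold.maximalAtlas (𝓡 n) ∞ M)
    {y : Γ.Xtilde n M} (hy : y ∈ (Γ.blowupCharts n M).dom φ) (hIJ : I ⊂ J)
    (h : y ∈ closure (o.stratum n M I)) : direction φ J y ∈ o.degenerateSet n J I := by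
  have h1 : y ∈ closure (o.stratum n M I ∩ (Γ.blowupCharts n M).dom φ) :=
    mem_closure_inter_of_isOpen h ((isSmooth_blowupCharts Γ n M).isOpen_dom hφ) hy
  rw [← (o.isClosed_degenerateSet n J I).closure_eq]
  refine closure_mono ?_ (mem_closure_image (continuousAt_direction hφ hy) h1)
  rintro _ ⟨y', ⟨hy', hd⟩, rfl⟩
  obtain ⟨u, hu⟩ := (mem_vertexDiagonal_iff hd).1 (o.conf_subset n M hy'.1)
  have hr := (mem_edgeStratum_iff hd).1 hy'.2
  have hnn : ∀ j : J, 0 ≤ (((Γ.blowupCharts n M).chart φ y').1 j.1).2.2 :=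
    fun j => DiagBlowup.polar_radius_nonneg _
  obtain ⟨j, hj, hjI⟩ := Finset.exists_of_ssubset hIJ
  obtain ⟨t, -, ht⟩ := exists_mem_stdSimplex_smul hnn
    ⟨⟨j, hj⟩, lt_of_le_of_ne (hnn _) fun h => hjI ((hr j).1 h.symm)⟩
  refine ⟨_, ht, fun i hi => ?_, Submodule.smul_mem _ _ (mem_rays.2 ⟨u, fun j => ?_⟩)⟩
  · rw [Pi.smul_apply, (hr i.1).2 hi, smul_zero]
  · exact (hu.radius_smul j.1).symm

theorem exists_mem_closure_of_not_isRigid (hφ : φ ∈ IsManifold.maximalAtlas (𝓡 n) ∞ M)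
    {y : Γ.Xtilde n M} (hy : y ∈ (Γ.blowupCharts n M).dom φ) (hJ : J.Nonempty)
    (hyJ : y ∈ o.stratum n M J) (h : ¬ o.IsRigid (direction φ J y)) :
    ∃ I : Finset Γ.Edge, I.Nonempty ∧ I ⊂ J ∧ y ∈ closure (o.stratum n M I) := by
  classical
  obtain ⟨c, hc, hc0, ⟨i, hi⟩, j, hj⟩ := exists_degenerate_of_not_isRigid hJ
    ((mem_conf_iff hφ hy ⟨o.conf_subset n M hyJ.1, hyJ.2⟩).1 hyJ.1) h
  let I : Finset Γ.Edge := (Finset.univ.filter fun j : J => c j = 0).map (.subtype _)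
  have hI : ∀ j : J, c j = 0 ↔ j.1 ∈ I := fun j => by simp [I]
  have hIJ : I ⊆ J := fun l hl => by
    simp only [I, Finset.mem_map] at hl
    obtain ⟨a, -, rfl⟩ := hl
    exact a.2
  refine ⟨I, ⟨i.1, (hI i).1 hi⟩, Finset.ssubset_iff_subset_ne.2 ⟨hIJ, ?_⟩,
    mem_closure_stratum hφ hy hyJ hIJ hc hc0 hI⟩
  intro hcon
  exact hj.ne' ((hI j).2 (hcon.symm.subset j.2))

/-- The singular part is saturated with respect to changes of signs of the rays, whereas rigidity
is invariant under such changes. -/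
theorem IsRigid.notMem_sing (hφ : φ ∈ IsManifold.maximalAtlas (𝓡 n) ∞ M)
    {y : Γ.Xtilde n M} (hy : y ∈ (Γ.blowupCharts n M).dom φ)
    (hyJ : blowdown y ∈ edgeStratum M J) (h : o.IsRigid (direction φ J y)) :
    y ∉ o.sing n M := by
  rintro ⟨-, y', hy', hyy'⟩
  simp only [sing', mem_iUnion] at hy'
  obtain ⟨J', I, ⟨i, hi⟩, hIJ, hJ', hI⟩ := hy'
  have hbl : blowdown y = blowdown y' := blowdown_eq_of_unorient_eq hyy'.symm
  obtain rfl : J' = J := eq_of_mem_edgeStratum hJ'.2 (hbl ▸ hyJ)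
  have hd : y' ∈ (Γ.blowupCharts n M).dom φ := by
    change blowdown y' ∈ (Γ.baseCharts n M).dom φ
    rw [← hbl]
    exact hy
  refine h.notMem_degenerateSet (θ' := direction φ J' y') (fun j => ?_) (i := ⟨i, hIJ.1 hi⟩) hi
    (direction_mem_degenerateSet hφ hd hIJ hI)
  exact (DiagBlowup.exists_smul_of_unorient_eq hφ (hy.1 j.1)
    (congrFun (congrArg Prod.fst hyy'.symm) j.1)).2

/-- The smooth points of a stratum are those with rigid multirays. -/
theorem mem_smoothStratum_iff (hφ : φ ∈ IsManifold.maximalAtlas (𝓡 n) ∞ M)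
    {y : Γ.Xtilde n M} (hy : y ∈ (Γ.blowupCharts n M).dom φ) (hJ : J.Nonempty)
    (hyJ : blowdown y ∈ o.vertexDiagonal M ∩ edgeStratum M J) :
    y ∈ o.smoothStratum n M J ↔ o.IsRigid (direction φ J y) := by
  constructor
  · intro h
    by_contra hcon
    obtain ⟨I, hI, hIJ, hyI⟩ := exists_mem_closure_of_not_isRigid hφ hy hJ h.1 hcon
    exact h.2 (mem_sing_of_mem_closure hyJ.2 hI hIJ hyI)
  · intro h
    have hc : y ∈ o.conf n M := by
      rw [mem_conf_iff hφ hy hyJ]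
      obtain ⟨c, hc, hpos, -⟩ := h
      exact subset_closure ⟨norm_direction hφ hy, c, hc, hpos⟩
    exact ⟨⟨hc, hyJ.2⟩, h.notMem_sing hφ hy hyJ.2⟩

variable (o n M) in
theorem sing_eq : o.sing n M = ⋃ (I : Finset Γ.Edge) (_ : I.Nonempty) (l : Γ.Edge) (_ : l ∉ I),
    closure (o.stratum n M I) ∩ {y | ((blowdown y).1 l).1 = ((blowdown y).1 l).2} := by
  ext y
  simp only [mem_iUnion]
  constructor
  · intro h
    obtain ⟨φ, hφ, hy⟩ := (isSmooth_blowupCharts Γ n M).exists_chart y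
    obtain ⟨J, hyJ⟩ := exists_mem_edgeStratum (blowdown y)
    have hJ : J.Nonempty := by
      obtain ⟨-, y', hy', hyy'⟩ := h
      simp only [sing', mem_iUnion] at hy'
      obtain ⟨J', I, ⟨i, hi⟩, hIJ, hJ', hI⟩ := hy'
      rw [← blowdown_eq_of_unorient_eq hyy'] at hyJ
      exact ⟨i, eq_of_mem_edgeStratum hJ'.2 hyJ ▸ hIJ.1 hi⟩
    have hnr : ¬ o.IsRigid (direction φ J y) := fun hr => hr.notMem_sing hφ hy hyJ h
    obtain ⟨I, hI, hIJ, hyI⟩ := exists_mem_closure_of_not_isRigid hφ hy hJ ⟨h.1, hyJ⟩ hnr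
    obtain ⟨l, hl, hlI⟩ := Finset.exists_of_ssubset hIJ
    exact ⟨I, hI, l, hlI, hyI, (hyJ l).2 hl⟩
  · rintro ⟨I, hI, l, hl, hyI, hyl⟩
    obtain ⟨J, hyJ⟩ := exists_mem_edgeStratum (blowdown y)
    refine mem_sing_of_mem_closure hyJ hI (Finset.ssubset_iff_subset_ne.2
      ⟨subset_of_mem_closure hyI hyJ, ?_⟩) hyI
    rintro rfl
    exact hl ((hyJ l).1 hyl)

variable (o n M) in
theorem isClosed_sing : IsClosed (o.sing n M) := by
  rw [sing_eq]
  exact isClosed_iUnion_of_finite fun I => isClosed_iUnion_of_finite fun _ =>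
    isClosed_iUnion_of_finite fun l => isClosed_iUnion_of_finite fun _ =>
      isClosed_closure.inter (isClosed_collapsed l)

end EdgeOrientation

end RibbonGraph

/-! ### Rigid multirays and unique solutions -/

namespace RibbonGraph

variable {F : Type*} [Finite F] {Γ : RibbonGraph F} {o : Γ.EdgeOrientation} {n : ℕ}
  {M : Type*} [TopologicalSpace M] [ChartedSpace (EuclideanSpace ℝ (Fin n)) M]
  {φ : OpenPartialHomeomorph M (EuclideanSpace ℝ (Fin n))} {J : Finset Γ.Edge}
  {y : Γ.Xtilde n M}

namespace EdgeOrientation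

theorem smul_mem_cycleSpace_iff {θ : J → Euc n} {c : J → ℝ} :
    (fun j => c j • θ j) ∈ o.cycleSpace n J ↔ c ∈ o.rays θ := by
  rw [cycleSpace_eq_range]
  rfl

theorem isSolution_iff {x : J → Euc n} :
    o.IsSolution φ J y x ↔ ∃ c ∈ o.rays (direction φ J y), (∀ j, 0 < c j) ∧
      (x = fun j => c j • direction φ J y j) ∧ ∑ j, ‖x j‖ ^ 2 = 1 ∧ ∀ j, x j ≠ 0 := by
  constructor
  · rintro ⟨h1, h2, h3⟩
    choose hne c hc hxc using h3
    have hx : x = fun j => c j • direction φ J y j := funext hxc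
    exact ⟨c, smul_mem_cycleSpace_iff.1 (hx ▸ h1), hc, hx, h2, hne⟩
  · rintro ⟨c, hc, hpos, hx, h2, hne⟩
    exact ⟨hx ▸ smul_mem_cycleSpace_iff.2 hc, h2, fun j => ⟨hne j, c j, hpos j, congrFun hx j⟩⟩

theorem exists_isSolution_smul (hφ : φ ∈ IsManifold.maximalAtlas (𝓡 n) ∞ M)
    (hy : y ∈ (Γ.blowupCharts n M).dom φ) (hJ : J.Nonempty) {c : J → ℝ}
    (hc : c ∈ o.rays (direction φ J y)) (hpos : ∀ j, 0 < c j) :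
    ∃ s : ℝ, 0 < s ∧ o.IsSolution φ J y fun j => (s * c j) • direction φ J y j := by
  obtain ⟨j₀, hj₀⟩ := hJ
  have hs : 0 < ∑ j, c j ^ 2 :=
    Finset.sum_pos (fun j _ => pow_pos (hpos j) 2) ⟨⟨j₀, hj₀⟩, Finset.mem_univ _⟩
  have hs' : 0 < (√(∑ j, c j ^ 2))⁻¹ := inv_pos.2 (Real.sqrt_pos.2 hs)
  refine ⟨(√(∑ j, c j ^ 2))⁻¹, hs', isSolution_iff.2
    ⟨_, Submodule.smul_mem _ _ hc, fun j => mul_pos hs' (hpos j), rfl, ?_, fun j => ?_⟩⟩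
  · have h1 : ∀ j, ‖((√(∑ j, c j ^ 2))⁻¹ * c j) • direction φ J y j‖ ^ 2 =
        (∑ j, c j ^ 2)⁻¹ * c j ^ 2 := fun j => by
      rw [norm_smul, norm_direction hφ hy, mul_one, Real.norm_eq_abs, sq_abs, mul_pow, inv_pow,
        Real.sq_sqrt hs.le]
    simp only [h1, ← Finset.mul_sum]
    exact inv_mul_cancel₀ hs.ne'
  · refine smul_ne_zero (mul_pos hs' (hpos j)).ne' fun h => ?_
    have := norm_direction (J := J) hφ hy j
    rw [h, norm_zero] at this
    exact zero_ne_one this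

theorem IsRigid.eq_of_isSolution (h : o.IsRigid (direction φ J y)) {x x' : J → Euc n}
    (hx : o.IsSolution φ J y x) (hx' : o.IsSolution φ J y x') : x = x' := by
  obtain ⟨b, -, -, huniq⟩ := h
  obtain ⟨c, hc, hpos, rfl, h1, hne⟩ := isSolution_iff.1 hx
  obtain ⟨c', hc', hpos', rfl, h1', -⟩ := isSolution_iff.1 hx'
  obtain ⟨t, rfl⟩ := huniq c hc
  obtain ⟨t', rfl⟩ := huniq c' hc'
  by_cases hJ : IsEmpty J
  · exact funext fun j => (hJ.false j).elim
  obtain ⟨j⟩ := not_isEmpty_iff.1 hJ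
  have hp := hpos j
  have hp' := hpos' j
  simp only [Pi.smul_apply, smul_eq_mul, mul_smul, norm_smul, mul_pow, ← Finset.mul_sum] at *
  have hS : (∑ i, ‖b i‖ ^ 2 * ‖direction φ J y i‖ ^ 2) ≠ 0 := fun h => by
    rw [h, mul_zero] at h1
    exact zero_ne_one h1
  have hsq : t ^ 2 = t' ^ 2 := by
    have := mul_right_cancel₀ hS (h1.trans h1'.symm)
    simpa only [Real.norm_eq_abs, sq_abs] using this
  have htt : t = t' := by
    rcases sq_eq_sq_iff_eq_or_eq_neg.1 hsq with h | h
    · exact h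
    · rw [h] at hp
      linarith
  rw [htt]

/-- A solution is unique if and only if it is unique without the positivity requirement, because
small multiples of any solution can be added to a positive one. -/
theorem existsUnique_isSolution_iff (hφ : φ ∈ IsManifold.maximalAtlas (𝓡 n) ∞ M)
    (hy : y ∈ (Γ.blowupCharts n M).dom φ) (hJ : J.Nonempty) :
    (∃! x, o.IsSolution φ J y x) ↔ o.IsRigid (direction φ J y) := by
  constructor
  · rintro ⟨x, hx, huniq⟩
    obtain ⟨c, hc, hpos, rfl, -, -⟩ := isSolution_iff.1 hx
    refine ⟨c, hc, hpos, fun c' hc' => ?_⟩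
    obtain ⟨ε, hε, hεpos⟩ : ∃ ε : ℝ, 0 < ε ∧ ∀ j, 0 < c j + ε * c' j := by
      have h1 : ∀ᶠ ε in 𝓝 (0 : ℝ), ∀ j, 0 < c j + ε * c' j := by
        refine Filter.eventually_all.2 fun j => ?_
        have : Continuous fun ε : ℝ => c j + ε * c' j := by fun_prop
        exact this.continuousAt.eventually (lt_mem_nhds (by simpa using hpos j))
      obtain ⟨ε, h, h'⟩ := ((h1.filter_mono nhdsWithin_le_nhds).and
        (self_mem_nhdsWithin : Ioi (0 : ℝ) ∈ 𝓝[>] 0)).exists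
      exact ⟨ε, h', h⟩
    obtain ⟨s, hs, hsol⟩ := exists_isSolution_smul (c := c + ε • c') hφ hy hJ
      (Submodule.add_mem _ hc (Submodule.smul_mem _ _ hc')) hεpos
    have heq := huniq _ hsol
    refine ⟨ε⁻¹ * (s⁻¹ - 1), funext fun j => ?_⟩
    have h1 := congrFun heq j
    have hne : direction φ J y j ≠ 0 := fun h => by
      have := norm_direction (J := J) hφ hy j
      rw [h, norm_zero] at this
      exact zero_ne_one this
    have h2 := smul_left_injective ℝ hne h1
    simp only [Pi.add_apply, Pi.smul_apply, smul_eq_mul] at h2 ⊢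
    field_simp
    linear_combination h2
  · intro h
    obtain ⟨c, hc, hpos, -⟩ := id h
    obtain ⟨s, -, hs⟩ := exists_isSolution_smul hφ hy hJ hc hpos
    exact ⟨_, hs, fun x hx => h.eq_of_isSolution hx hs⟩

end EdgeOrientation

end RibbonGraph

/-! ### The collar of a rigid multiray: coordinates -/

namespace RibbonGraph

variable {F : Type*} [Finite F] {Γ : RibbonGraph F} {o : Γ.EdgeOrientation} {n : ℕ}
  {J : Finset Γ.Edge}

/-- The Euclidean inner product with `x` on `(ℝⁿ)^J`. -/
noncomputable def pairing (x : J → Euc n) : (J → Euc n) →L[ℝ] ℝ :=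
  ∑ j, (innerSL ℝ (x j)).comp (ContinuousLinearMap.proj j)

theorem pairing_apply (x x' : J → Euc n) : pairing x x' = ∑ j, inner ℝ (x j) (x' j) := by
  simp [pairing]

theorem pairing_self (x : J → Euc n) : pairing x x = ∑ j, ‖x j‖ ^ 2 := by
  simp [pairing_apply]

/-- The Euclidean norm on `(ℝⁿ)^J`. -/
noncomputable def norm₂ (x : J → Euc n) : ℝ := √(∑ j, ‖x j‖ ^ 2)

theorem norm₂_pos (hJ : J.Nonempty) {x : J → Euc n} (hx : ∀ j, x j ≠ 0) : 0 < norm₂ x := by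
  obtain ⟨j, hj⟩ := hJ
  exact Real.sqrt_pos.2 (Finset.sum_pos (fun j _ => pow_pos (norm_pos_iff.2 (hx j)) 2)
    ⟨⟨j, hj⟩, Finset.mem_univ _⟩)

theorem norm₂_smul {t : ℝ} (ht : 0 ≤ t) (x : J → Euc n) : norm₂ (t • x) = t * norm₂ x := by
  simp only [norm₂, Pi.smul_apply, norm_smul, mul_pow, ← Finset.mul_sum, Real.norm_eq_abs, sq_abs]
  rw [Real.sqrt_mul (sq_nonneg t), Real.sqrt_sq ht]

theorem contDiffAt_norm₂ (hJ : J.Nonempty) {x : J → Euc n} (hx : ∀ j, x j ≠ 0) :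
    ContDiffAt ℝ ∞ norm₂ x := by
  have h : ContDiff ℝ ∞ fun x : J → Euc n => ∑ j, ‖x j‖ ^ 2 := by
    refine ContDiff.sum fun j _ => ?_
    exact (contDiff_norm_sq ℝ).comp (contDiff_apply ℝ (Euc n) j)
  exact h.contDiffAt.sqrt (Real.sqrt_pos.1 (norm₂_pos hJ hx)).ne'

namespace EdgeOrientation

/-- The solution of the cycle equations on a multiray `θ` near a rigid multiray `θ₀`, normalized
by a linear condition, depends smoothly on `θ`: it is the solution of a system of linear equations
that has maximal rank at `θ₀`. -/
theorem IsRigid.exists_contDiffAt_solution {θ₀ : J → Euc n} (h : o.IsRigid θ₀)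
    {x₀ : J → Euc n} (hx₀ : x₀ ∈ LinearMap.range (o.coboundary n J).toLinearMap) {c₀ : J → ℝ}
    (hc₀ : ∀ j, x₀ j = c₀ j • θ₀ j) (h1 : pairing x₀ x₀ = 1) :
    ∃ X : (J → Euc n) → (J → Euc n), ∀ᶠ θ in 𝓝 θ₀, ContDiffAt ℝ ∞ X θ ∧
      ∀ x ∈ LinearMap.range (o.coboundary n J).toLinearMap, ∀ c : J → ℝ, (∀ j, x j = c j • θ j) →
        (∀ j, ‖θ j‖ = 1) → pairing x₀ x = 1 → X θ = x := by
  obtain ⟨R, hR⟩ : ∃ R, R = LinearMap.range (o.coboundary n J).toLinearMap := ⟨_, rfl⟩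
  rw [← hR] at hx₀ ⊢
  -- The normalized solution is the preimage of `(0, 1)` under `A θ`: its components have no part
  -- orthogonal to `θ`, and its pairing with `x₀` is `1`.
  let A : (J → Euc n) → R →ₗ[ℝ] (J → Euc n) × ℝ := fun θ =>
    { toFun := fun x => (fun j => x.1 j - (inner ℝ (θ j) (x.1 j) : ℝ) • θ j, pairing x₀ x.1)
      map_add' := fun x y => by
        refine Prod.ext (funext fun j => ?_) ?_
        · simp only [Submodule.coe_add, Pi.add_apply, inner_add_right, add_smul, Prod.mk_add_mk]
          abel
        · simp
      map_smul' := fun t x => by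
        refine Prod.ext (funext fun j => ?_) ?_
        · simp only [Submodule.coe_smul, Pi.smul_apply, inner_smul_right, mul_smul, Prod.smul_mk,
            smul_sub, RingHom.id_apply]
        · simp }
  have hA : ∀ θ : J → Euc n, (∀ j, ‖θ j‖ = 1) → ∀ x : R, ∀ c : J → ℝ, (∀ j, x.1 j = c j • θ j) →
      pairing x₀ x.1 = 1 → A θ x = (0, 1) := by
    intro θ hθ x c hc hx
    refine Prod.ext (funext fun j => ?_) hx
    change x.1 j - (inner ℝ (θ j) (x.1 j) : ℝ) • θ j = 0
    rw [hc, inner_smul_right, real_inner_self_eq_norm_sq, hθ]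
    simp
  -- Rigidity says that the solutions on `θ₀` are the multiples of `x₀`.
  have hker : LinearMap.ker (A θ₀) = ⊥ := by
    refine LinearMap.ker_eq_bot'.2 fun x hx => ?_
    have hx1 : ∀ j, x.1 j = (inner ℝ (θ₀ j) (x.1 j) : ℝ) • θ₀ j := fun j =>
      sub_eq_zero.1 (congrFun (congrArg Prod.fst hx) j)
    have hx2 : pairing x₀ x.1 = 0 := congrArg Prod.snd hx
    obtain ⟨c, -, -, huniq⟩ := h
    have hmem : ∀ (y : J → Euc n) (b : J → ℝ), y ∈ R → (∀ j, y j = b j • θ₀ j) → b ∈ o.rays θ₀ := by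
      intro y b hy hyb
      rw [hR] at hy
      obtain ⟨u, hu⟩ := hy
      exact mem_rays.2 ⟨u, fun j => (congrFun hu j).trans (hyb j)⟩
    obtain ⟨t, ht⟩ := huniq _ (hmem _ _ x.2 hx1)
    obtain ⟨t₀, ht₀⟩ := huniq _ (hmem _ _ hx₀ hc₀)
    have ht₀0 : t₀ ≠ 0 := by
      rintro rfl
      have : x₀ = 0 := funext fun j => by rw [hc₀, ht₀]; simp
      rw [this, map_zero] at h1
      exact zero_ne_one h1
    have hxx₀ : x.1 = (t * t₀⁻¹) • x₀ := funext fun j => by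
      have h2 := congrFun ht j
      have h3 := congrFun ht₀ j
      rw [hx1, h2, Pi.smul_apply, Pi.smul_apply, hc₀, h3, Pi.smul_apply, smul_smul]
      congr 1
      simp only [smul_eq_mul]
      field_simp
    have ht0 : t * t₀⁻¹ = 0 := by
      rw [hxx₀, map_smul, h1, smul_eq_mul, mul_one] at hx2
      exact hx2
    exact Subtype.ext (by rw [hxx₀, ht0, zero_smul]; rfl)
  -- With a left inverse `Λ` of `A θ₀`, the map `Λ ∘ A θ` is invertible for `θ` near `θ₀`.
  obtain ⟨Λ, hΛ⟩ := (A θ₀).exists_leftInverse_of_injective hker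
  let B : (J → Euc n) → (R →L[ℝ] R) := fun θ => (Λ ∘ₗ A θ).toContinuousLinearMap
  have hB0 : B θ₀ = (ContinuousLinearEquiv.refl ℝ R : R →L[ℝ] R) := by
    ext1 x
    exact LinearMap.congr_fun hΛ x
  have hB : ContDiff ℝ ∞ B := by
    refine contDiff_clm_apply_iff.2 fun x => ?_
    change ContDiff ℝ ∞ fun θ => Λ.toContinuousLinearMap (A θ x)
    refine (ContinuousLinearMap.contDiff _).comp (ContDiff.prodMk (contDiff_pi.2 fun j => ?_)
      contDiff_const)
    have hj : ContDiff ℝ ∞ fun θ : J → Euc n => θ j := contDiff_apply ℝ (Euc n) j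
    exact contDiff_const.sub ((hj.inner ℝ contDiff_const).smul hj)
  refine ⟨fun θ => ((B θ).inverse (Λ (0, 1))).1, ?_⟩
  have hev : ∀ᶠ θ in 𝓝 θ₀, B θ ∈ range ((↑) : (R ≃L[ℝ] R) → R →L[ℝ] R) := by
    refine hB.continuous.continuousAt.eventually ?_
    rw [hB0]
    exact ContinuousLinearEquiv.nhds _
  filter_upwards [hev] with θ hθ
  obtain ⟨b, hb⟩ := hθ
  refine ⟨?_, fun x hx c hc hn hx1 => ?_⟩
  · have h2 : ContDiffAt ℝ ∞ (fun θ => (B θ).inverse) θ := by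
      refine ContDiffAt.comp (g := ContinuousLinearMap.inverse) θ ?_ hB.contDiffAt
      rw [← hb]
      exact contDiffAt_map_inverse b
    exact R.subtypeL.contDiff.contDiffAt.comp (𝕜 := ℝ) (f := fun θ => (B θ).inverse (Λ (0, 1)))
      θ (h2.clm_apply contDiffAt_const)
  · have h3 := hA θ hn ⟨x, hx⟩ c hc hx1
    have h4 : Λ (0, 1) = B θ ⟨x, hx⟩ := by rw [← h3]; rfl
    change ((B θ).inverse (Λ (0, 1))).1 = x
    rw [h4, ← hb, ContinuousLinearMap.inverse_equiv]
    exact congrArg Subtype.val (b.symm_apply_apply _)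

/-! ### The collar map and its inverse -/

variable (o) in
/-- The positions of the vertices in the collar coordinates `(t, h)`. Along the edges in `J` the
differences of the positions are the `t`-fold multiples of the unit vector in the direction of
`x₀ + δ h`; here `s` is a section of `δ`. -/
noncomputable def collarPos (s : (J → Euc n) →L[ℝ] (Γ.Vert → Euc n)) (x₀ : J → Euc n)
    (w : ℝ × (Γ.Vert → Euc n)) : Γ.Vert → Euc n :=
  w.2 - s (o.coboundary n J w.2) + (w.1 * (norm₂ (x₀ + o.coboundary n J w.2))⁻¹) •
    s (x₀ + o.coboundary n J w.2)

open Classical in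
variable (o) in
/-- The coordinates in the blow-up of the point with collar coordinates `(t, h)`. -/
noncomputable def collarCoord (s : (J → Euc n) →L[ℝ] (Γ.Vert → Euc n)) (x₀ : J → Euc n)
    (w : ℝ × (Γ.Vert → Euc n)) : Γ.BlowupCoord n :=
  o.coordOf (o.collarPos s x₀ w)
    (fun l => if hl : l ∈ J then ‖(x₀ + o.coboundary n J w.2) ⟨l, hl⟩‖⁻¹ •
        (x₀ + o.coboundary n J w.2) ⟨l, hl⟩
      else ‖o.collarPos s x₀ w (o.head l) - o.collarPos s x₀ w (o.tail l)‖⁻¹ •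
        (o.collarPos s x₀ w (o.head l) - o.collarPos s x₀ w (o.tail l)))
    (fun l => if hl : l ∈ J then w.1 * (norm₂ (x₀ + o.coboundary n J w.2))⁻¹ *
        ‖(x₀ + o.coboundary n J w.2) ⟨l, hl⟩‖
      else ‖o.collarPos s x₀ w (o.head l) - o.collarPos s x₀ w (o.tail l)‖)

/-- The components of a multiray at the edges in `J`, in coordinates. -/
def rayCoord (J : Finset Γ.Edge) (z : Γ.BlowupCoord n) : J → Euc n := fun j => (z.1 j.1).2.1

variable (o) in
/-- The collar coordinates of a point, given the function `X` that assigns to a multiray the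
solution of the cycle equations. -/
noncomputable def collarInv (s : (J → Euc n) →L[ℝ] (Γ.Vert → Euc n)) (x₀ : J → Euc n)
    (X : (J → Euc n) → (J → Euc n)) (z : Γ.BlowupCoord n) : ℝ × (Γ.Vert → Euc n) :=
  (norm₂ (X (rayCoord J z)) * pairing x₀ (o.coboundary n J (o.posCoord z)),
    o.posCoord z - s (o.coboundary n J (o.posCoord z)) + s (X (rayCoord J z) - x₀))

/-- The coordinates `z` lie over the vertex diagonal, with positions `u`, and the differences along
the edges in `J` are the `τ`-fold multiples of the solution `x` of the cycle equations. -/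
structure IsCollarPoint (x₀ : J → Euc n) (z : Γ.BlowupCoord n)
    (u : Γ.Vert → Euc n) (x : J → Euc n) (τ : ℝ) : Prop where
  isPosition : o.IsPosition z u
  norm_eq : ∀ l, ‖(z.1 l).2.1‖ = 1
  pos : ∀ l, l ∉ J → 0 < (z.1 l).2.2
  mem_range : x ∈ LinearMap.range (o.coboundary n J).toLinearMap
  exists_smul : ∃ c : J → ℝ, (∀ j, 0 < c j) ∧ ∀ j, x j = c j • rayCoord J z j
  pairing_eq : pairing x₀ x = 1
  coboundary_eq : o.coboundary n J u = τ • x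

variable {s : (J → Euc n) →L[ℝ] (Γ.Vert → Euc n)} {x₀ : J → Euc n}

/-- The defining property of the section `s`, for the difference at a vertex. -/
theorem coboundary_section {a : Γ.Vert}
    (hs : ∀ u, ∀ v ∈ o.vertOf J, s (o.coboundary n J u) v = u v - u a) {x : J → Euc n}
    (hx : x ∈ LinearMap.range (o.coboundary n J).toLinearMap) : o.coboundary n J (s x) = x := by
  obtain ⟨u, rfl⟩ := hx
  funext j
  change s (o.coboundary n J u) _ - s (o.coboundary n J u) _ = u _ - u _
  rw [hs u _ (head_mem_vertOf j.2), hs u _ (tail_mem_vertOf j.2)]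
  abel

theorem coboundary_collarPos {a : Γ.Vert}
    (hs : ∀ u, ∀ v ∈ o.vertOf J, s (o.coboundary n J u) v = u v - u a)
    (hx₀ : x₀ ∈ LinearMap.range (o.coboundary n J).toLinearMap) (w : ℝ × (Γ.Vert → Euc n)) :
    o.coboundary n J (o.collarPos s x₀ w) =
      (w.1 * (norm₂ (x₀ + o.coboundary n J w.2))⁻¹) • (x₀ + o.coboundary n J w.2) := by
  have h2 : o.coboundary n J w.2 ∈ LinearMap.range (o.coboundary n J).toLinearMap := ⟨_, rfl⟩
  rw [collarPos, map_add, map_sub, map_smul, coboundary_section hs h2,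
    coboundary_section hs (Submodule.add_mem _ hx₀ h2), sub_self, zero_add]

/-- The collar map takes values over the vertex diagonal, with `x₀ + δ h` as the solution. -/
theorem isCollarPoint_collarCoord {a : Γ.Vert}
    (hs : ∀ u, ∀ v ∈ o.vertOf J, s (o.coboundary n J u) v = u v - u a)
    (hx₀ : x₀ ∈ LinearMap.range (o.coboundary n J).toLinearMap) (h1 : pairing x₀ x₀ = 1)
    {w : ℝ × (Γ.Vert → Euc n)} (hw : pairing x₀ (o.coboundary n J w.2) = 0)
    (hne : ∀ j, (x₀ + o.coboundary n J w.2) j ≠ 0)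
    (hne' : ∀ l, l ∉ J → o.collarPos s x₀ w (o.head l) - o.collarPos s x₀ w (o.tail l) ≠ 0) :
    o.IsCollarPoint x₀ (o.collarCoord s x₀ w) (o.collarPos s x₀ w) (x₀ + o.coboundary n J w.2)
      (w.1 * (norm₂ (x₀ + o.coboundary n J w.2))⁻¹) := by
  have hδ := coboundary_collarPos hs hx₀ w
  refine ⟨isPosition_coordOf fun l => ?_, fun l => ?_, fun l hl => ?_,
    Submodule.add_mem _ hx₀ ⟨_, rfl⟩, ⟨fun j => ‖(x₀ + o.coboundary n J w.2) j‖,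
      fun j => norm_pos_iff.2 (hne j), fun j => ?_⟩, by rw [map_add, h1, hw, add_zero], hδ⟩
  · by_cases hl : l ∈ J
    · rw [dif_pos hl, dif_pos hl, mul_smul, smul_smul _ (_⁻¹) , mul_inv_cancel₀
        (norm_ne_zero_iff.2 (hne ⟨l, hl⟩)), one_smul]
      exact (congrFun hδ ⟨l, hl⟩).symm
    · rw [dif_neg hl, dif_neg hl, smul_smul, mul_inv_cancel₀ (norm_ne_zero_iff.2 (hne' l hl)),
        one_smul]
  · simp only [collarCoord, coordOf]
    by_cases hl : l ∈ J
    · rw [dif_pos hl]; exact norm_smul_inv_norm (hne ⟨l, hl⟩)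
    · rw [dif_neg hl]; exact norm_smul_inv_norm (hne' l hl)
  · simp only [collarCoord, coordOf]
    rw [dif_neg hl]
    exact norm_pos_iff.2 (hne' l hl)
  · simp only [rayCoord, collarCoord, coordOf]
    rw [dif_pos j.2, smul_smul, mul_inv_cancel₀ (norm_ne_zero_iff.2 (hne j)), one_smul]

namespace IsCollarPoint

variable {z : Γ.BlowupCoord n} {u : Γ.Vert → Euc n} {x : J → Euc n} {τ : ℝ}
  {X : (J → Euc n) → (J → Euc n)} {a : Γ.Vert}

theorem ne_zero (h : o.IsCollarPoint x₀ z u x τ) (j : J) : x j ≠ 0 := by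
  obtain ⟨c, hc, hx⟩ := h.exists_smul
  rw [hx]
  refine smul_ne_zero (hc j).ne' fun h0 => ?_
  have := h.norm_eq j.1
  rw [show (z.1 j.1).2.1 = 0 from h0, norm_zero] at this
  exact zero_ne_one this

theorem collarInv_eq (h : o.IsCollarPoint x₀ z u x τ) (hX : X (rayCoord J z) = x) :
    o.collarInv s x₀ X z = (norm₂ x * τ, u - τ • s x + s (x - x₀)) := by
  rw [collarInv, h.isPosition.posCoord, h.coboundary_eq, hX, map_smul, map_smul, h.pairing_eq,
    smul_eq_mul, mul_one]

theorem coboundary_collarInv (h : o.IsCollarPoint x₀ z u x τ)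
    (hs : ∀ u, ∀ v ∈ o.vertOf J, s (o.coboundary n J u) v = u v - u a)
    (hx₀ : x₀ ∈ LinearMap.range (o.coboundary n J).toLinearMap) :
    o.coboundary n J (u - τ • s x + s (x - x₀)) = x - x₀ := by
  rw [map_add, map_sub, map_smul, coboundary_section hs h.mem_range,
    coboundary_section hs (Submodule.sub_mem _ h.mem_range hx₀), h.coboundary_eq, sub_self,
    zero_add]

/-- The collar map recovers a point from its collar coordinates. -/
theorem collarCoord_eq (hJ : J.Nonempty) (h : o.IsCollarPoint x₀ z u x τ)
    (hs : ∀ u, ∀ v ∈ o.vertOf J, s (o.coboundary n J u) v = u v - u a)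
    (hx₀ : x₀ ∈ LinearMap.range (o.coboundary n J).toLinearMap) :
    o.collarCoord s x₀ (norm₂ x * τ, u - τ • s x + s (x - x₀)) = z := by
  have hδ := h.coboundary_collarInv hs hx₀
  have hN := norm₂_pos hJ h.ne_zero
  have hτ : norm₂ x * τ * (norm₂ x)⁻¹ = τ := by field_simp
  have hpos : o.collarPos s x₀ (norm₂ x * τ, u - τ • s x + s (x - x₀)) = u := by
    rw [collarPos]
    dsimp only
    rw [hδ, add_sub_cancel, hτ]
    abel
  obtain ⟨c, hc, hxc⟩ := h.exists_smul
  have hc' : ∀ j : J, ‖x j‖ = c j := fun j => by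
    rw [hxc, norm_smul, show ‖rayCoord J z j‖ = 1 from h.norm_eq j.1, mul_one,
      Real.norm_of_nonneg (hc j).le]
  refine Prod.ext (funext fun l => ?_) (funext fun i => ?_)
  · simp only [collarCoord, coordOf, hpos, hδ, add_sub_cancel, hτ]
    refine Prod.ext (h.isPosition.1 l).1.symm ?_
    have hr := h.isPosition.radius_smul l
    by_cases hl : l ∈ J
    · simp only [dif_pos hl]
      refine Prod.ext ?_ ?_
      · dsimp only
        rw [hc', hxc, smul_smul, inv_mul_cancel₀ (hc _).ne', one_smul]
        rfl
      · dsimp only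
        have h2 : o.coboundary n J u ⟨l, hl⟩ = (z.1 l).2.2 • (z.1 l).2.1 := hr.symm
        rw [h.coboundary_eq, Pi.smul_apply, hxc, smul_smul] at h2
        have hne : (z.1 l).2.1 ≠ 0 := fun h0 => by
          have := h.norm_eq l
          rw [h0, norm_zero] at this
          exact zero_ne_one this
        rw [hc']
        exact smul_left_injective ℝ hne h2
    · simp only [dif_neg hl]
      have h3 := eq_direction_of_smul (h.pos l hl) (h.norm_eq l) hr
      exact Prod.ext h3.2.symm h3.1.symm
  · simp only [collarCoord, coordOf, hpos]
    exact (h.isPosition.2 i).symm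

end IsCollarPoint

/-- The collar coordinates of the points in the image of the collar map. -/
theorem collarInv_collarCoord {X : (J → Euc n) → (J → Euc n)} {a : Γ.Vert} (hJ : J.Nonempty)
    (hs : ∀ u, ∀ v ∈ o.vertOf J, s (o.coboundary n J u) v = u v - u a)
    (hx₀ : x₀ ∈ LinearMap.range (o.coboundary n J).toLinearMap) (h1 : pairing x₀ x₀ = 1)
    {w : ℝ × (Γ.Vert → Euc n)} (hw : pairing x₀ (o.coboundary n J w.2) = 0)
    (hne : ∀ j, (x₀ + o.coboundary n J w.2) j ≠ 0)
    (hne' : ∀ l, l ∉ J → o.collarPos s x₀ w (o.head l) - o.collarPos s x₀ w (o.tail l) ≠ 0)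
    (hX : X (rayCoord J (o.collarCoord s x₀ w)) = x₀ + o.coboundary n J w.2) :
    o.collarInv s x₀ X (o.collarCoord s x₀ w) = w := by
  rw [(isCollarPoint_collarCoord hs hx₀ h1 hw hne hne').collarInv_eq hX]
  have hN := norm₂_pos hJ hne
  refine Prod.ext ?_ ?_
  · dsimp only
    field_simp
  · dsimp only
    rw [collarPos, add_sub_cancel_left]
    abel

theorem contDiffAt_collarPos (hJ : J.Nonempty) {w : ℝ × (Γ.Vert → Euc n)}
    (hne : ∀ j, (x₀ + o.coboundary n J w.2) j ≠ 0) :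
    ContDiffAt ℝ ∞ (o.collarPos s x₀) w := by
  have h2 : ContDiff ℝ ∞ fun w : ℝ × (Γ.Vert → Euc n) => x₀ + o.coboundary n J w.2 := by fun_prop
  have h3 : ContDiffAt ℝ ∞ (fun w : ℝ × (Γ.Vert → Euc n) =>
      (norm₂ (x₀ + o.coboundary n J w.2))⁻¹) w :=
    (ContDiffAt.comp (g := norm₂) w (contDiffAt_norm₂ hJ hne) h2.contDiffAt).inv
      (norm₂_pos hJ hne).ne'
  unfold collarPos
  refine ContDiffAt.add (by fun_prop) ((contDiffAt_fst.mul h3).smul ?_)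
  exact (s.contDiff.comp h2).contDiffAt

theorem contDiffAt_collarCoord (hJ : J.Nonempty) {w : ℝ × (Γ.Vert → Euc n)}
    (hne : ∀ j, (x₀ + o.coboundary n J w.2) j ≠ 0)
    (hne' : ∀ l, l ∉ J → o.collarPos s x₀ w (o.head l) - o.collarPos s x₀ w (o.tail l) ≠ 0) :
    ContDiffAt ℝ ∞ (o.collarCoord s x₀) w := by
  have hp := contDiffAt_pi.1 (contDiffAt_collarPos (s := s) hJ hne)
  have h2 : ContDiff ℝ ∞ fun w : ℝ × (Γ.Vert → Euc n) => x₀ + o.coboundary n J w.2 := by fun_prop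
  have h2j := fun j => contDiffAt_pi.1 (h2.contDiffAt (x := w)) j
  have h3 : ContDiffAt ℝ ∞ (fun w : ℝ × (Γ.Vert → Euc n) =>
      (norm₂ (x₀ + o.coboundary n J w.2))⁻¹) w :=
    (ContDiffAt.comp (g := norm₂) w (contDiffAt_norm₂ hJ hne) h2.contDiffAt).inv
      (norm₂_pos hJ hne).ne'
  unfold collarCoord coordOf
  refine ContDiffAt.prodMk (contDiffAt_pi.2 fun l => (hp _).prodMk ?_)
    (contDiffAt_pi.2 fun i => hp _)
  by_cases hl : l ∈ J
  · simp only [dif_pos hl]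
    have hn := (h2j ⟨l, hl⟩).norm ℝ (hne ⟨l, hl⟩)
    exact ((hn.inv (norm_ne_zero_iff.2 (hne _))).smul (h2j _)).prodMk
      ((contDiffAt_fst.mul h3).mul hn)
  · simp only [dif_neg hl]
    have hd := (hp (o.head l)).sub (hp (o.tail l))
    have hn := hd.norm ℝ (hne' l hl)
    exact ((hn.inv (norm_ne_zero_iff.2 (hne' l hl))).smul hd).prodMk hn

theorem contDiffAt_collarInv {X : (J → Euc n) → (J → Euc n)} (hJ : J.Nonempty)
    {z : Γ.BlowupCoord n} (hX : ContDiffAt ℝ ∞ X (rayCoord J z))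
    (hne : ∀ j, X (rayCoord J z) j ≠ 0) : ContDiffAt ℝ ∞ (o.collarInv s x₀ X) z := by
  have h1 : ContDiffAt ℝ ∞ (fun z : Γ.BlowupCoord n => X (rayCoord J z)) z := by
    refine hX.comp z ?_
    have : ContDiff ℝ ∞ (rayCoord J : Γ.BlowupCoord n → J → Euc n) := by
      unfold rayCoord; fun_prop
    exact this.contDiffAt
  have h2 : ContDiffAt ℝ ∞ (o.posCoord : Γ.BlowupCoord n → _) z := (contDiff_posCoord o n).contDiffAt
  have h3 : ContDiffAt ℝ ∞ (fun z : Γ.BlowupCoord n => norm₂ (X (rayCoord J z))) z :=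
    ContDiffAt.comp (g := norm₂) z (contDiffAt_norm₂ hJ hne) h1
  have h4 : ContDiffAt ℝ ∞ (fun z : Γ.BlowupCoord n => o.coboundary n J (o.posCoord z)) z :=
    (o.coboundary n J).contDiff.contDiffAt.comp z h2
  unfold collarInv
  exact (h3.mul ((pairing x₀).contDiff.contDiffAt.comp z h4)).prodMk
    ((h2.sub (s.contDiff.contDiffAt.comp z h4)).add
      (s.contDiff.contDiffAt.comp z (h1.sub contDiffAt_const)))

end EdgeOrientation

end RibbonGraph

/-! ### The collar of a smooth boundary point -/

namespace RibbonGraph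

variable {F : Type*} [Finite F] {Γ : RibbonGraph F} {n : ℕ}
  {M : Type*} [TopologicalSpace M] [ChartedSpace (EuclideanSpace ℝ (Fin n)) M]

/-- Collar coordinates `(t, h)` for the smooth part of the configuration space near a point of
`C_{J1}`. In the coordinates of the blow-up given by `φ`, they are defined by mutually inverse
maps `inv` and `map` that are smooth on open sets `V` and `O`, not only on the closed half-space
`0 ≤ t`; the boundary is given by `t = 0`. -/
structure CollarChart (o : Γ.EdgeOrientation)
    (φ : OpenPartialHomeomorph M (EuclideanSpace ℝ (Fin n))) (J : Finset Γ.Edge)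
    (W : Type*) [NormedAddCommGroup W] [NormedSpace ℝ W] where
  V : Set (Γ.BlowupCoord n)
  O : Set (ℝ × W)
  inv : Γ.BlowupCoord n → ℝ × W
  map : ℝ × W → Γ.BlowupCoord n
  isOpen_V : IsOpen V
  isOpen_O : IsOpen O
  contDiffAt_inv : ∀ z ∈ V, ContDiffAt ℝ ∞ inv z
  contDiffAt_map : ∀ w ∈ O, ContDiffAt ℝ ∞ map w
  inv_mem : ∀ y ∈ o.smoothPart n M, y ∈ (Γ.blowupCharts n M).dom φ →
    (Γ.blowupCharts n M).chart φ y ∈ V → inv ((Γ.blowupCharts n M).chart φ y) ∈ O ∧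
      0 ≤ (inv ((Γ.blowupCharts n M).chart φ y)).1 ∧
      map (inv ((Γ.blowupCharts n M).chart φ y)) = (Γ.blowupCharts n M).chart φ y
  map_mem : ∀ w ∈ O, 0 ≤ w.1 → map w ∈ Γ.chartRange φ ∩ V ∧ inv (map w) = w
  mem_stratum : ∀ w ∈ O, 0 < w.1 → ∀ y ∈ (Γ.blowupCharts n M).dom φ,
    (Γ.blowupCharts n M).chart φ y = map w → y ∈ o.stratum n M ∅
  mem_smoothStratum : ∀ w ∈ O, w.1 = 0 → ∀ y ∈ (Γ.blowupCharts n M).dom φ,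
    (Γ.blowupCharts n M).chart φ y = map w → y ∈ o.smoothStratum n M J

variable {o : Γ.EdgeOrientation} {φ : OpenPartialHomeomorph M (EuclideanSpace ℝ (Fin n))}
  {J : Finset Γ.Edge} {y : Γ.Xtilde n M}

namespace EdgeOrientation

/-- A positive solution on the multiray of `z` can be scaled so that its pairing with `x₀` is `1`. -/
theorem exists_isCollarPoint (hJ : J.Nonempty) {x₀ : J → Euc n} {z : Γ.BlowupCoord n}
    {u : Γ.Vert → Euc n} (hu : o.IsPosition z u) (hnorm : ∀ l, ‖(z.1 l).2.1‖ = 1)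
    (hpos : ∀ l, l ∉ J → 0 < (z.1 l).2.2) (hz : ∀ j, 0 < inner ℝ (x₀ j) (rayCoord J z j))
    {c : J → ℝ} (hc : c ∈ o.rays (rayCoord J z)) (hc0 : ∀ j, 0 < c j) {τ : ℝ} (hτ : 0 ≤ τ)
    (hδ : o.coboundary n J u = τ • fun j => c j • rayCoord J z j) :
    ∃ x : J → Euc n, ∃ τ' : ℝ, 0 ≤ τ' ∧ o.IsCollarPoint x₀ z u x τ' := by
  obtain ⟨b, hb⟩ : ∃ b, b = pairing x₀ fun j => c j • rayCoord J z j := ⟨_, rfl⟩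
  have hb0 : 0 < b := by
    obtain ⟨j, hj⟩ := hJ
    rw [hb, pairing_apply]
    refine Finset.sum_pos (fun j _ => ?_) ⟨⟨j, hj⟩, Finset.mem_univ _⟩
    rw [inner_smul_right]
    exact mul_pos (hc0 j) (hz j)
  refine ⟨b⁻¹ • fun j => c j • rayCoord J z j, b * τ, mul_nonneg hb0.le hτ, hu, hnorm, hpos,
    Submodule.smul_mem _ _ hc, ⟨fun j => b⁻¹ * c j, fun j => mul_pos (inv_pos.2 hb0) (hc0 j),
      fun j => by simp only [Pi.smul_apply, smul_smul]⟩, ?_, ?_⟩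
  · rw [map_smul, ← hb, smul_eq_mul, inv_mul_cancel₀ hb0.ne']
  · rw [hδ, smul_smul, mul_right_comm, mul_inv_cancel₀ hb0.ne', one_mul]

variable [IsManifold (𝓡 n) ∞ M] [T2Space M] [NeZero n]

/-- Properties that hold near a point hold on a neighbourhood in the coordinates. -/
theorem eventually_chart (hφ : φ ∈ IsManifold.maximalAtlas (𝓡 n) ∞ M)
    (hy : y ∈ (Γ.blowupCharts n M).dom φ) {P : Γ.Xtilde n M → Prop} (h : ∀ᶠ y' in 𝓝 y, P y') :
    ∀ᶠ z in 𝓝 ((Γ.blowupCharts n M).chart φ y), ∀ y' ∈ (Γ.blowupCharts n M).dom φ,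
      (Γ.blowupCharts n M).chart φ y' = z → P y' := by
  rw [(isSmooth_blowupCharts Γ n M).nhds_eq φ hφ y hy, Filter.eventually_inf_principal,
    Filter.eventually_comap] at h
  filter_upwards [h] with z hz y' hy' hyz using hz y' hyz hy'

variable [CompactSpace M]

/-- Near a smooth boundary point there are collar coordinates `(t, h)`, where `h` are positions `u`
of the vertices subject to one linear normalization. The solution of the cycle equations at the
point is `x₀ + δ h`, up to scaling, and the points with equal `h` are joined by the segments along
which the edges in `J` grow by `t` times the normalized solution while the vertex `a` is fixed. -/
theorem exists_collarChart (hφ : φ ∈ IsManifold.maximalAtlas (𝓡 n) ∞ M) {y₀ : Γ.Xtilde n M}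
    (hJ : J.Nonempty) (hy₀ : y₀ ∈ o.smoothStratum n M J)
    (hd : y₀ ∈ (Γ.blowupCharts n M).dom φ) {a : Γ.Vert} (ha : a ∈ o.vertOf J) :
    ∃ W : Submodule ℝ (Γ.Vert → Euc n), Module.finrank ℝ W = Γ.confDim n - 1 ∧
      ∃ C : Γ.CollarChart (M := M) o φ J W, (Γ.blowupCharts n M).chart φ y₀ ∈ C.V ∧
        ∀ t h, (t, h) ∈ C.O → (0, h) ∈ C.O → 0 ≤ t →
          ∀ y ∈ (Γ.blowupCharts n M).dom φ, ∀ b ∈ (Γ.blowupCharts n M).dom φ,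
            (Γ.blowupCharts n M).chart φ y = C.map (0, h) →
            (Γ.blowupCharts n M).chart φ b = C.map (t, h) →
            o.IsBoundaryChartValue φ J a t y b := by
  classical
  have hbl : blowdown y₀ ∈ o.vertexDiagonal M ∩ edgeStratum M J :=
    ⟨o.conf_subset n M hy₀.1.1, hy₀.1.2⟩
  have hrig := (mem_smoothStratum_iff hφ hd hJ hbl).1 hy₀
  have hn₀ : ∀ j, ‖direction φ J y₀ j‖ = 1 := norm_direction hφ hd
  have hzr := chart_mem_chartRange (Γ := Γ) hφ hd
  obtain ⟨u₀, hu₀⟩ := (mem_vertexDiagonal_iff hd).1 hbl.1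
  have hr := (mem_edgeStratum_iff hd).1 hbl.2
  have hgood : ∀ᶠ y in 𝓝 y₀, y ∉ o.sing n M ∧
      ∀ I : Finset Γ.Edge, I.Nonempty → y ∈ o.stratum n M I → I = J :=
    ((o.isClosed_sing n M).isOpen_compl.eventually_mem hy₀.2).and (eventually_mem_stratum hy₀)
  have hgood' := eventually_chart hφ hd hgood
  -- the unique solution for the given point
  obtain ⟨x₀, hx₀, -⟩ := (existsUnique_isSolution_iff hφ hd hJ).2 hrig
  obtain ⟨c₀, hc₀, hc₀pos, hx₀c, hx₀n, hx₀ne⟩ := isSolution_iff.1 hx₀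
  have hx₀r : x₀ ∈ LinearMap.range (o.coboundary n J).toLinearMap := by
    rw [hx₀c]; exact hc₀
  have h1 : pairing x₀ x₀ = 1 := by rw [pairing_self, hx₀n]
  -- a section `s` of `δ` that fixes the vertex `a` and the vertices outside `Γ_J`, and the solution
  -- `X` as a function of the multiray
  obtain ⟨s, hs, hs0⟩ := exists_potential (o := o) (J := J) n a fun v hv => hrig.joined ha hv
  obtain ⟨X, hX⟩ := hrig.exists_contDiffAt_solution hx₀r (fun j => congrFun hx₀c j) h1
  have hdir : direction φ J y₀ = rayCoord J ((Γ.blowupCharts n M).chart φ y₀) := rfl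
  obtain ⟨z₀, hz₀⟩ : ∃ z, z = (Γ.blowupCharts n M).chart φ y₀ := ⟨_, rfl⟩
  rw [← hz₀] at hzr hu₀ hgood' hdir ⊢
  simp only [← hz₀] at hr
  rw [hdir] at hX hn₀ hx₀c hc₀
  have hδu₀ : o.coboundary n J u₀ = 0 := funext fun j => by
    have := hu₀.radius_smul j.1
    rw [(hr j.1).2 j.2, zero_smul] at this
    exact this.symm
  have hcp : o.IsCollarPoint x₀ z₀ u₀ x₀ 0 := by
    refine ⟨hu₀, fun l => (hzr.1 l).2.2.1, fun l hl => ?_, hx₀r,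
      ⟨c₀, hc₀pos, fun j => congrFun hx₀c j⟩, h1, by rw [hδu₀, zero_smul]⟩
    exact lt_of_le_of_ne (hzr.1 l).2.2.2 fun h => hl ((hr l).1 h.symm)
  have hXx₀ : X (rayCoord J z₀) = x₀ :=
    hX.self_of_nhds.2 x₀ hx₀r c₀ (fun j => congrFun hx₀c j) hn₀ h1
  have hw₀ : o.collarCoord s x₀ (0, u₀) = z₀ := by
    have := hcp.collarCoord_eq hJ hs hx₀r
    simpa using this
  have hp₀ : o.collarPos s x₀ (0, u₀) = u₀ := by
    simp [collarPos, hδu₀]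
  have hne₀ : ∀ j, (x₀ + o.coboundary n J ((0, u₀) : ℝ × (Γ.Vert → Euc n)).2) j ≠ 0 := by
    simpa [hδu₀] using hx₀ne
  have hne₀' : ∀ l, l ∉ J → o.collarPos s x₀ (0, u₀) (o.head l) -
      o.collarPos s x₀ (0, u₀) (o.tail l) ≠ 0 := fun l hl => by
    rw [hp₀, ← hu₀.radius_smul l]
    refine smul_ne_zero (hcp.pos l hl).ne' fun h => ?_
    have := hcp.norm_eq l
    rw [h, norm_zero] at this
    exact zero_ne_one this
  -- the open set of good collar coordinates
  have hcont := (contDiffAt_collarPos (s := s) (w := (0, u₀)) hJ hne₀).continuousAt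
  have hcontv : ∀ v, ContinuousAt (fun w => o.collarPos s x₀ w v) (0, u₀) := fun v =>
    (continuous_apply v).continuousAt.comp hcont
  have hcontC := (contDiffAt_collarCoord (s := s) (w := (0, u₀)) hJ hne₀ hne₀').continuousAt
  rw [ContinuousAt, hw₀] at hcontC
  have hrayc : Continuous (rayCoord J : Γ.BlowupCoord n → J → Euc n) := by
    unfold rayCoord; fun_prop
  have hXz := hrayc.continuousAt.eventually hX
  have hO : ∀ᶠ w in 𝓝 ((0 : ℝ), u₀), (∀ j, (x₀ + o.coboundary n J w.2) j ≠ 0) ∧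
      (∀ l, l ∉ J → o.collarPos s x₀ w (o.head l) - o.collarPos s x₀ w (o.tail l) ≠ 0) ∧
      (∀ v, o.collarPos s x₀ w v ∈ φ.target) := by
    refine Filter.Eventually.and ?_ (Filter.Eventually.and ?_ ?_)
    · refine Filter.eventually_all.2 fun j => ?_
      have : Continuous fun w : ℝ × (Γ.Vert → Euc n) => (x₀ + o.coboundary n J w.2) j := by
        fun_prop
      exact this.continuousAt.eventually_ne (hne₀ j)
    · refine Filter.eventually_all.2 fun l => ?_
      by_cases hl : l ∈ J
      · exact Filter.Eventually.of_forall fun w h => absurd hl h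
      · filter_upwards [((hcontv (o.head l)).sub (hcontv (o.tail l))).eventually_ne (hne₀' l hl)]
          with w hw _ using hw
    · refine Filter.eventually_all.2 fun v => (hcontv v).eventually
        (φ.open_target.mem_nhds ?_)
      change o.collarPos s x₀ (0, u₀) v ∈ φ.target
      rw [hp₀]
      exact hu₀.mem_target hzr v
  obtain ⟨O₁, hO₁, hO₁o, hO₁m⟩ := eventually_nhds_iff.1 hO
  -- the open set of good coordinates in the blow-up
  have hV : ∀ᶠ z in 𝓝 z₀, (ContDiffAt ℝ ∞ X (rayCoord J z) ∧
      ∀ x ∈ LinearMap.range (o.coboundary n J).toLinearMap, ∀ c : J → ℝ,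
        (∀ j, x j = c j • rayCoord J z j) → (∀ j, ‖rayCoord J z j‖ = 1) →
        pairing x₀ x = 1 → X (rayCoord J z) = x) ∧
      (∀ j, X (rayCoord J z) j ≠ 0) ∧ (∀ j, 0 < inner ℝ (x₀ j) (rayCoord J z j)) ∧
      ∀ y' ∈ (Γ.blowupCharts n M).dom φ, (Γ.blowupCharts n M).chart φ y' = z →
        y' ∉ o.sing n M ∧ ∀ I : Finset Γ.Edge, I.Nonempty → y' ∈ o.stratum n M I → I = J := by
    refine hXz.and (Filter.Eventually.and ?_ (Filter.Eventually.and ?_ hgood'))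
    · refine Filter.eventually_all.2 fun j => ?_
      have : ContinuousAt (fun z => X (rayCoord J z) j) z₀ :=
        (continuous_apply j).continuousAt.comp
          (ContinuousAt.comp (g := X) hX.self_of_nhds.1.continuousAt hrayc.continuousAt)
      refine this.eventually_ne ?_
      rw [hXx₀]
      exact hx₀ne j
    · refine Filter.eventually_all.2 fun j => ?_
      have : Continuous fun z : Γ.BlowupCoord n => (inner ℝ (x₀ j) (rayCoord J z j) : ℝ) :=
        continuous_const.inner ((continuous_apply j).comp hrayc)
      refine this.continuousAt.eventually (lt_mem_nhds ?_)
      change 0 < inner ℝ (x₀ j) (rayCoord J z₀ j)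
      rw [congrFun hx₀c j, real_inner_smul_left, real_inner_self_eq_norm_sq, hn₀]
      simpa using hc₀pos j
  obtain ⟨V₁, hV₁, hV₁o, hV₁m⟩ := eventually_nhds_iff.1 hV
  have hinvs : ∀ z ∈ V₁, ContDiffAt ℝ ∞ (o.collarInv s x₀ X) z := fun z hz =>
    contDiffAt_collarInv hJ (hV₁ z hz).1.1 (hV₁ z hz).2.1
  have hmaps : ∀ w ∈ O₁, ContDiffAt ℝ ∞ (o.collarCoord s x₀) w := fun w hw =>
    contDiffAt_collarCoord hJ (hO₁ w hw).1 (hO₁ w hw).2.1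
  -- The open sets are shrunk so that the two maps carry one into the other.
  obtain ⟨V₂, hV₂⟩ : ∃ V₂, V₂ = V₁ ∩ o.collarInv s x₀ X ⁻¹' O₁ := ⟨_, rfl⟩
  have hV₂o : IsOpen V₂ := hV₂ ▸ ContinuousOn.isOpen_inter_preimage
    (fun z hz => (hinvs z hz).continuousAt.continuousWithinAt) hV₁o hO₁o
  obtain ⟨O₂, hO₂⟩ : ∃ O₂, O₂ = O₁ ∩ o.collarCoord s x₀ ⁻¹' V₂ := ⟨_, rfl⟩
  have hO₂o : IsOpen O₂ := hO₂ ▸ ContinuousOn.isOpen_inter_preimage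
    (fun w hw => (hmaps w hw).continuousAt.continuousWithinAt) hO₁o hV₂o
  -- The normalization `pairing x₀ (δ h) = 0` removes the freedom of scaling the solution.
  let ℓ : (Γ.Vert → Euc n) →ₗ[ℝ] ℝ := (pairing x₀).toLinearMap ∘ₗ (o.coboundary n J).toLinearMap
  let W : Submodule ℝ (Γ.Vert → Euc n) := LinearMap.ker ℓ
  have hW : ∀ h : W, pairing x₀ (o.coboundary n J h) = 0 := fun h => h.2
  have hfin : Module.finrank ℝ W = Γ.confDim n - 1 := by
    have hsurj : LinearMap.range ℓ = ⊤ := by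
      refine LinearMap.range_eq_top.2 fun t => ?_
      obtain ⟨u, hu⟩ := hx₀r
      refine ⟨t • u, ?_⟩
      change pairing x₀ (o.coboundary n J (t • u)) = t
      rw [map_smul, show o.coboundary n J u = x₀ from hu, map_smul, h1, smul_eq_mul, mul_one]
    have h2 := ℓ.finrank_range_add_finrank_ker
    rw [hsurj, finrank_top, Module.finrank_self, Module.finrank_pi_fintype] at h2
    simp only [finrank_euclideanSpace, Fintype.card_fin, Finset.sum_const, Finset.card_univ,
      smul_eq_mul] at h2
    rw [confDim, Nat.card_eq_fintype_card, mul_comm, ← h2]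
    simp [W]
  obtain ⟨pr, hpr⟩ := W.subtype.exists_leftInverse_of_injective W.ker_subtype
  have hpr' : ∀ h : W, pr h = h := fun h => LinearMap.congr_fun hpr h
  let ι : ℝ × W → ℝ × (Γ.Vert → Euc n) := fun w => (w.1, w.2)
  have hι : ContDiff ℝ ∞ ι := contDiff_fst.prodMk (W.subtypeL.contDiff.comp contDiff_snd)
  let ρ : ℝ × (Γ.Vert → Euc n) → ℝ × W := fun w => (w.1, pr.toContinuousLinearMap w.2)
  have hρ : ContDiff ℝ ∞ ρ :=
    contDiff_fst.prodMk (pr.toContinuousLinearMap.contDiff.comp contDiff_snd)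
  have hcpw : ∀ w : ℝ × W, ι w ∈ O₁ → o.IsCollarPoint x₀ (o.collarCoord s x₀ (ι w))
      (o.collarPos s x₀ (ι w)) (x₀ + o.coboundary n J w.2)
      (w.1 * (norm₂ (x₀ + o.coboundary n J w.2))⁻¹) := fun w hw =>
    isCollarPoint_collarCoord hs hx₀r h1 (hW w.2) (hO₁ _ hw).1 (hO₁ _ hw).2.1
  have hXcp : ∀ z ∈ V₁, ∀ u x τ, o.IsCollarPoint x₀ z u x τ → X (rayCoord J z) = x := by
    intro z hz u x τ h
    obtain ⟨c, -, hc⟩ := h.exists_smul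
    exact (hV₁ z hz).1.2 x h.mem_range c hc (fun j => h.norm_eq j.1) h.pairing_eq
  -- The point with collar coordinates `(t, h)` lies in the open stratum for `t > 0` and in the
  -- boundary for `t = 0`.
  have hbdry : ∀ w : ℝ × W, ι w ∈ O₂ → ∀ y ∈ (Γ.blowupCharts n M).dom φ,
      (Γ.blowupCharts n M).chart φ y = o.collarCoord s x₀ (ι w) →
      blowdown y ∈ o.vertexDiagonal M ∧
        (0 < w.1 → blowdown y ∉ Γ.edgeDiagonal M) ∧ (w.1 = 0 → y ∈ o.smoothStratum n M J) := by
    intro w hw y hy hyw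
    rw [hO₂] at hw
    have h2 := hcpw w hw.1
    rw [← hyw] at h2
    have hN := norm₂_pos hJ (hO₁ _ hw.1).1
    have hvd : blowdown y ∈ o.vertexDiagonal M :=
      (mem_vertexDiagonal_iff hy).2 ⟨_, h2.isPosition⟩
    -- the radius of an edge in `J` vanishes precisely if `t = 0`
    have hrad : ∀ j : J, (((Γ.blowupCharts n M).chart φ y).1 j.1).2.2 = 0 ↔ w.1 = 0 := by
      intro j
      have h3 := h2.isPosition.radius_smul j.1
      have h4 : o.coboundary n J (o.collarPos s x₀ (ι w)) j =
        (((Γ.blowupCharts n M).chart φ y).1 j.1).2.2 •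
          (((Γ.blowupCharts n M).chart φ y).1 j.1).2.1 := h3.symm
      have h5 : (((Γ.blowupCharts n M).chart φ y).1 j.1).2.1 ≠ 0 := fun h => by
        have := h2.norm_eq j.1
        rw [h, norm_zero] at this
        exact zero_ne_one this
      rw [← smul_eq_zero_iff_left h5, ← h4, h2.coboundary_eq, Pi.smul_apply,
        smul_eq_zero_iff_left (h2.ne_zero j), mul_eq_zero_iff_right (inv_pos.2 hN).ne']
    refine ⟨hvd, fun ht => ?_, fun ht => ?_⟩
    · rw [← mem_edgeStratum_empty, mem_edgeStratum_iff hy]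
      intro l
      refine ⟨fun h => ?_, fun h => absurd h (Finset.notMem_empty _)⟩
      by_cases hl : l ∈ J
      · exact absurd ((hrad ⟨l, hl⟩).1 h) ht.ne'
      · exact absurd h (h2.pos l hl).ne'
    · have hes : blowdown y ∈ edgeStratum M J := by
        rw [mem_edgeStratum_iff hy]
        intro l
        by_cases hl : l ∈ J
        · exact ⟨fun _ => hl, fun _ => (hrad ⟨l, hl⟩).2 ht⟩
        · exact ⟨fun h => absurd h (h2.pos l hl).ne', fun h => absurd h hl⟩
      have hzV : (Γ.blowupCharts n M).chart φ y ∈ V₂ := by rw [hyw]; exact hw.2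
      rw [hV₂] at hzV
      refine ⟨⟨(mem_conf_iff hφ hy ⟨hvd, hes⟩).2 (subset_closure ⟨norm_direction hφ hy, ?_⟩), hes⟩,
        ((hV₁ _ hzV.1).2.2.2 y hy rfl).1⟩
      obtain ⟨c, hc, hxc⟩ := h2.exists_smul
      obtain ⟨u, hu⟩ := h2.mem_range
      exact ⟨c, mem_rays.2 ⟨u, fun j => (congrFun hu j).trans (hxc j)⟩, hc⟩
  refine ⟨W, hfin, ⟨{
    V := V₂
    O := ι ⁻¹' O₂
    inv := fun z => ρ (o.collarInv s x₀ X z)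
    map := fun w => o.collarCoord s x₀ (ι w)
    isOpen_V := hV₂o
    isOpen_O := hO₂o.preimage hι.continuous
    contDiffAt_inv := fun z hz =>
      ContDiffAt.comp (g := ρ) z hρ.contDiffAt (hinvs z (hV₂ ▸ hz : z ∈ V₁ ∩ _).1)
    contDiffAt_map := fun w hw =>
      ContDiffAt.comp (f := ι) w (hmaps _ (hO₂ ▸ hw : ι w ∈ O₁ ∩ _).1) hι.contDiffAt
    inv_mem := ?_
    map_mem := ?_
    mem_stratum := fun w hw ht y hy hyw => ?_
    mem_smoothStratum := fun w hw ht y hy hyw => (hbdry w hw y hy hyw).2.2 ht }, ?_, ?_⟩⟩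
  · -- points of the smooth part have collar coordinates
    intro y hys hy hyV
    have hyV' : (Γ.blowupCharts n M).chart φ y ∈ V₁ ∩ o.collarInv s x₀ X ⁻¹' O₁ := hV₂ ▸ hyV
    have hVy := hV₁ _ hyV'.1
    have hyr := chart_mem_chartRange (Γ := Γ) hφ hy
    have hconf : y ∈ o.conf n M := by
      rcases hys with h | h
      · exact h.1
      · simp only [boundary1, mem_iUnion] at h
        obtain ⟨I, -, hI⟩ := h
        exact hI.1.1
    have hvd := o.conf_subset n M hconf
    obtain ⟨u, hu⟩ := (mem_vertexDiagonal_iff hy).1 hvd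
    -- A positive solution on the multiray of `y`: in the open stratum the differences of the positions
    -- (`τ = 1`), in the boundary the rigid solution, with vanishing differences (`τ = 0`).
    have hex : ∃ c ∈ o.rays (rayCoord J ((Γ.blowupCharts n M).chart φ y)), (∀ j, 0 < c j) ∧
        (∀ l, l ∉ J → 0 < (((Γ.blowupCharts n M).chart φ y).1 l).2.2) ∧ ∃ τ : ℝ, 0 ≤ τ ∧
          o.coboundary n J u =
            τ • fun j => c j • rayCoord J ((Γ.blowupCharts n M).chart φ y) j := by
      rcases hys with h | h
      · have hr' := (mem_edgeStratum_iff hy).1 h.2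
        have hrp : ∀ l, 0 < (((Γ.blowupCharts n M).chart φ y).1 l).2.2 := fun l =>
          lt_of_le_of_ne (hyr.1 l).2.2.2 fun h => Finset.notMem_empty _ ((hr' l).1 h.symm)
        refine ⟨fun j => (((Γ.blowupCharts n M).chart φ y).1 j.1).2.2,
          mem_rays.2 ⟨u, fun j => (hu.radius_smul j.1).symm⟩, fun j => hrp _, fun l _ => hrp l,
          1, zero_le_one, ?_⟩
        rw [one_smul]
        exact funext fun j => (hu.radius_smul j.1).symm
      · simp only [boundary1, mem_iUnion] at h
        obtain ⟨I, hI, hyI⟩ := h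
        obtain rfl := (hVy.2.2.2 y hy rfl).2 I hI hyI.1
        have hr' := (mem_edgeStratum_iff hy).1 hyI.1.2
        obtain ⟨c, hc, hpos, -⟩ := (mem_smoothStratum_iff hφ hy hI ⟨hvd, hyI.1.2⟩).1 hyI
        refine ⟨c, hc, hpos, fun l hl => lt_of_le_of_ne (hyr.1 l).2.2.2
          fun h => hl ((hr' l).1 h.symm), 0, le_rfl, ?_⟩
        rw [zero_smul]
        refine funext fun j => ?_
        have := hu.radius_smul j.1
        rw [(hr' j.1).2 j.2, zero_smul] at this
        exact this.symm
    obtain ⟨c, hc, hpos, hoff, τ, hτ, hδ⟩ := hex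
    obtain ⟨x, τ', hτ', hcp'⟩ := exists_isCollarPoint hJ hu (fun l => (hyr.1 l).2.2.1) hoff
      hVy.2.2.1 hc hpos hτ hδ
    have hinv := hcp'.collarInv_eq (s := s) (hXcp _ hyV'.1 _ _ _ hcp')
    have hmem : u - τ' • s x + s (x - x₀) ∈ W := by
      change pairing x₀ (o.coboundary n J _) = 0
      rw [hcp'.coboundary_collarInv hs hx₀r, map_sub, hcp'.pairing_eq, h1, sub_self]
    have hιρ : ι (ρ (o.collarInv s x₀ X ((Γ.blowupCharts n M).chart φ y))) =
        o.collarInv s x₀ X ((Γ.blowupCharts n M).chart φ y) := by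
      rw [hinv]
      refine Prod.ext rfl ?_
      exact congrArg Subtype.val (hpr' ⟨_, hmem⟩)
    have hcc : o.collarCoord s x₀ (o.collarInv s x₀ X ((Γ.blowupCharts n M).chart φ y)) =
        (Γ.blowupCharts n M).chart φ y := by
      rw [hinv]
      exact hcp'.collarCoord_eq hJ hs hx₀r
    refine ⟨?_, ?_, ?_⟩
    · rw [mem_preimage, hιρ, hO₂]
      refine ⟨hyV'.2, ?_⟩
      rw [mem_preimage, hcc]
      exact hyV
    · change 0 ≤ (o.collarInv s x₀ X ((Γ.blowupCharts n M).chart φ y)).1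
      rw [hinv]
      exact mul_nonneg (Real.sqrt_nonneg _) hτ'
    · rw [hιρ, hcc]
  · -- collar coordinates with `0 ≤ t` define points
    intro w hw ht
    have hw' : ι w ∈ O₁ ∩ o.collarCoord s x₀ ⁻¹' V₂ := hO₂ ▸ hw
    have hV' : o.collarCoord s x₀ (ι w) ∈ V₁ ∩ o.collarInv s x₀ X ⁻¹' O₁ := hV₂ ▸ hw'.2
    have h2 := hcpw w hw'.1
    have hN := norm₂_pos hJ (hO₁ _ hw'.1).1
    refine ⟨⟨?_, hw'.2⟩, ?_⟩
    · refine coordOf_mem_chartRange h2.isPosition.radius_smul (hO₁ _ hw'.1).2.2 h2.norm_eq ?_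
      intro l
      by_cases hl : l ∈ J
      · rw [dif_pos hl]
        exact mul_nonneg (mul_nonneg ht (inv_pos.2 hN).le) (norm_nonneg _)
      · rw [dif_neg hl]
        exact norm_nonneg _
    · rw [collarInv_collarCoord hJ hs hx₀r h1 (hW w.2) (hO₁ _ hw'.1).1 (hO₁ _ hw'.1).2.1
        (hXcp _ hV'.1 _ _ _ h2)]
      exact Prod.ext rfl (hpr' w.2)
  · rw [stratum_empty]
    have := hbdry w hw y hy hyw
    exact ⟨this.1, this.2.1 ht⟩
  · change z₀ ∈ V₂
    rw [hV₂]
    refine ⟨hV₁m, ?_⟩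
    rw [mem_preimage, hcp.collarInv_eq hXx₀]
    simpa using hO₁m
  · -- the positions of the points with given collar coordinates
    intro t h ht h0 ht0 y hy b hb hyh hbh
    have ht' : ι (t, h) ∈ O₁ ∩ o.collarCoord s x₀ ⁻¹' V₂ := hO₂ ▸ ht
    have h0' : ι (0, h) ∈ O₁ ∩ o.collarCoord s x₀ ⁻¹' V₂ := hO₂ ▸ h0
    have hct := hcpw (t, h) ht'.1
    have hc0 := hcpw (0, h) h0'.1
    replace hyh : (Γ.blowupCharts n M).chart φ y = o.collarCoord s x₀ (ι (0, h)) := hyh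
    replace hbh : (Γ.blowupCharts n M).chart φ b = o.collarCoord s x₀ (ι (t, h)) := hbh
    have hyS : y ∈ o.smoothStratum n M J := (hbdry (0, h) h0 y hy hyh).2.2 rfl
    refine ⟨hy, hb, fun hteq => ?_, fun htpos => ⟨?_, fun p q hp hq => ⟨?_, ?_⟩⟩⟩
    · refine chart_injOn hφ hb hy ?_
      rw [hyh, hbh, hteq]
    · rw [stratum_empty]
      have := hbdry (t, h) ht b hb hbh
      exact ⟨this.1, this.2.1 htpos⟩
    all_goals
      have hpp : φ ∘ p = o.collarPos s x₀ (ι (0, h)) := by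
        rw [← hc0.isPosition.posCoord, ← (isPosition_of_blowdown_eq (φ := φ) hp).posCoord, hyh]
      have hqq : φ ∘ q = o.collarPos s x₀ (ι (t, h)) := by
        rw [← hct.isPosition.posCoord, ← (isPosition_of_blowdown_eq (φ := φ) hq).posCoord, hbh]
    · intro v hv
      refine φ.injOn (mem_source_of_blowdown_eq hq hb v) (mem_source_of_blowdown_eq hp hy v) ?_
      have hsv : s (x₀ + o.coboundary n J h) v = 0 := by
        by_cases hvJ : v ∈ o.vertOf J
        · obtain rfl : v = a := hv.resolve_right fun h => h hvJ
          obtain ⟨u, hu⟩ := hct.mem_range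
          rw [show x₀ + o.coboundary n J h = o.coboundary n J u from hu.symm, hs u v hvJ, sub_self]
        · exact hs0 _ v hvJ
      change (φ ∘ q) v = (φ ∘ p) v
      rw [hpp, hqq]
      simp only [collarPos, Pi.add_apply, Pi.smul_apply, ι, hsv, smul_zero]
    · intro x hx j
      have h3 : φ (q (o.head j.1)) - φ (q (o.tail j.1)) = o.coboundary n J (φ ∘ q) j := rfl
      rw [h3, hqq, coboundary_collarPos hs hx₀r]
      have hrigy := (mem_smoothStratum_iff hφ hy hJ ⟨o.conf_subset n M hyS.1.1, hyS.1.2⟩).1 hyS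
      have hN := norm₂_pos hJ (hO₁ _ h0'.1).1
      have hsol : o.IsSolution φ J y
          ((norm₂ (x₀ + o.coboundary n J h))⁻¹ • (x₀ + o.coboundary n J h)) := by
        obtain ⟨c, hc, hxc⟩ := hc0.exists_smul
        rw [← hyh] at hxc
        have hxc' : (norm₂ (x₀ + o.coboundary n J h))⁻¹ • (x₀ + o.coboundary n J h) =
            fun j => ((norm₂ (x₀ + o.coboundary n J h))⁻¹ * c j) • direction φ J y j := by
          funext j
          rw [Pi.smul_apply, mul_smul]
          exact congrArg _ (hxc j)
        refine isSolution_iff.2 ⟨fun j => (norm₂ (x₀ + o.coboundary n J h))⁻¹ * c j, ?_,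
          fun j => mul_pos (inv_pos.2 hN) (hc j), hxc', ?_, fun j => ?_⟩
        · rw [← smul_mem_cycleSpace_iff, ← hxc', cycleSpace_eq_range]
          exact Submodule.smul_mem _ _ hc0.mem_range
        · have h4 := norm₂_smul (inv_pos.2 hN).le (x₀ + o.coboundary n J h)
          rw [show norm₂ (x₀ + o.coboundary n J (ι (0, h)).2) = norm₂ (x₀ + o.coboundary n J h)
            from rfl] at hN h4
          rw [inv_mul_cancel₀ hN.ne', norm₂, Real.sqrt_eq_one] at h4
          exact h4
        · exact smul_ne_zero (inv_pos.2 hN).ne' (hc0.ne_zero j)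
      rw [hrigy.eq_of_isSolution hx hsol, Pi.smul_apply, Pi.smul_apply, smul_smul]

end EdgeOrientation

end RibbonGraph

/-! ### Charts of the smooth part and of its boundary -/

namespace RibbonGraph

variable {F : Type*} [Finite F] {Γ : RibbonGraph F} {o : Γ.EdgeOrientation} {n : ℕ}
  {M : Type*} [TopologicalSpace M] [ChartedSpace (EuclideanSpace ℝ (Fin n)) M]
  {φ : OpenPartialHomeomorph M (EuclideanSpace ℝ (Fin n))} {J : Finset Γ.Edge}
  {W : Type*} [NormedAddCommGroup W] [NormedSpace ℝ W]

namespace EdgeOrientation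

variable (o n M) in
theorem smoothStratum_subset_boundary1 (hJ : J.Nonempty) :
    o.smoothStratum n M J ⊆ o.boundary1 n M := fun _ h => mem_iUnion₂.2 ⟨J, hJ, h⟩

variable (o n M) in
theorem smoothStratum_subset_smoothPart (hJ : J.Nonempty) :
    o.smoothStratum n M J ⊆ o.smoothPart n M :=
  (o.smoothStratum_subset_boundary1 n M hJ).trans subset_union_right

variable (o n M) in
theorem disjoint_stratum_boundary1 : Disjoint (o.stratum n M ∅) (o.boundary1 n M) := by
  refine Set.disjoint_left.2 fun y h h' => ?_
  obtain ⟨J, hJ, hyJ⟩ := mem_iUnion₂.1 h'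
  exact hJ.ne_empty (eq_of_mem_edgeStratum h.2 hyJ.1.2).symm

end EdgeOrientation

section

variable [IsManifold (𝓡 n) ∞ M] [T2Space M] [NeZero n]

theorem isOpen_dom_inter_preimage (hφ : φ ∈ IsManifold.maximalAtlas (𝓡 n) ∞ M)
    {V : Set (Γ.BlowupCoord n)} (hV : IsOpen V) :
    IsOpen ((Γ.blowupCharts n M).dom φ ∩ (Γ.blowupCharts n M).chart φ ⁻¹' V) :=
  ContinuousOn.isOpen_inter_preimage (fun _ hy =>
    ((isSmooth_blowupCharts Γ n M).continuousAt_chart hφ hy).continuousWithinAt)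
    ((isSmooth_blowupCharts Γ n M).isOpen_dom hφ) hV

end

namespace CollarChart

variable (C : Γ.CollarChart (M := M) o φ J W) {y : Γ.Xtilde n M}

theorem inv_fst_eq_zero (hJ : J.Nonempty) (hyJ : y ∈ o.smoothStratum n M J)
    (hy : y ∈ (Γ.blowupCharts n M).dom φ) (hV : (Γ.blowupCharts n M).chart φ y ∈ C.V) :
    (C.inv ((Γ.blowupCharts n M).chart φ y)).1 = 0 := by
  obtain ⟨h1, h2, h3⟩ := C.inv_mem y (o.smoothStratum_subset_smoothPart n M hJ hyJ) hy hV
  refine (eq_of_le_of_not_lt h2 fun h => ?_).symm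
  exact Set.disjoint_left.1 (o.disjoint_stratum_boundary1 n M) (C.mem_stratum _ h1 h y hy h3.symm)
    (o.smoothStratum_subset_boundary1 n M hJ hyJ)

variable [Nonempty (Γ.Xtilde n M)]

/-- The point with given collar coordinates. -/
noncomputable def point (w : ℝ × W) : Γ.Xtilde n M := pointOf φ (C.map w)

variable {w : ℝ × W}

section

variable (hφ : φ ∈ IsManifold.maximalAtlas (𝓡 n) ∞ M)
include hφ

theorem point_mem_dom (hw : w ∈ C.O) (ht : 0 ≤ w.1) :
    C.point w ∈ (Γ.blowupCharts n M).dom φ :=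
  pointOf_mem hφ (C.map_mem w hw ht).1.1

theorem chart_point (hw : w ∈ C.O) (ht : 0 ≤ w.1) :
    (Γ.blowupCharts n M).chart φ (C.point w) = C.map w :=
  chart_pointOf hφ (C.map_mem w hw ht).1.1

theorem chart_point_mem (hw : w ∈ C.O) (ht : 0 ≤ w.1) :
    (Γ.blowupCharts n M).chart φ (C.point w) ∈ C.V := by
  rw [C.chart_point hφ hw ht]
  exact (C.map_mem w hw ht).1.2

theorem inv_chart_point (hw : w ∈ C.O) (ht : 0 ≤ w.1) :
    C.inv ((Γ.blowupCharts n M).chart φ (C.point w)) = w := by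
  rw [C.chart_point hφ hw ht]
  exact (C.map_mem w hw ht).2

theorem point_mem_smoothStratum (hw : w ∈ C.O) (ht : w.1 = 0) :
    C.point w ∈ o.smoothStratum n M J :=
  C.mem_smoothStratum w hw ht _ (C.point_mem_dom hφ hw ht.ge) (C.chart_point hφ hw ht.ge)

theorem point_mem_smoothPart (hJ : J.Nonempty) (hw : w ∈ C.O) (ht : 0 ≤ w.1) :
    C.point w ∈ o.smoothPart n M := by
  rcases ht.eq_or_lt with h | h
  · exact o.smoothStratum_subset_smoothPart n M hJ (C.point_mem_smoothStratum hφ hw h.symm)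
  · exact Or.inl (C.mem_stratum w hw h _ (C.point_mem_dom hφ hw ht) (C.chart_point hφ hw ht))

theorem point_inv (hyS : y ∈ o.smoothPart n M)
    (hy : y ∈ (Γ.blowupCharts n M).dom φ) (hV : (Γ.blowupCharts n M).chart φ y ∈ C.V) :
    C.point (C.inv ((Γ.blowupCharts n M).chart φ y)) = y := by
  obtain ⟨h1, h2, h3⟩ := C.inv_mem y hyS hy hV
  exact chart_injOn hφ (C.point_mem_dom hφ h1 h2) hy ((C.chart_point hφ h1 h2).trans h3)

variable [IsManifold (𝓡 n) ∞ M] [T2Space M] [NeZero n]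

/-- Collar coordinates are a chart of the smooth part, with the half-space `0 ≤ t` as model. -/
theorem exists_subsetChart (hJ : J.Nonempty) {d : ℕ} [NeZero d]
    (Φ : (ℝ × W) ≃L[ℝ] EuclideanSpace ℝ (Fin d)) (hΦ : ∀ w, Φ w 0 = w.1) :
    ∃ D : (Γ.blowupCharts n M).SubsetChart (𝓡∂ d) (o.smoothPart n M), D.φ = φ ∧
      D.nbhd = (Γ.blowupCharts n M).dom φ ∩ (Γ.blowupCharts n M).chart φ ⁻¹' C.V ∧
      D.coord = fun z => Φ (C.inv z) := by
  have hmem : ∀ w ∈ Φ.symm ⁻¹' C.O ∩ range (𝓡∂ d), 0 ≤ (Φ.symm w).1 := by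
    intro w hw
    have := hw.2
    rw [range_modelWithCornersEuclideanHalfSpace] at this
    rw [← hΦ, Φ.apply_symm_apply]
    exact this
  refine ⟨{
    φ := φ
    nbhd := (Γ.blowupCharts n M).dom φ ∩ (Γ.blowupCharts n M).chart φ ⁻¹' C.V
    image := Φ.symm ⁻¹' C.O
    coord := fun z => Φ (C.inv z)
    param := fun w => C.point (Φ.symm w)
    mem_atlas := hφ
    isOpen_nbhd := isOpen_dom_inter_preimage hφ C.isOpen_V
    isOpen_image := C.isOpen_O.preimage Φ.symm.continuous
    nbhd_subset := inter_subset_left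
    coord_mem := fun y hy hyV => ⟨?_, ?_⟩
    param_coord := fun y hy hyV => ?_
    contDiffAt_coord := fun y hy hyV => Φ.contDiff.contDiffAt.comp _ (C.contDiffAt_inv _ hyV.2)
    param_mem := fun w hw => ⟨C.point_mem_smoothPart hφ hJ hw.1 (hmem w hw),
      C.point_mem_dom hφ hw.1 (hmem w hw), C.chart_point_mem hφ hw.1 (hmem w hw)⟩
    coord_param := fun w hw => ?_
    contDiffWithinAt_param := fun w hw => ?_ }, rfl, rfl, rfl⟩
  · rw [mem_preimage, Φ.symm_apply_apply]
    exact (C.inv_mem y hy hyV.1 hyV.2).1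
  · rw [range_modelWithCornersEuclideanHalfSpace]
    change 0 ≤ Φ _ 0
    rw [hΦ]
    exact (C.inv_mem y hy hyV.1 hyV.2).2.1
  · rw [Φ.symm_apply_apply]
    exact C.point_inv hφ hy hyV.1 hyV.2
  · rw [C.inv_chart_point hφ hw.1 (hmem w hw), Φ.apply_symm_apply]
  · have h1 : ContDiffAt ℝ ∞ (C.map ∘ Φ.symm) w :=
      (C.contDiffAt_map _ hw.1).comp w Φ.symm.contDiff.contDiffAt
    refine h1.contDiffWithinAt.congr_of_eventuallyEq_of_mem ?_ hw.2
    filter_upwards [inter_mem_nhdsWithin (range (𝓡∂ d))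
      ((C.isOpen_O.preimage Φ.symm.continuous).mem_nhds hw.1)] with w' hw'
    exact C.chart_point hφ hw'.2 (hmem w' ⟨hw'.2, hw'.1⟩)

/-- Collar coordinates with `t = 0` are a chart of the boundary stratum. -/
theorem exists_boundary_subsetChart (hJ : J.Nonempty) {d : ℕ}
    (Ψ : W ≃L[ℝ] EuclideanSpace ℝ (Fin d)) :
    ∃ D : (Γ.blowupCharts n M).SubsetChart (𝓡 d) (o.smoothStratum n M J),
      D.nbhd = (Γ.blowupCharts n M).dom φ ∩ (Γ.blowupCharts n M).chart φ ⁻¹' C.V := by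
  have hinv : ∀ y ∈ o.smoothStratum n M J, y ∈ (Γ.blowupCharts n M).dom φ →
      (Γ.blowupCharts n M).chart φ y ∈ C.V → ((0 : ℝ), (C.inv ((Γ.blowupCharts n M).chart φ y)).2) =
        C.inv ((Γ.blowupCharts n M).chart φ y) := fun y hy hd hV =>
    Prod.ext (C.inv_fst_eq_zero hJ hy hd hV).symm rfl
  have hcont : Continuous fun w => ((0 : ℝ), Ψ.symm w) := by fun_prop
  refine ⟨{
    φ := φ
    nbhd := (Γ.blowupCharts n M).dom φ ∩ (Γ.blowupCharts n M).chart φ ⁻¹' C.V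
    image := (fun w => ((0 : ℝ), Ψ.symm w)) ⁻¹' C.O
    coord := fun z => Ψ (C.inv z).2
    param := fun w => C.point (0, Ψ.symm w)
    mem_atlas := hφ
    isOpen_nbhd := isOpen_dom_inter_preimage hφ C.isOpen_V
    isOpen_image := C.isOpen_O.preimage hcont
    nbhd_subset := inter_subset_left
    coord_mem := fun y hy hyV => ⟨?_, by simp⟩
    param_coord := fun y hy hyV => ?_
    contDiffAt_coord := fun y hy hyV => Ψ.contDiff.contDiffAt.comp _
      (contDiffAt_snd.comp _ (C.contDiffAt_inv _ hyV.2))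
    param_mem := fun w hw => ⟨C.point_mem_smoothStratum hφ hw.1 rfl,
      C.point_mem_dom hφ hw.1 le_rfl, C.chart_point_mem hφ hw.1 le_rfl⟩
    coord_param := fun w hw => ?_
    contDiffWithinAt_param := fun w hw => ?_ }, rfl⟩
  · rw [mem_preimage, Ψ.symm_apply_apply, hinv y hy hyV.1 hyV.2]
    exact (C.inv_mem y (o.smoothStratum_subset_smoothPart n M hJ hy) hyV.1 hyV.2).1
  · rw [Ψ.symm_apply_apply, hinv y hy hyV.1 hyV.2]
    exact C.point_inv hφ (o.smoothStratum_subset_smoothPart n M hJ hy) hyV.1 hyV.2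
  · rw [C.inv_chart_point hφ hw.1 le_rfl, Ψ.apply_symm_apply]
  · have h1 : ContDiffAt ℝ ∞ (C.map ∘ fun w => ((0 : ℝ), Ψ.symm w)) w :=
      ContDiffAt.comp (f := fun w => ((0 : ℝ), Ψ.symm w)) w (C.contDiffAt_map _ hw.1)
        (contDiffAt_const.prodMk Ψ.symm.contDiff.contDiffAt)
    refine (h1.congr_of_eventuallyEq ?_).contDiffWithinAt
    filter_upwards [(C.isOpen_O.preimage hcont).mem_nhds hw.1] with w' hw'
    exact C.chart_point hφ hw' le_rfl

end

end CollarChart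

/-! ### The boundary diffeomorphism -/

/-- The point of the half-line with given coordinate. -/
noncomputable def halfLinePoint (t : ℝ) : EuclideanHalfSpace 1 :=
  ⟨EuclideanSpace.single 0 (max t 0), by simp⟩

theorem halfLinePoint_apply {t : ℝ} (ht : 0 ≤ t) : (halfLinePoint t).1 0 = t := by
  simp [halfLinePoint, ht]

theorem halfLinePoint_coord (x : EuclideanHalfSpace 1) : halfLinePoint (x.1 0) = x := by
  refine Subtype.ext ?_
  ext i
  rw [Subsingleton.elim i 0]
  exact halfLinePoint_apply x.2

theorem contMDiffAt_halfLinePoint {V H N : Type*} [NormedAddCommGroup V] [NormedSpace ℝ V]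
    [TopologicalSpace H] [TopologicalSpace N] [ChartedSpace H N] {I : ModelWithCorners ℝ V H}
    {f : N → ℝ} {p : N} (hf : ContMDiffAt I 𝓘(ℝ, ℝ) ∞ f p) (h0 : ∀ᶠ x in 𝓝 p, 0 ≤ f x) :
    ContMDiffAt I (𝓡∂ 1) ∞ (fun x => halfLinePoint (f x)) p := by
  have hc : Continuous halfLinePoint := by
    unfold halfLinePoint
    refine Continuous.subtype_mk (f := fun t => EuclideanSpace.single 0 (max t 0)) ?_ _
    have : Continuous fun t : ℝ => max t 0 := continuous_id.max continuous_const
    exact (PiLp.continuous_toLp 2 _).comp (continuous_pi fun i => by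
      rw [Subsingleton.elim i 0]; simpa using this)
  rw [contMDiffAt_iff_target]
  refine ⟨ContinuousAt.comp (f := f) hc.continuousAt hf.continuousAt, ?_⟩
  let L : ℝ → EuclideanSpace ℝ (Fin 1) := fun t => EuclideanSpace.single 0 t
  have hL : ContDiff ℝ ∞ L := by
    refine contDiff_euclidean.2 fun i => ?_
    rw [Subsingleton.elim i 0]
    simp only [L, PiLp.single_apply, if_true]
    exact contDiff_id
  refine (ContMDiffAt.comp p hL.contMDiff.contMDiffAt hf).congr_of_eventuallyEq ?_
  filter_upwards [h0] with x hx
  change (halfLinePoint (f x)).1 = EuclideanSpace.single 0 (f x)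
  simp [halfLinePoint, hx]

namespace CollarChart

variable [IsManifold (𝓡 n) ∞ M] [T2Space M] [NeZero n]

/-- In collar coordinates, the boundary diffeomorphism is the identity. -/
theorem exists_partialDiffeomorph (C : Γ.CollarChart (M := M) o φ J W) (hJ : J.Nonempty)
    (hφ : φ ∈ IsManifold.maximalAtlas (𝓡 n) ∞ M) {d : ℕ} [NeZero d]
    [ChartedSpace (EuclideanHalfSpace d) (o.smoothPart n M)]
    [ChartedSpace (EuclideanSpace ℝ (Fin (d - 1))) (o.smoothStratum n M J)]
    (hA : (Γ.blowupCharts n M).IsSmoothSubset (𝓡∂ d) (o.smoothPart n M))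
    (hB : (Γ.blowupCharts n M).IsSmoothSubset (𝓡 (d - 1)) (o.smoothStratum n M J))
    (y₀ : o.smoothStratum n M J) (hy₀ : y₀.1 ∈ (Γ.blowupCharts n M).dom φ)
    (hV : (Γ.blowupCharts n M).chart φ y₀ ∈ C.V) :
    ∃ β : PartialDiffeomorph ((𝓡∂ 1).prod (𝓡 (d - 1))) (𝓡∂ d)
        (EuclideanHalfSpace 1 × o.smoothStratum n M J) (o.smoothPart n M) ∞,
      (0, y₀) ∈ β.source ∧ ∀ q ∈ β.source, ∃ h, (q.1.1 0, h) ∈ C.O ∧ (0, h) ∈ C.O ∧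
        q.2.1 ∈ (Γ.blowupCharts n M).dom φ ∧ (β.toFun q).1 ∈ (Γ.blowupCharts n M).dom φ ∧
        (Γ.blowupCharts n M).chart φ q.2.1 = C.map (0, h) ∧
        (Γ.blowupCharts n M).chart φ (β.toFun q).1 = C.map (q.1.1 0, h) := by
  classical
  have : Nonempty (Γ.Xtilde n M) := ⟨y₀⟩
  have hS := isSmooth_blowupCharts Γ n M
  let Ω := (Γ.blowupCharts n M).dom φ ∩ (Γ.blowupCharts n M).chart φ ⁻¹' C.V
  have hΩ : IsOpen Ω := isOpen_dom_inter_preimage hφ C.isOpen_V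
  have hBA := o.smoothStratum_subset_smoothPart n M hJ
  let hh : Γ.Xtilde n M → W := fun y => (C.inv ((Γ.blowupCharts n M).chart φ y)).2
  have hinv : ∀ y ∈ o.smoothStratum n M J, y ∈ Ω →
      ((0 : ℝ), hh y) = C.inv ((Γ.blowupCharts n M).chart φ y) := fun y hy hd =>
    Prod.ext (C.inv_fst_eq_zero hJ hy hd.1 hd.2).symm rfl
  have hinvO : ∀ y ∈ o.smoothStratum n M J, y ∈ Ω → ((0 : ℝ), hh y) ∈ C.O := fun y hy hd => by
    rw [hinv y hy hd]; exact (C.inv_mem y (hBA hy) hd.1 hd.2).1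
  have hpt0 : ∀ y ∈ o.smoothStratum n M J, y ∈ Ω → C.point (0, hh y) = y := fun y hy hd => by
    rw [hinv y hy hd]; exact C.point_inv hφ (hBA hy) hd.1 hd.2
  have hinvs : ∀ y ∈ Ω, ContinuousAt (fun y => C.inv ((Γ.blowupCharts n M).chart φ y)) y :=
    fun y hy => ContinuousAt.comp (g := C.inv) (C.contDiffAt_inv _ hy.2).continuousAt
      (hS.continuousAt_chart hφ hy.1)
  -- the collar coordinates of the image point
  let wf : EuclideanHalfSpace 1 × o.smoothStratum n M J → ℝ × W := fun q => (q.1.1 0, hh q.2)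
  let src : Set (EuclideanHalfSpace 1 × o.smoothStratum n M J) :=
    (fun q => (q.2 : Γ.Xtilde n M)) ⁻¹' Ω ∩ wf ⁻¹' C.O
  let tgt : Set (o.smoothPart n M) :=
    Subtype.val ⁻¹' Ω ∩ (fun b : o.smoothPart n M => ((0 : ℝ), hh b)) ⁻¹' C.O
  -- The fallback values are never used on the source and the target.
  let f : EuclideanHalfSpace 1 × o.smoothStratum n M J → o.smoothPart n M := fun q =>
    if h : C.point (wf q) ∈ o.smoothPart n M then ⟨_, h⟩ else ⟨q.2, hBA q.2.2⟩
  let g : o.smoothPart n M → EuclideanHalfSpace 1 × o.smoothStratum n M J := fun b =>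
    (halfLinePoint (C.inv ((Γ.blowupCharts n M).chart φ b)).1,
      if h : C.point (0, hh b) ∈ o.smoothStratum n M J then ⟨_, h⟩ else y₀)
  have hf : ∀ q ∈ src, (f q : Γ.Xtilde n M) = C.point (wf q) := fun q hq => by
    have : C.point (wf q) ∈ o.smoothPart n M := C.point_mem_smoothPart hφ hJ hq.2 q.1.2
    simp only [f, dif_pos this]
  have hg : ∀ b ∈ tgt, ((g b).2 : Γ.Xtilde n M) = C.point (0, hh b) := fun b hb => by
    have : C.point (0, hh b) ∈ o.smoothStratum n M J := C.point_mem_smoothStratum hφ hb.2 rfl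
    simp only [g, dif_pos this]
  have hg0 : ∀ b ∈ tgt, 0 ≤ (C.inv ((Γ.blowupCharts n M).chart φ b)).1 := fun b hb =>
    (C.inv_mem b b.2 hb.1.1 hb.1.2).2.1
  have hfΩ : ∀ q ∈ src, (f q : Γ.Xtilde n M) ∈ Ω := fun q hq => by
    rw [hf q hq]
    exact ⟨C.point_mem_dom hφ hq.2 q.1.2, C.chart_point_mem hφ hq.2 q.1.2⟩
  have hgΩ : ∀ b ∈ tgt, ((g b).2 : Γ.Xtilde n M) ∈ Ω := fun b hb => by
    rw [hg b hb]
    exact ⟨C.point_mem_dom hφ hb.2 le_rfl, C.chart_point_mem hφ hb.2 le_rfl⟩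
  have hfinv : ∀ q ∈ src, C.inv ((Γ.blowupCharts n M).chart φ (f q)) = wf q := fun q hq => by
    rw [hf q hq]
    exact C.inv_chart_point hφ hq.2 q.1.2
  have hginv : ∀ b ∈ tgt, C.inv ((Γ.blowupCharts n M).chart φ (g b).2) = (0, hh b) :=
    fun b hb => by
      rw [hg b hb]
      exact C.inv_chart_point hφ hb.2 le_rfl
  have hcoord0 : Continuous fun x : EuclideanHalfSpace 1 => x.1 0 :=
    (EuclideanSpace.proj (𝕜 := ℝ) (0 : Fin 1)).continuous.comp continuous_subtype_val
  have hsrc : IsOpen src := by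
    refine ContinuousOn.isOpen_inter_preimage (fun q hq => ?_)
      (hΩ.preimage (continuous_subtype_val.comp continuous_snd)) C.isOpen_O
    have h2 : ContinuousAt (fun q : EuclideanHalfSpace 1 × o.smoothStratum n M J =>
        C.inv ((Γ.blowupCharts n M).chart φ q.2)) q :=
      ContinuousAt.comp (f := fun q : EuclideanHalfSpace 1 × o.smoothStratum n M J =>
        (q.2 : Γ.Xtilde n M)) (hinvs _ hq)
        (continuous_subtype_val.comp continuous_snd).continuousAt
    exact ((hcoord0.comp continuous_fst).continuousAt.prodMk
      (continuous_snd.continuousAt.comp h2)).continuousWithinAt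
  have htgt : IsOpen tgt := by
    refine ContinuousOn.isOpen_inter_preimage (fun b hb => ?_)
      (hΩ.preimage continuous_subtype_val) C.isOpen_O
    have h2 : ContinuousAt (fun b : o.smoothPart n M =>
        C.inv ((Γ.blowupCharts n M).chart φ b)) b :=
      ContinuousAt.comp (f := fun b : o.smoothPart n M => (b : Γ.Xtilde n M)) (hinvs _ hb)
        continuous_subtype_val.continuousAt
    exact (continuousAt_const.prodMk (continuous_snd.continuousAt.comp h2)).continuousWithinAt
  refine ⟨{
    toFun := f
    invFun := g
    source := src
    target := tgt
    map_source' := fun q hq => ⟨hfΩ q hq, ?_⟩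
    map_target' := fun b hb => ⟨hgΩ b hb, ?_⟩
    left_inv' := fun q hq => ?_
    right_inv' := fun b hb => ?_
    open_source := hsrc
    open_target := htgt
    contMDiffOn_toFun := fun q hq => ContMDiffAt.contMDiffWithinAt ?_
    contMDiffOn_invFun := fun b hb => ContMDiffAt.contMDiffWithinAt ?_ }, ⟨⟨hy₀, hV⟩, ?_⟩,
    fun q hq => ⟨hh q.2, hq.2, hinvO q.2 q.2.2 hq.1, hq.1.1, (hfΩ q hq).1, ?_, ?_⟩⟩
  · change ((0 : ℝ), (C.inv ((Γ.blowupCharts n M).chart φ (f q))).2) ∈ C.O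
    rw [hfinv q hq]
    exact hinvO q.2 q.2.2 hq.1
  · change ((g b).1.1 0, (C.inv ((Γ.blowupCharts n M).chart φ (g b).2)).2) ∈ C.O
    rw [hginv b hb, show (g b).1.1 0 = (C.inv ((Γ.blowupCharts n M).chart φ b)).1 from
      halfLinePoint_apply (hg0 b hb)]
    exact (C.inv_mem b b.2 hb.1.1 hb.1.2).1
  · have hft : f q ∈ tgt := by
      refine ⟨hfΩ q hq, ?_⟩
      change ((0 : ℝ), (C.inv ((Γ.blowupCharts n M).chart φ (f q))).2) ∈ C.O
      rw [hfinv q hq]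
      exact hinvO q.2 q.2.2 hq.1
    refine Prod.ext ?_ (Subtype.ext ?_)
    · change halfLinePoint (C.inv ((Γ.blowupCharts n M).chart φ (f q))).1 = q.1
      rw [hfinv q hq]
      exact halfLinePoint_coord q.1
    · rw [hg _ hft]
      change C.point (0, (C.inv ((Γ.blowupCharts n M).chart φ (f q))).2) = q.2
      rw [hfinv q hq]
      exact hpt0 q.2 q.2.2 hq.1
  · have hwf : wf (g b) = C.inv ((Γ.blowupCharts n M).chart φ b) := by
      refine Prod.ext (halfLinePoint_apply (hg0 b hb)) ?_
      change (C.inv ((Γ.blowupCharts n M).chart φ (g b).2)).2 = _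
      rw [hginv b hb]
    have hgs : g b ∈ src := by
      refine ⟨hgΩ b hb, ?_⟩
      rw [mem_preimage, hwf]
      exact (C.inv_mem b b.2 hb.1.1 hb.1.2).1
    refine Subtype.ext ?_
    rw [hf _ hgs, hwf]
    exact C.point_inv hφ b.2 hb.1.1 hb.1.2
  · -- smoothness of the map
    have hev := hsrc.mem_nhds hq
    refine hA.contMDiffAt_of_chart hS hφ ?_ ?_
    · filter_upwards [hev] with x hx using (hfΩ x hx).1
    · have h1 : ContMDiffAt ((𝓡∂ 1).prod (𝓡 (d - 1))) 𝓘(ℝ, ℝ) ∞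
          (fun q : EuclideanHalfSpace 1 × o.smoothStratum n M J => q.1.1 0) q := by
        have h3 : ContMDiff (𝓡∂ 1) 𝓘(ℝ, EuclideanSpace ℝ (Fin 1)) ∞
          (𝓡∂ 1 : EuclideanHalfSpace 1 → EuclideanSpace ℝ (Fin 1)) := (𝓡∂ 1).contMDiff
        exact ((EuclideanSpace.proj (𝕜 := ℝ) (0 : Fin 1)).contMDiff.comp
          (h3.comp contMDiff_fst)).contMDiffAt
      have h2 : ContMDiffAt ((𝓡∂ 1).prod (𝓡 (d - 1))) 𝓘(ℝ, W) ∞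
          (fun q : EuclideanHalfSpace 1 × o.smoothStratum n M J => hh q.2) q := by
        have h3 : ContMDiffAt (𝓡 (d - 1)) 𝓘(ℝ, W) ∞
            (fun y : o.smoothStratum n M J => hh y) q.2 :=
          ContMDiffAt.comp (g := fun z => (C.inv z).2)
            (f := fun y : o.smoothStratum n M J => (Γ.blowupCharts n M).chart φ y) q.2
            (contDiffAt_snd.comp _ (C.contDiffAt_inv _ hq.1.2)).contMDiffAt
            (hB.contMDiffAt_chart hS hφ hq.1.1)
        exact h3.comp q contMDiffAt_snd
      have h4 : ContMDiffAt ((𝓡∂ 1).prod (𝓡 (d - 1))) 𝓘(ℝ, Γ.BlowupCoord n) ∞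
          (fun q => C.map (wf q)) q :=
        ContMDiffAt.comp (g := C.map) (f := wf) q (C.contDiffAt_map _ hq.2).contMDiffAt
          (h1.prodMk_space h2)
      refine h4.congr_of_eventuallyEq ?_
      filter_upwards [hev] with x hx
      rw [hf x hx]
      exact C.chart_point hφ hx.2 x.1.2
  · -- smoothness of the inverse map
    have hev := htgt.mem_nhds hb
    have h1 : ContMDiffAt (𝓡∂ d) 𝓘(ℝ, ℝ × W) ∞
        (fun b : o.smoothPart n M => C.inv ((Γ.blowupCharts n M).chart φ b)) b :=
      ContMDiffAt.comp (g := C.inv)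
        (f := fun b : o.smoothPart n M => (Γ.blowupCharts n M).chart φ b) b
        (C.contDiffAt_inv _ hb.1.2).contMDiffAt (hA.contMDiffAt_chart hS hφ hb.1.1)
    refine ContMDiffAt.prodMk (contMDiffAt_halfLinePoint
      (ContMDiffAt.comp (g := Prod.fst) b contDiffAt_fst.contMDiffAt h1) ?_) ?_
    · filter_upwards [hev] with x hx using hg0 x hx
    · refine hB.contMDiffAt_of_chart hS hφ (g := fun b => (g b).2) ?_ ?_
      · filter_upwards [hev] with x hx using (hgΩ x hx).1
      · have h2 : ContDiffAt ℝ ∞ (fun w : ℝ × W => C.map (0, w.2))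
            (C.inv ((Γ.blowupCharts n M).chart φ b)) :=
          ContDiffAt.comp (g := C.map) (f := fun w : ℝ × W => ((0 : ℝ), w.2)) _
            (C.contDiffAt_map _ hb.2) (contDiffAt_const.prodMk contDiffAt_snd)
        refine (ContMDiffAt.comp (g := fun w : ℝ × W => C.map (0, w.2)) b h2.contMDiffAt
          h1).congr_of_eventuallyEq ?_
        filter_upwards [hev] with x hx
        rw [hg x hx]
        exact C.chart_point hφ hx.2 le_rfl
  · change ((0 : ℝ), hh y₀) ∈ C.O
    exact hinvO y₀ y₀.2 ⟨hy₀, hV⟩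
  · rw [hinv q.2 q.2.2 hq.1]
    exact (C.inv_mem q.2 (hBA q.2.2) hq.1.1 hq.1.2).2.2.symm
  · change (Γ.blowupCharts n M).chart φ (f q) = _
    rw [hf q hq]
    exact C.chart_point hφ hq.2 q.1.2

end CollarChart

end RibbonGraph

/-! ### The smooth structures -/

theorem nonempty_continuousLinearEquiv_euclideanSpace {W : Type*} [NormedAddCommGroup W]
    [NormedSpace ℝ W] [FiniteDimensional ℝ W] {d : ℕ} (h : Module.finrank ℝ W = d) :
    Nonempty (W ≃L[ℝ] EuclideanSpace ℝ (Fin d)) :=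
  ⟨ContinuousLinearEquiv.ofFinrankEq (by rw [h, finrank_euclideanSpace, Fintype.card_fin])⟩

namespace RibbonGraph

variable {F : Type*} [Finite F] {Γ : RibbonGraph F} {o : Γ.EdgeOrientation} {n : ℕ}
  {M : Type*} [TopologicalSpace M] [ChartedSpace (EuclideanSpace ℝ (Fin n)) M]
  {φ : OpenPartialHomeomorph M (EuclideanSpace ℝ (Fin n))} {J : Finset Γ.Edge}

namespace EdgeOrientation

variable (o) in
/-- The coordinates of a configuration with positions `u` for which the end points of every edge
outside `J` are distinct, with given multiray `θ` at the edges in `J`. -/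
noncomputable def polarCoord (θ : J → Euc n) (u : Γ.Vert → Euc n) : Γ.BlowupCoord n :=
  open Classical in
  o.coordOf u (fun l => if hl : l ∈ J then θ ⟨l, hl⟩
      else ‖u (o.head l) - u (o.tail l)‖⁻¹ • (u (o.head l) - u (o.tail l)))
    (fun l => if l ∈ J then 0 else ‖u (o.head l) - u (o.tail l)‖)

variable {u : Γ.Vert → Euc n} {θ : J → Euc n}

theorem polarCoord_radius_smul (hu : o.coboundary n J u = 0)
    (hne : ∀ l, l ∉ J → u (o.head l) - u (o.tail l) ≠ 0) (l : Γ.Edge) :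
    ((o.polarCoord θ u).1 l).2.2 • ((o.polarCoord θ u).1 l).2.1 =
      u (o.head l) - u (o.tail l) := by
  classical
  simp only [polarCoord, coordOf]
  by_cases hl : l ∈ J
  · rw [if_pos hl, zero_smul]
    exact (congrFun hu ⟨l, hl⟩).symm
  · rw [if_neg hl, dif_neg hl, smul_smul, mul_inv_cancel₀ (norm_ne_zero_iff.2 (hne l hl)),
      one_smul]

theorem isPosition_polarCoord (hu : o.coboundary n J u = 0)
    (hne : ∀ l, l ∉ J → u (o.head l) - u (o.tail l) ≠ 0) :
    o.IsPosition (o.polarCoord θ u) u :=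
  isPosition_coordOf (polarCoord_radius_smul hu hne)

theorem polarCoord_mem_chartRange {N : Type*} [TopologicalSpace N]
    {φ : OpenPartialHomeomorph N (Euc n)} (hu : o.coboundary n J u = 0)
    (hne : ∀ l, l ∉ J → u (o.head l) - u (o.tail l) ≠ 0) (hθ : ∀ j, ‖θ j‖ = 1)
    (ht : ∀ v, u v ∈ φ.target) : o.polarCoord θ u ∈ Γ.chartRange φ := by
  classical
  refine coordOf_mem_chartRange (polarCoord_radius_smul (θ := θ) hu hne) ht (fun l => ?_) fun l => ?_
  · by_cases hl : l ∈ J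
    · rw [dif_pos hl]; exact hθ _
    · rw [dif_neg hl]; exact norm_smul_inv_norm (hne l hl)
  · by_cases hl : l ∈ J
    · rw [if_pos hl]
    · rw [if_neg hl]; exact norm_nonneg _

theorem polarCoord_radius_eq_zero_iff (hne : ∀ l, l ∉ J → u (o.head l) - u (o.tail l) ≠ 0)
    (l : Γ.Edge) : ((o.polarCoord θ u).1 l).2.2 = 0 ↔ l ∈ J := by
  classical
  simp only [polarCoord, coordOf]
  by_cases hl : l ∈ J
  · simp [hl]
  · simpa [hl] using hne l hl

theorem contDiffAt_uncurry_polarCoord (hne : ∀ l, l ∉ J → u (o.head l) - u (o.tail l) ≠ 0) :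
    ContDiffAt ℝ ∞ (fun p : (J → Euc n) × (Γ.Vert → Euc n) => o.polarCoord p.1 p.2) (θ, u) := by
  classical
  have hp : ∀ v, ContDiffAt ℝ ∞ (fun p : (J → Euc n) × (Γ.Vert → Euc n) => p.2 v) (θ, u) :=
    fun v => by fun_prop
  unfold polarCoord coordOf
  refine ContDiffAt.prodMk (contDiffAt_pi.2 fun l => (hp _).prodMk ?_)
    (contDiffAt_pi.2 fun i => hp _)
  by_cases hl : l ∈ J
  · simp only [dif_pos hl, if_pos hl]
    fun_prop
  · simp only [dif_neg hl, if_neg hl]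
    have hd := (hp (o.head l)).sub (hp (o.tail l))
    have hn := hd.norm ℝ (hne l hl)
    exact ((hn.inv (norm_ne_zero_iff.2 (hne l hl))).smul hd).prodMk hn

theorem contDiffAt_polarCoord (hne : ∀ l, l ∉ J → u (o.head l) - u (o.tail l) ≠ 0) :
    ContDiffAt ℝ ∞ (o.polarCoord θ) u :=
  ContDiffAt.comp (g := fun p : (J → Euc n) × (Γ.Vert → Euc n) => o.polarCoord p.1 p.2)
    (f := fun u => (θ, u)) u (contDiffAt_uncurry_polarCoord hne) (by fun_prop)

theorem IsPosition.eq_polarCoord {N : Type*} [TopologicalSpace N]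
    {φ : OpenPartialHomeomorph N (Euc n)} {z : Γ.BlowupCoord n} (h : o.IsPosition z u)
    (hz : z ∈ Γ.chartRange φ) (hr : ∀ l, (z.1 l).2.2 = 0 ↔ l ∈ J) :
    o.polarCoord (rayCoord J z) u = z := by
  classical
  refine Prod.ext (funext fun l => Prod.ext (h.1 l).1.symm ?_) (funext fun i => (h.2 i).symm)
  by_cases hl : l ∈ J
  · simp only [polarCoord, coordOf, dif_pos hl, if_pos hl]
    exact Prod.ext rfl ((hr l).2 hl).symm
  · simp only [polarCoord, coordOf, dif_neg hl, if_neg hl]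
    have h3 := eq_direction_of_smul (lt_of_le_of_ne (hz.1 l).2.2.2 fun h => hl ((hr l).1 h.symm))
      (hz.1 l).2.2.1 (h.radius_smul l)
    exact Prod.ext h3.2.symm h3.1.symm

theorem IsPosition.coboundary_eq_zero {z : Γ.BlowupCoord n} (h : o.IsPosition z u)
    (hr : ∀ l, (z.1 l).2.2 = 0 ↔ l ∈ J) : o.coboundary n J u = 0 := funext fun j => by
  have := h.radius_smul j.1
  rw [(hr j.1).2 j.2, zero_smul] at this
  exact this.symm

theorem IsPosition.sub_ne_zero {N : Type*} [TopologicalSpace N]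
    {φ : OpenPartialHomeomorph N (Euc n)} {z : Γ.BlowupCoord n} (h : o.IsPosition z u)
    (hz : z ∈ Γ.chartRange φ) (hr : ∀ l, (z.1 l).2.2 = 0 ↔ l ∈ J) {l : Γ.Edge} (hl : l ∉ J) :
    u (o.head l) - u (o.tail l) ≠ 0 := by
  rw [← h.radius_smul l]
  refine smul_ne_zero (fun h => hl ((hr l).1 h)) fun h => ?_
  have := (hz.1 l).2.2.1
  rw [h, norm_zero] at this
  exact zero_ne_one this

variable (n M) in
theorem isOpen_noncollapsed [T2Space M] :
    IsOpen {y : Γ.Xtilde n M | blowdown y ∈ edgeStratum M ∅} := by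
  have : {y : Γ.Xtilde n M | blowdown y ∈ edgeStratum M ∅} =
      ⋂ l : Γ.Edge, {y | ((blowdown y).1 l).1 = ((blowdown y).1 l).2}ᶜ := by
    ext y
    simp [edgeStratum]
  rw [this]
  exact isOpen_iInter_of_finite fun l => (isClosed_collapsed l).isOpen_compl

theorem finrank_positions : Module.finrank ℝ (Γ.Vert → Euc n) = Γ.confDim n := by
  rw [Module.finrank_pi_fintype]
  simp [confDim, mul_comm]

variable [IsManifold (𝓡 n) ∞ M] [T2Space M] [NeZero n] [CompactSpace M]

/-- The positions of the vertices are coordinates on the open stratum. They are translated so that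
the given point has the given image `v₀`. -/
theorem exists_subsetChart_stratum_empty {V H : Type*} [NormedAddCommGroup V] [NormedSpace ℝ V]
    [TopologicalSpace H] {I : ModelWithCorners ℝ V H} {y₀ : Γ.Xtilde n M}
    (hy₀ : y₀ ∈ o.stratum n M ∅) (Ξ : (Γ.Vert → Euc n) ≃L[ℝ] V) {v₀ : V} {O : Set V}
    (hO : IsOpen O) (hOI : O ⊆ range I) (hv₀ : v₀ ∈ O) :
    ∃ D : (Γ.blowupCharts n M).SubsetChart I (o.stratum n M ∅), y₀ ∈ D.nbhd ∧
      D.coord ((Γ.blowupCharts n M).chart D.φ y₀) = v₀ := by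
  classical
  have : Nonempty (Γ.Xtilde n M) := ⟨y₀⟩
  have hS := isSmooth_blowupCharts Γ n M
  obtain ⟨φ, hφ, hd⟩ := hS.exists_chart y₀
  obtain ⟨u₀, hu₀⟩ := (mem_vertexDiagonal_iff hd).1 (o.conf_subset n M hy₀.1)
  let co : Γ.BlowupCoord n → V := fun z => Ξ (o.posCoord z - u₀) + v₀
  have hco : ContDiff ℝ ∞ co :=
    (Ξ.contDiff.comp ((contDiff_posCoord o n).sub contDiff_const)).add contDiff_const
  let po : V → (Γ.Vert → Euc n) := fun w => Ξ.symm (w - v₀) + u₀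
  have hpo : ContDiff ℝ ∞ po :=
    (Ξ.symm.contDiff.comp (contDiff_id.sub contDiff_const)).add contDiff_const
  have hpoco : ∀ z, po (co z) = o.posCoord z := fun z => by simp [po, co]
  have hcopo : ∀ z w, o.posCoord z = po w → co z = w := fun z w h => by simp [co, h, po]
  -- no edge is collapsed, so that the multiray is empty
  let θ : (∅ : Finset Γ.Edge) → Euc n := fun j => absurd j.2 (Finset.notMem_empty _)
  have hθ : ∀ θ' : (∅ : Finset Γ.Edge) → Euc n, θ' = θ := fun θ' =>
    funext fun j => absurd j.2 (Finset.notMem_empty _)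
  have hθn : ∀ j, ‖θ j‖ = 1 := fun j => absurd j.2 (Finset.notMem_empty _)
  have hδ : ∀ u, o.coboundary n (∅ : Finset Γ.Edge) u = 0 := fun u =>
    funext fun j => absurd j.2 (Finset.notMem_empty _)
  let G : Set (Γ.Vert → Euc n) := {u | (∀ v, u v ∈ φ.target) ∧
    ∀ l, l ∉ (∅ : Finset Γ.Edge) → u (o.head l) - u (o.tail l) ≠ 0}
  have hG : IsOpen G := by
    refine IsOpen.inter ?_ ?_
    · have : {u : Γ.Vert → Euc n | ∀ v, u v ∈ φ.target} = ⋂ v, (fun u => u v) ⁻¹' φ.target := by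
        ext; simp
      change IsOpen {u : Γ.Vert → Euc n | ∀ v, u v ∈ φ.target}
      rw [this]
      exact isOpen_iInter_of_finite fun v => φ.open_target.preimage (continuous_apply v)
    · have : {u : Γ.Vert → Euc n | ∀ l, l ∉ (∅ : Finset Γ.Edge) → u (o.head l) - u (o.tail l) ≠ 0} =
          ⋂ l, {u | u (o.head l) - u (o.tail l) ≠ 0} := by
        ext; simp
      change IsOpen {u : Γ.Vert → Euc n | ∀ l, l ∉ (∅ : Finset Γ.Edge) →
        u (o.head l) - u (o.tail l) ≠ 0}
      rw [this]
      exact isOpen_iInter_of_finite fun l => isOpen_ne_fun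
        (by fun_prop) continuous_const
  have hpt : ∀ u ∈ G, ∃ y ∈ (Γ.blowupCharts n M).dom φ, y ∈ o.stratum n M ∅ ∧
      pointOf φ (o.polarCoord θ u) = y ∧ (Γ.blowupCharts n M).chart φ y = o.polarCoord θ u := by
    intro u hu
    have hr := polarCoord_mem_chartRange (φ := φ) (hδ u) hu.2 hθn hu.1
    have hmem := pointOf_mem (M := M) hφ hr
    have hch := chart_pointOf (M := M) hφ hr
    refine ⟨_, hmem, ?_, rfl, hch⟩
    rw [stratum_empty]
    refine ⟨(mem_vertexDiagonal_iff hmem).2 ⟨u, ?_⟩, mem_edgeStratum_empty.1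
      ((mem_edgeStratum_iff hmem).2 ?_)⟩
    · rw [hch]; exact isPosition_polarCoord (hδ u) hu.2
    · rw [hch]; exact polarCoord_radius_eq_zero_iff hu.2
  have hyp : ∀ y ∈ o.stratum n M ∅, y ∈ (Γ.blowupCharts n M).dom φ →
      o.posCoord ((Γ.blowupCharts n M).chart φ y) ∈ G ∧
      o.polarCoord θ (o.posCoord ((Γ.blowupCharts n M).chart φ y)) =
        (Γ.blowupCharts n M).chart φ y := by
    intro y hy hyd
    obtain ⟨u, hu⟩ := (mem_vertexDiagonal_iff hyd).1 (o.conf_subset n M hy.1)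
    have hr := (mem_edgeStratum_iff hyd).1 hy.2
    have hz := chart_mem_chartRange (Γ := Γ) hφ hyd
    rw [hu.posCoord]
    refine ⟨⟨hu.mem_target hz, fun l hl => hu.sub_ne_zero hz hr hl⟩, ?_⟩
    rw [← hθ (rayCoord ∅ ((Γ.blowupCharts n M).chart φ y))]
    exact hu.eq_polarCoord hz hr
  have hcop : ∀ u ∈ G, o.posCoord (o.polarCoord θ u) = u := fun u hu =>
    (isPosition_polarCoord (hδ u) hu.2).posCoord
  have hco₀ : co ((Γ.blowupCharts n M).chart φ y₀) = v₀ := by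
    change Ξ (o.posCoord _ - u₀) + v₀ = v₀
    rw [hu₀.posCoord, sub_self, map_zero, zero_add]
  have himage : IsOpen (O ∩ po ⁻¹' G) := hO.inter (hG.preimage hpo.continuous)
  refine ⟨{
    φ := φ
    nbhd := (Γ.blowupCharts n M).dom φ ∩ (Γ.blowupCharts n M).chart φ ⁻¹' (co ⁻¹' O)
    image := O ∩ po ⁻¹' G
    coord := co
    param := fun w => pointOf φ (o.polarCoord θ (po w))
    mem_atlas := hφ
    isOpen_nbhd := isOpen_dom_inter_preimage hφ (hO.preimage hco.continuous)
    isOpen_image := himage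
    nbhd_subset := inter_subset_left
    coord_mem := fun y hy hyV => ⟨⟨hyV.2, ?_⟩, hOI hyV.2⟩
    param_coord := fun y hy hyV => ?_
    contDiffAt_coord := fun y hy hyV => hco.contDiffAt
    param_mem := fun w hw => ?_
    coord_param := fun w hw => ?_
    contDiffWithinAt_param := fun w hw => ?_ }, ⟨hd, ?_⟩, hco₀⟩
  · rw [mem_preimage, hpoco]
    exact (hyp y hy hyV.1).1
  · rw [hpoco, (hyp y hy hyV.1).2, pointOf_chart hφ hyV.1]
  · obtain ⟨y, hy, hyS, hyp, hyc⟩ := hpt (po w) hw.1.2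
    rw [hyp]
    refine ⟨hyS, hy, ?_⟩
    rw [mem_preimage, mem_preimage, hyc, hcopo _ w (hcop _ hw.1.2)]
    exact hw.1.1
  · obtain ⟨y, hy, hyS, hyp, hyc⟩ := hpt (po w) hw.1.2
    rw [hyp, hyc]
    exact hcopo _ w (hcop _ hw.1.2)
  · have h1 : ContDiffAt ℝ ∞ (o.polarCoord θ ∘ po) w :=
      (contDiffAt_polarCoord hw.1.2.2).comp w hpo.contDiffAt
    refine (h1.congr_of_eventuallyEq ?_).contDiffWithinAt
    filter_upwards [himage.mem_nhds hw.1] with w' hw'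
    obtain ⟨y, hy, hyS, hyp, hyc⟩ := hpt (po w') hw'.2
    change (Γ.blowupCharts n M).chart φ (pointOf φ (o.polarCoord θ (po w'))) = _
    rw [hyp, hyc]
    rfl
  · rw [mem_preimage, mem_preimage, hco₀]
    exact hv₀

variable (o n M) in
theorem isSubmanifold_stratum_empty :
    (Γ.blowupCharts n M).IsSubmanifold (o.stratum n M ∅) (Γ.confDim n) := by
  refine (isSmooth_blowupCharts Γ n M).isSubmanifold fun y hy => ?_
  obtain ⟨D, hD, -⟩ := exists_subsetChart_stratum_empty (I := 𝓡 (Γ.confDim n)) hy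
    (nonempty_continuousLinearEquiv_euclideanSpace finrank_positions).some
    (v₀ := 0) isOpen_univ (by simp) (mem_univ _)
  exact ⟨D, hD⟩

/-- Charts of the smooth part. The first coordinate is positive at the points of the open stratum
and zero at the boundary points. -/
theorem exists_subsetChart_smoothPart {y : Γ.Xtilde n M} (hy : y ∈ o.smoothPart n M) :
    ∃ D : (Γ.blowupCharts n M).SubsetChart (𝓡∂ (Γ.confDim n)) (o.smoothPart n M), y ∈ D.nbhd ∧
      (0 < D.coord ((Γ.blowupCharts n M).chart D.φ y) 0 ↔ y ∈ o.stratum n M ∅) := by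
  have hS := isSmooth_blowupCharts Γ n M
  rcases hy with hy | hy
  · obtain ⟨D, hD, hD0⟩ := exists_subsetChart_stratum_empty (I := 𝓡∂ (Γ.confDim n)) hy
      (nonempty_continuousLinearEquiv_euclideanSpace finrank_positions).some
      (v₀ := EuclideanSpace.single 0 1) (O := {w | 0 < w 0})
      (isOpen_lt continuous_const (EuclideanSpace.proj (𝕜 := ℝ) (0 : Fin _)).continuous)
      (by
        rw [range_modelWithCornersEuclideanHalfSpace]
        exact fun w (hw : 0 < w 0) => hw.le) (by simp)
    -- the open stratum is open in the smooth part
    obtain ⟨D', hn, hφ, hc⟩ := ChartSystem.SubsetChart.exists_of_inter_eq hS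
      (A' := o.smoothPart n M) D (isOpen_noncollapsed n M) (by
        refine Set.ext fun y => ⟨fun h => ⟨Or.inl h.1, h.2⟩, fun h => ⟨?_, h.2⟩⟩
        rcases h.1 with h1 | h1
        · exact h1
        · obtain ⟨J, hJ, hyJ⟩ := mem_iUnion₂.1 h1
          exact absurd (eq_of_mem_edgeStratum h.2 hyJ.1.2).symm hJ.ne_empty)
    refine ⟨D', hn ▸ ⟨hD, hy.2⟩, iff_of_true ?_ hy⟩
    rw [hφ, hc, hD0]
    simp
  · obtain ⟨J, hJ, hyJ⟩ := mem_iUnion₂.1 hy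
    have : Nonempty (Γ.Xtilde n M) := ⟨y⟩
    obtain ⟨φ, hφ, hd⟩ := hS.exists_chart y
    obtain ⟨j, hj⟩ := id hJ
    obtain ⟨W, hW, C, hCV, -⟩ := exists_collarChart hφ hJ hyJ hd (tail_mem_vertOf hj)
    obtain ⟨Φ, hΦ⟩ := exists_continuousLinearEquiv_euclideanSpace W (Γ.confDim n) hW
    obtain ⟨D, hDφ, hDn, hDc⟩ := C.exists_subsetChart hφ hJ Φ hΦ
    refine ⟨D, hDn ▸ ⟨hd, hCV⟩, iff_of_false ?_
      (Set.disjoint_right.1 (o.disjoint_stratum_boundary1 n M) hy)⟩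
    rw [hDc, hDφ]
    dsimp only
    rw [hΦ, C.inv_fst_eq_zero hJ hyJ hd hCV]
    exact lt_irrefl _

variable (o n M) in
theorem exists_chartedSpace_smoothPart :
    ∃ _ : ChartedSpace (EuclideanHalfSpace (Γ.confDim n)) (o.smoothPart n M),
      (Γ.blowupCharts n M).IsSmoothSubset (𝓡∂ (Γ.confDim n)) (o.smoothPart n M) ∧
      (𝓡∂ (Γ.confDim n)).interior (o.smoothPart n M) = Subtype.val ⁻¹' o.stratum n M ∅ ∧
      (𝓡∂ (Γ.confDim n)).boundary (o.smoothPart n M) = Subtype.val ⁻¹' o.boundary1 n M := by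
  have hS := isSmooth_blowupCharts Γ n M
  choose D hD hD0 using fun y : o.smoothPart n M => exists_subsetChart_smoothPart y.2
  let := ChartSystem.SubsetChart.chartedSpace hS D hD
  have hint : (𝓡∂ (Γ.confDim n)).interior (o.smoothPart n M) =
      Subtype.val ⁻¹' o.stratum n M ∅ := by
    ext y
    refine Iff.trans ?_ (hD0 y)
    change extChartAt _ y y ∈ interior (range _) ↔ _
    rw [ChartSystem.SubsetChart.extChartAt_self hS D hD y,
      interior_range_modelWithCornersEuclideanHalfSpace]
    rfl
  refine ⟨this, ChartSystem.SubsetChart.isSmoothSubset hS D hD, hint, ?_⟩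
  rw [← ModelWithCorners.compl_interior, hint]
  ext y
  constructor
  · exact fun h => y.2.resolve_left h
  · exact fun h => Set.disjoint_right.1 (o.disjoint_stratum_boundary1 n M) h

theorem exists_subsetChart_smoothStratum (hJ : J.Nonempty) {y : Γ.Xtilde n M}
    (hy : y ∈ o.smoothStratum n M J) :
    ∃ D : (Γ.blowupCharts n M).SubsetChart (𝓡 (Γ.confDim n - 1)) (o.smoothStratum n M J),
      y ∈ D.nbhd := by
  have : Nonempty (Γ.Xtilde n M) := ⟨y⟩
  obtain ⟨φ, hφ, hd⟩ := (isSmooth_blowupCharts Γ n M).exists_chart y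
  obtain ⟨j, hj⟩ := id hJ
  obtain ⟨W, hW, C, hCV, -⟩ := exists_collarChart hφ hJ hy hd (tail_mem_vertOf hj)
  obtain ⟨Ψ⟩ := nonempty_continuousLinearEquiv_euclideanSpace hW
  obtain ⟨D, hDn⟩ := C.exists_boundary_subsetChart hφ hJ Ψ
  exact ⟨D, hDn ▸ ⟨hd, hCV⟩⟩

variable (o n M) in
theorem exists_chartedSpace_smoothStratum (hJ : J.Nonempty) :
    ∃ _ : ChartedSpace (EuclideanSpace ℝ (Fin (Γ.confDim n - 1))) (o.smoothStratum n M J),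
      (Γ.blowupCharts n M).IsSmoothSubset (𝓡 (Γ.confDim n - 1)) (o.smoothStratum n M J) := by
  choose D hD using fun y : o.smoothStratum n M J => exists_subsetChart_smoothStratum hJ y.2
  exact ⟨ChartSystem.SubsetChart.chartedSpace (isSmooth_blowupCharts Γ n M) D hD,
    ChartSystem.SubsetChart.isSmoothSubset (isSmooth_blowupCharts Γ n M) D hD⟩

end EdgeOrientation

end RibbonGraph

/-! ### The blow-down map on a boundary stratum -/

namespace RibbonGraph

variable {F : Type*} [Finite F] {Γ : RibbonGraph F} {o : Γ.EdgeOrientation} {n : ℕ}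
  {M : Type*} [TopologicalSpace M] [ChartedSpace (EuclideanSpace ℝ (Fin n)) M]
  {φ : OpenPartialHomeomorph M (EuclideanSpace ℝ (Fin n))} {J : Finset Γ.Edge}

/-- The blow-down map in coordinates. -/
noncomputable def baseCoordOf (z : Γ.BlowupCoord n) : Γ.BaseCoord n :=
  (fun l => ((z.1 l).1, (z.1 l).1 + (z.1 l).2.2 • (z.1 l).2.1), z.2)

theorem contDiff_baseCoordOf : ContDiff ℝ ∞ (baseCoordOf : Γ.BlowupCoord n → _) := by
  unfold baseCoordOf
  fun_prop

theorem chart_blowdown (y : Γ.Xtilde n M) :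
    (Γ.baseCharts n M).chart φ (blowdown y) = baseCoordOf ((Γ.blowupCharts n M).chart φ y) :=
  Prod.ext (funext fun l => Prod.ext (DiagBlowup.polar_fst (y.1 l)).symm
    (DiagBlowup.polar_add_smul (y.1 l)).symm) rfl

namespace EdgeOrientation

variable (o) in
/-- The positions of the vertices as a function of the coordinates on the base. -/
noncomputable def basePos (x : Γ.BaseCoord n) : Γ.Vert → Euc n :=
  o.posCoord (fun l => ((x.1 l).1, (x.1 l).2 - (x.1 l).1, 1), x.2)

theorem contDiff_basePos : ContDiff ℝ ∞ (o.basePos : Γ.BaseCoord n → _) := by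
  refine (contDiff_posCoord o n).comp ?_
  fun_prop

theorem IsPosition.basePos_eq {z : Γ.BlowupCoord n} {u : Γ.Vert → Euc n} (h : o.IsPosition z u) :
    o.basePos (baseCoordOf z) = u := by
  refine IsPosition.posCoord ⟨fun l => ⟨(h.1 l).1, ?_⟩, h.2⟩
  rw [← (h.1 l).2]
  simp [baseCoordOf]

variable (o n J) in
/-- The kernel of `δ`: the positions for which the edges in `J` are collapsed. -/
noncomputable def collapsed : Submodule ℝ (Γ.Vert → Euc n) :=
  LinearMap.ker (o.coboundary n J).toLinearMap

variable (o J) in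
/-- The positions in the range of the chart `φ` for which no edge outside `J` is collapsed. -/
def admissible {N : Type*} [TopologicalSpace N] (φ : OpenPartialHomeomorph N (Euc n)) :
    Set (Γ.Vert → Euc n) :=
  {u | (∀ v, u v ∈ φ.target) ∧ ∀ l, l ∉ J → u (o.head l) - u (o.tail l) ≠ 0}

variable (o J) in
theorem isOpen_admissible {N : Type*} [TopologicalSpace N] (φ : OpenPartialHomeomorph N (Euc n)) :
    IsOpen (o.admissible J φ) := by
  have : o.admissible J φ = (⋂ v, (fun u => u v) ⁻¹' φ.target) ∩
      ⋂ (l) (_ : l ∉ J), {u | u (o.head l) - u (o.tail l) ≠ 0} := by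
    ext; simp [admissible]
  rw [this]
  refine (isOpen_iInter_of_finite fun v => φ.open_target.preimage (continuous_apply v)).inter
    (isOpen_iInter_of_finite fun l => isOpen_iInter_of_finite fun _ => isOpen_ne_fun
      (by fun_prop) continuous_const)

variable [T2Space M] [CompactSpace M]

theorem exists_position (hφ : φ ∈ IsManifold.maximalAtlas (𝓡 n) ∞ M) {y : Γ.Xtilde n M}
    (hyJ : y ∈ o.smoothStratum n M J) (hy : y ∈ (Γ.blowupCharts n M).dom φ) :
    ∃ u ∈ o.collapsed n J, u ∈ o.admissible J φ ∧
      o.IsPosition ((Γ.blowupCharts n M).chart φ y) u ∧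
      o.polarCoord (direction φ J y) u = (Γ.blowupCharts n M).chart φ y := by
  obtain ⟨u, hu⟩ := (mem_vertexDiagonal_iff hy).1 (o.conf_subset n M hyJ.1.1)
  have hr := (mem_edgeStratum_iff hy).1 hyJ.1.2
  have hz := chart_mem_chartRange (Γ := Γ) hφ hy
  exact ⟨u, hu.coboundary_eq_zero hr, ⟨hu.mem_target hz, fun l hl => hu.sub_ne_zero hz hr hl⟩, hu,
    hu.eq_polarCoord hz hr⟩

variable [IsManifold (𝓡 n) ∞ M] [NeZero n]

/-- The multiray of a smooth boundary point can be moved to all base points in the domain of the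
chart: the smoothness of a point depends only on its multiray. -/
theorem pointOf_polarCoord_mem [Nonempty (Γ.Xtilde n M)]
    (hφ : φ ∈ IsManifold.maximalAtlas (𝓡 n) ∞ M) (hJ : J.Nonempty) {y : Γ.Xtilde n M}
    (hyJ : y ∈ o.smoothStratum n M J) (hy : y ∈ (Γ.blowupCharts n M).dom φ)
    {u : Γ.Vert → Euc n} (hu : u ∈ o.collapsed n J) (hu' : u ∈ o.admissible J φ) :
    (pointOf φ (o.polarCoord (direction φ J y) u) : Γ.Xtilde n M) ∈ (Γ.blowupCharts n M).dom φ ∧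
    (pointOf φ (o.polarCoord (direction φ J y) u) : Γ.Xtilde n M) ∈ o.smoothStratum n M J ∧
    (Γ.blowupCharts n M).chart φ (pointOf φ (o.polarCoord (direction φ J y) u)) =
      o.polarCoord (direction φ J y) u := by
  classical
  have hr := polarCoord_mem_chartRange (φ := φ) hu hu'.2 (norm_direction (J := J) hφ hy) hu'.1
  have hmem := pointOf_mem (M := M) hφ hr
  have hch := chart_pointOf (M := M) hφ hr
  refine ⟨hmem, ?_, hch⟩
  have hbl : blowdown (pointOf φ (o.polarCoord (direction φ J y) u) : Γ.Xtilde n M) ∈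
      o.vertexDiagonal M ∩ edgeStratum M J := by
    refine ⟨(mem_vertexDiagonal_iff hmem).2 ⟨u, ?_⟩, (mem_edgeStratum_iff hmem).2 ?_⟩
    · rw [hch]; exact isPosition_polarCoord hu hu'.2
    · rw [hch]; exact polarCoord_radius_eq_zero_iff hu'.2
  rw [mem_smoothStratum_iff hφ hmem hJ hbl]
  have : direction φ J (pointOf φ (o.polarCoord (direction φ J y) u) : Γ.Xtilde n M) =
      direction φ J y := by
    funext j
    change (((Γ.blowupCharts n M).chart φ _).1 j.1).2.1 = _
    rw [hch]
    simp only [polarCoord, coordOf, dif_pos j.2]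
  rw [this]
  exact (mem_smoothStratum_iff hφ hy hJ ⟨o.conf_subset n M hyJ.1.1, hyJ.1.2⟩).1 hyJ

/-- The positions with the edges in `J` collapsed are coordinates on the image of a boundary stratum.
The inverse is well-defined because the multiray of one point can be used over all of them. -/
theorem exists_subsetChart_image (hJ : J.Nonempty) {x₀ : Γ.X M}
    (hx₀ : x₀ ∈ blowdown '' o.smoothStratum n M J) :
    ∃ D : (Γ.baseCharts n M).SubsetChart (𝓡 (Module.finrank ℝ (o.collapsed n J)))
      (blowdown '' o.smoothStratum n M J), x₀ ∈ D.nbhd := by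
  obtain ⟨y₀, hy₀, rfl⟩ := hx₀
  have : Nonempty (Γ.Xtilde n M) := ⟨y₀⟩
  have hS := isSmooth_baseCharts Γ n M
  obtain ⟨φ, hφ, hd⟩ := (isSmooth_blowupCharts Γ n M).exists_chart y₀
  obtain ⟨Ψ⟩ := nonempty_continuousLinearEquiv_euclideanSpace
    (W := o.collapsed n J) rfl
  obtain ⟨pr, hpr⟩ := (o.collapsed n J).subtype.exists_leftInverse_of_injective
    (o.collapsed n J).ker_subtype
  have hpr' : ∀ h : o.collapsed n J, pr h = h := fun h => LinearMap.congr_fun hpr h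
  let po : EuclideanSpace ℝ (Fin (Module.finrank ℝ (o.collapsed n J))) → (Γ.Vert → Euc n) :=
    fun w => Ψ.symm w
  have hpo : ContDiff ℝ ∞ po := (o.collapsed n J).subtypeL.contDiff.comp Ψ.symm.contDiff
  have hpt := fun w (hw : po w ∈ o.admissible J φ) =>
    pointOf_polarCoord_mem hφ hJ hy₀ hd (Ψ.symm w).2 hw
  have himage : IsOpen (po ⁻¹' o.admissible J φ) :=
    (o.isOpen_admissible J φ).preimage hpo.continuous
  have hbase : ∀ w, po w ∈ o.admissible J φ → (Γ.baseCharts n M).chart φ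
      (blowdown (pointOf φ (o.polarCoord (direction φ J y₀) (po w)) : Γ.Xtilde n M)) =
      baseCoordOf (o.polarCoord (direction φ J y₀) (po w)) := fun w hw => by
    rw [chart_blowdown, (hpt w hw).2.2]
  refine ⟨{
    φ := φ
    nbhd := (Γ.baseCharts n M).dom φ
    image := po ⁻¹' o.admissible J φ
    coord := fun x => Ψ (pr.toContinuousLinearMap (o.basePos x))
    param := fun w => blowdown
      (pointOf φ (o.polarCoord (direction φ J y₀) (po w)) : Γ.Xtilde n M)
    mem_atlas := hφ
    isOpen_nbhd := hS.isOpen_dom hφ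
    isOpen_image := himage
    nbhd_subset := Subset.rfl
    coord_mem := ?_
    param_coord := ?_
    contDiffAt_coord := fun y hy hyV => (Ψ.contDiff.comp
      (pr.toContinuousLinearMap.contDiff.comp contDiff_basePos)).contDiffAt
    param_mem := fun w hw => ⟨⟨_, (hpt w hw.1).2.1, rfl⟩, (hpt w hw.1).1⟩
    coord_param := fun w hw => ?_
    contDiffWithinAt_param := fun w hw => ?_ }, hd⟩
  · rintro _ ⟨y, hy, rfl⟩ hyd
    obtain ⟨u, hu, hu', hup, -⟩ := exists_position hφ hy hyd
    refine ⟨?_, by simp⟩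
    change ((Ψ.symm (Ψ (pr (o.basePos _))) : o.collapsed n J) : Γ.Vert → Euc n) ∈
      o.admissible J φ
    rw [Ψ.symm_apply_apply, chart_blowdown, hup.basePos_eq, hpr' ⟨u, hu⟩]
    exact hu'
  · rintro _ ⟨y, hy, rfl⟩ hyd
    obtain ⟨u, hu, hu', hup, -⟩ := exists_position hφ hy hyd
    have h1 : po (Ψ (pr.toContinuousLinearMap (o.basePos
        ((Γ.baseCharts n M).chart φ (blowdown y))))) = u := by
      change ((Ψ.symm (Ψ (pr (o.basePos _))) : o.collapsed n J) : Γ.Vert → Euc n) = _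
      rw [Ψ.symm_apply_apply, chart_blowdown, hup.basePos_eq, hpr' ⟨u, hu⟩]
    rw [h1]
    obtain ⟨h2, -, h3⟩ := pointOf_polarCoord_mem hφ hJ hy₀ hd hu hu'
    rw [hup.blowdown_eq hyd]
    refine IsPosition.blowdown_eq h2 ?_
    rw [h3]
    exact isPosition_polarCoord hu hu'.2
  · rw [hbase w hw.1, (isPosition_polarCoord (Ψ.symm w).2 hw.1.2).basePos_eq]
    change Ψ (pr (Ψ.symm w : o.collapsed n J)) = w
    rw [hpr', Ψ.apply_symm_apply]
  · have h1 : ContDiffAt ℝ ∞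
        (fun w => baseCoordOf (o.polarCoord (direction φ J y₀) (po w))) w :=
      contDiff_baseCoordOf.contDiffAt.comp w
        ((contDiffAt_polarCoord hw.1.2).comp w hpo.contDiffAt)
    refine (h1.congr_of_eventuallyEq ?_).contDiffWithinAt
    filter_upwards [himage.mem_nhds hw.1] with w' hw' using hbase w' hw'

/-- The blow-down map of a boundary stratum is a submersion onto its image, because the multirays
can be transported along the base. -/
theorem exists_chartedSpace_image (hJ : J.Nonempty) {d : ℕ}
    [ChartedSpace (EuclideanSpace ℝ (Fin d)) (o.smoothStratum n M J)]
    (hB : (Γ.blowupCharts n M).IsSmoothSubset (𝓡 d) (o.smoothStratum n M J)) :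
    ∃ (m : ℕ) (_ : ChartedSpace (EuclideanSpace ℝ (Fin m)) (blowdown '' o.smoothStratum n M J)),
      IsManifold (𝓡 m) ∞ (blowdown '' o.smoothStratum n M J) ∧
      (Γ.baseCharts n M).Immersion (𝓡 m)
        (Subtype.val : blowdown '' o.smoothStratum n M J → Γ.X M) ∧
      ContMDiff (𝓡 d) (𝓡 m) ∞ (imageFactorization blowdown (o.smoothStratum n M J)) ∧
      ∀ p, Function.Surjective (mfderiv (𝓡 d) (𝓡 m)
        (imageFactorization blowdown (o.smoothStratum n M J)) p) := by
  have hS := isSmooth_baseCharts Γ n M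
  have hS' := isSmooth_blowupCharts Γ n M
  choose D hD using fun x : blowdown '' o.smoothStratum n M J => exists_subsetChart_image hJ x.2
  let := ChartSystem.SubsetChart.chartedSpace hS D hD
  have hA := ChartSystem.SubsetChart.isSmoothSubset hS D hD
  have hsm : ContMDiff (𝓡 d) (𝓡 (Module.finrank ℝ (o.collapsed n J))) ∞
      (imageFactorization blowdown (o.smoothStratum n M J)) := by
    intro p
    obtain ⟨φ, hφ, hd⟩ := hS'.exists_chart p.1
    refine hA.contMDiffAt_of_chart hS hφ ?_ ?_
    · exact continuous_subtype_val.continuousAt.eventually (hS'.dom_mem_nhds hφ hd)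
    · have : (fun x : o.smoothStratum n M J => (Γ.baseCharts n M).chart φ
          (imageFactorization blowdown (o.smoothStratum n M J) x)) =
          fun x : o.smoothStratum n M J => baseCoordOf ((Γ.blowupCharts n M).chart φ x) :=
        funext fun x => chart_blowdown x.1
      rw [this]
      exact ContMDiffAt.comp (g := baseCoordOf)
        (f := fun x : o.smoothStratum n M J => (Γ.blowupCharts n M).chart φ x) p
        contDiff_baseCoordOf.contMDiff.contMDiffAt (hB.contMDiffAt_chart hS' hφ hd)
  refine ⟨_, this, hA.isManifold, hA.immersion, hsm, fun p => ?_⟩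
  have : Nonempty (Γ.Xtilde n M) := ⟨p⟩
  classical
  obtain ⟨φ, hφ, hd⟩ := hS'.exists_chart p.1
  -- a local section that keeps the multiray of `p`
  let pt : blowdown '' o.smoothStratum n M J → Γ.Xtilde n M := fun x =>
    pointOf φ (o.polarCoord (direction φ J p) (o.basePos ((Γ.baseCharts n M).chart φ x)))
  let σ : blowdown '' o.smoothStratum n M J → o.smoothStratum n M J := fun x =>
    if h : pt x ∈ o.smoothStratum n M J then ⟨_, h⟩ else p
  let π := imageFactorization blowdown (o.smoothStratum n M J)
  have hkey : ∀ x : blowdown '' o.smoothStratum n M J, x.1 ∈ (Γ.baseCharts n M).dom φ →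
      o.basePos ((Γ.baseCharts n M).chart φ x) ∈ o.admissible J φ ∧
      (σ x : Γ.Xtilde n M) ∈ (Γ.blowupCharts n M).dom φ ∧
      (Γ.blowupCharts n M).chart φ (σ x) =
        o.polarCoord (direction φ J p) (o.basePos ((Γ.baseCharts n M).chart φ x)) ∧
      π (σ x) = x := by
    rintro ⟨_, y, hy, rfl⟩ hyd
    obtain ⟨u, hu, hu', hup, -⟩ := exists_position hφ hy hyd
    have hbp : o.basePos ((Γ.baseCharts n M).chart φ (blowdown y)) = u := by
      rw [chart_blowdown, hup.basePos_eq]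
    obtain ⟨h1, h2, h3⟩ := pointOf_polarCoord_mem hφ hJ p.2 hd hu hu'
    have hσ : (σ ⟨_, y, hy, rfl⟩ : Γ.Xtilde n M) =
        pointOf φ (o.polarCoord (direction φ J p) u) := by
      have : pt ⟨_, y, hy, rfl⟩ = pointOf φ (o.polarCoord (direction φ J p) u) :=
        congrArg (fun u => (pointOf φ (o.polarCoord (direction φ J p) u) : Γ.Xtilde n M)) hbp
      have h4 : pt ⟨_, y, hy, rfl⟩ ∈ o.smoothStratum n M J := by rw [this]; exact h2
      simp only [σ, dif_pos h4, this]
    dsimp only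
    rw [hbp, hσ]
    refine ⟨hu', h1, h3, Subtype.ext ?_⟩
    change blowdown (σ _).1 = blowdown y
    rw [hσ, hup.blowdown_eq hyd]
    refine IsPosition.blowdown_eq h1 ?_
    rw [h3]
    exact isPosition_polarCoord hu hu'.2
  have hdom : ∀ᶠ x in 𝓝 (π p), x.1 ∈ (Γ.baseCharts n M).dom φ :=
    continuous_subtype_val.continuousAt.eventually (hS.dom_mem_nhds hφ hd)
  have hσp : σ (π p) = p := by
    refine Subtype.ext ?_
    obtain ⟨u, hu, hu', hup, hpc⟩ := exists_position hφ p.2 hd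
    refine chart_injOn hφ (hkey (π p) hd).2.1 hd ?_
    rw [(hkey (π p) hd).2.2.1]
    change o.polarCoord (direction φ J p) (o.basePos
      ((Γ.baseCharts n M).chart φ (blowdown p.1))) = _
    rw [chart_blowdown, hup.basePos_eq, hpc]
  have hσs : ContMDiffAt (𝓡 (Module.finrank ℝ (o.collapsed n J))) (𝓡 d) ∞ σ (π p) := by
    refine hB.contMDiffAt_of_chart hS' hφ ?_ ?_
    · filter_upwards [hdom] with x hx using (hkey x hx).2.1
    · have h1 : ContDiffAt ℝ ∞ (fun x => o.polarCoord (direction φ J p) (o.basePos x))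
          ((Γ.baseCharts n M).chart φ (π p)) :=
        ContDiffAt.comp _ (contDiffAt_polarCoord (hkey (π p) hd).1.2) contDiff_basePos.contDiffAt
      refine (ContMDiffAt.comp (g := fun x => o.polarCoord (direction φ J p) (o.basePos x))
        (f := fun x : blowdown '' o.smoothStratum n M J => (Γ.baseCharts n M).chart φ x) (π p)
        h1.contMDiffAt (hA.contMDiffAt_chart hS hφ hd)).congr_of_eventuallyEq ?_
      filter_upwards [hdom] with x hx using (hkey x hx).2.2.1
  have hπd : MDifferentiableAt (𝓡 d) (𝓡 (Module.finrank ℝ (o.collapsed n J))) π (σ (π p)) :=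
    (hsm _).mdifferentiableAt (by simp)
  have hcomp := mfderiv_comp (π p) hπd (hσs.mdifferentiableAt (by simp))
  -- the differential of the section is a right inverse of the differential of the projection
  have hid : mfderiv (𝓡 (Module.finrank ℝ (o.collapsed n J)))
      (𝓡 (Module.finrank ℝ (o.collapsed n J))) (π ∘ σ) (π p) = ContinuousLinearMap.id ℝ _ := by
    rw [← mfderiv_id]
    refine Filter.EventuallyEq.mfderiv_eq ?_
    filter_upwards [hdom] with x hx using (hkey x hx).2.2.2
  rw [hid] at hcomp
  intro v
  have h1 := congrArg (fun L => L v) hcomp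
  rw [hσp] at h1
  exact ⟨_, h1.symm⟩

end EdgeOrientation

end RibbonGraph

/-! ### The codimension of the singular part -/

namespace RibbonGraph

variable {F : Type*} [Finite F] {Γ : RibbonGraph F} {o : Γ.EdgeOrientation} {n : ℕ}
  {J I : Finset Γ.Edge}

namespace EdgeOrientation

variable (o n J I) in
/-- The limits of directions that contain a nonnegative solution of the cycle equations whose
zeros are precisely the edges in `I`. -/
def faceSet : Set (J → Euc n) :=
  {θ | θ ∈ closure (o.directionSet n J) ∧
    ∃ c ∈ o.rays θ, (∀ j, 0 ≤ c j) ∧ ∀ j : J, c j = 0 ↔ j.1 ∈ I}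

/-- Rank and nullity of the restriction of `δ` to the positions with the edges in `I` collapsed. -/
theorem finrank_map_collapsed (hIJ : I ⊆ J) :
    Module.finrank ℝ ((o.collapsed n I).map (o.coboundary n J).toLinearMap) +
      Module.finrank ℝ (o.collapsed n J) = Module.finrank ℝ (o.collapsed n I) := by
  let f := (o.coboundary n J).toLinearMap.domRestrict (o.collapsed n I)
  have hle : o.collapsed n J ≤ o.collapsed n I := fun u hu => by
    refine LinearMap.mem_ker.2 (funext fun i => ?_)
    exact congrFun (LinearMap.mem_ker.1 hu) ⟨i.1, hIJ i.2⟩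
  have hker : LinearMap.ker f = (o.collapsed n J).comap (o.collapsed n I).subtype := by
    ext u
    rfl
  have h := LinearMap.finrank_range_add_finrank_ker f
  rw [hker, LinearEquiv.finrank_eq (Submodule.comapSubtypeEquivOfLe hle)] at h
  rw [← h, LinearMap.range_domRestrict]

theorem finrank_collapsed_empty : Module.finrank ℝ (o.collapsed n ∅) = Γ.confDim n := by
  have : o.collapsed n ∅ = ⊤ := by
    refine LinearMap.ker_eq_top.2 (LinearMap.ext fun u => funext fun j => ?_)
    exact absurd j.2 (Finset.notMem_empty _)
  rw [this, finrank_top]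
  exact finrank_positions

/-- A point of `o.faceSet n J I` is determined by its restriction to `I`, and by a solution that
vanishes on `I` and is unique up to scaling. -/
theorem smoothlyCovered_faceSet (hIJ : I ⊂ J) {d e : ℕ}
    (h : SmoothlyCovered (closure (o.directionSet n I)) d
      (Module.finrank ℝ (o.collapsed n I) + e)) :
    SmoothlyCovered (o.faceSet n J I) d (Module.finrank ℝ (o.collapsed n J) + 1 + e) := by
  classical
  let W := (o.collapsed n I).map (o.coboundary n J).toLinearMap
  obtain ⟨B, hB, hB'⟩ := SmoothlyCovered.exists_slice W
  have hrank := o.finrank_map_collapsed (n := n) hIJ.subset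
  let U : Set ((I → Euc n) × W) := {p | ∀ j : J, j.1 ∉ I → (p.2 : J → Euc n) j ≠ 0}
  have hU : IsOpen U := by
    have : U = ⋂ (j : J) (_ : j.1 ∉ I), {p | (p.2 : J → Euc n) j ≠ 0} := by ext; simp [U]
    rw [this]
    exact isOpen_iInter_of_finite fun j => isOpen_iInter_of_finite fun _ =>
      isOpen_ne_fun ((continuous_apply j).comp (continuous_subtype_val.comp continuous_snd))
        continuous_const
  -- the multiray that is given by `p.1` on `I` and by the normalized components of `p.2` elsewhere
  let f : (I → Euc n) × W → (J → Euc n) := fun p j =>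
    if hj : j.1 ∈ I then p.1 ⟨j.1, hj⟩ else
      ‖(p.2 : J → Euc n) j‖⁻¹ • (p.2 : J → Euc n) j
  have hf : ContDiffOn ℝ ∞ f U := by
    intro p hp
    refine ContDiffAt.contDiffWithinAt (contDiffAt_pi.2 fun j => ?_)
    by_cases hj : j.1 ∈ I
    · simp only [f, dif_pos hj]
      fun_prop
    · simp only [f, dif_neg hj]
      have h1 : ContDiffAt ℝ ∞ (fun p : (I → Euc n) × W => (p.2 : J → Euc n) j) p := by
        have : ContDiff ℝ ∞ (fun p : (I → Euc n) × W => (W.subtypeL p.2) j) := by fun_prop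
        exact this.contDiffAt
      exact ((h1.norm ℝ (hp j hj)).inv (norm_ne_zero_iff.2 (hp j hj))).smul h1
  refine (((h.prod hB).image hU hf).of_le (fun m hm => ?_)).mono ?_
  -- The dimensions add up to at most `d - (rank I + e) + (rank I - rank J - 1)`, where `rank` is the
  -- dimension of the space of collapsed positions.
  · have : Module.finrank ℝ W = Module.finrank ℝ
      ((o.collapsed n I).map (o.coboundary n J).toLinearMap) := rfl
    omega
  · rintro θ ⟨hθ, c, hc, hc0, hcI⟩
    obtain ⟨u, hu⟩ := mem_rays.1 hc
    have hpos : ∀ j : J, j.1 ∉ I → 0 < c j := fun j hj =>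
      lt_of_le_of_ne (hc0 j) fun h => hj ((hcI j).1 h.symm)
    -- the solution `c j • θ j` is a vector of `W`, and a multiple of it lies in the slice
    have hw : o.coboundary n J u ∈ W := by
      refine ⟨u, LinearMap.mem_ker.2 (funext fun i => ?_), rfl⟩
      have := hu ⟨i.1, hIJ.subset i.2⟩
      rwa [(hcI ⟨i.1, hIJ.subset i.2⟩).2 i.2, zero_smul] at this
    obtain ⟨j₀, hj₀, hj₀I⟩ := Finset.exists_of_ssubset hIJ
    have hnorm := norm_eq_one_of_mem_closure hθ
    have hne : (⟨_, hw⟩ : W) ≠ 0 := fun h => by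
      have h1 := congrFun (congrArg Subtype.val h) ⟨j₀, hj₀⟩
      change o.coboundary n J u ⟨j₀, hj₀⟩ = 0 at h1
      rw [hu, smul_eq_zero] at h1
      refine h1.elim (hpos ⟨j₀, hj₀⟩ hj₀I).ne' fun h2 => ?_
      have := hnorm ⟨j₀, hj₀⟩
      rw [h2, norm_zero] at this
      exact zero_ne_one this
    obtain ⟨r, hr, hrB⟩ := hB' _ hne
    have hval : ∀ j : J, ((r • (⟨_, hw⟩ : W) : W) : J → Euc n) j = (r * c j) • θ j := fun j => by
      change r • o.coboundary n J u j = _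
      rw [hu, smul_smul]
    have hrc : ∀ j : J, j.1 ∉ I → 0 < r * c j := fun j hj => mul_pos hr (hpos j hj)
    refine ⟨(fun i => θ ⟨i.1, hIJ.subset i.2⟩, r • ⟨_, hw⟩), ⟨⟨?_, hrB⟩, fun j hj => ?_⟩, ?_⟩
    · exact restrict_mem_closure_directionSet hIJ.subset hθ
    · change ((r • (⟨_, hw⟩ : W) : W) : J → Euc n) j ≠ 0
      rw [hval, ← norm_ne_zero_iff, norm_smul, hnorm, mul_one, norm_ne_zero_iff]
      exact (hrc j hj).ne'
    · funext j
      by_cases hj : j.1 ∈ I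
      · simp only [f, dif_pos hj]
      · simp only [f, dif_neg hj]
        rw [hval, norm_smul, hnorm, mul_one, Real.norm_of_nonneg (hrc j hj).le, smul_smul,
          inv_mul_cancel₀ (hrc j hj).ne', one_smul]

theorem mem_faceSet_of_mem_rays {θ : J → Euc n} (hθ : θ ∈ closure (o.directionSet n J))
    {c : J → ℝ} (hc : c ∈ o.rays θ) (hc0 : ∀ j, 0 ≤ c j) (hpos : ∃ j, 0 < c j) :
    ∃ I, I ⊂ J ∧ ((∃ j, c j = 0) → I.Nonempty) ∧ θ ∈ o.faceSet n J I := by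
  classical
  have hmem : ∀ j : J, j.1 ∈ (Finset.univ.filter fun j : J => c j = 0).map
      (Function.Embedding.subtype _) ↔ c j = 0 := fun j => by simp
  refine ⟨(Finset.univ.filter fun j : J => c j = 0).map (Function.Embedding.subtype _), ?_, ?_,
    hθ, c, hc, hc0, fun j => (hmem j).symm⟩
  · obtain ⟨j, hj⟩ := hpos
    refine Finset.ssubset_iff_subset_ne.2 ⟨fun l hl => ?_, fun h => ?_⟩
    · obtain ⟨i, -, rfl⟩ := Finset.mem_map.1 hl
      exact i.2
    · exact hj.ne' ((hmem j).1 (h.ge j.2))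
  · rintro ⟨j, hj⟩
    exact ⟨j.1, (hmem j).2 hj⟩

/-- The limit multirays have codimension one together with the collapsed positions, whose dimension
is therefore part of the codimension here. -/
theorem smoothlyCovered_closure_directionSet (hJ : J.Nonempty) :
    SmoothlyCovered (closure (o.directionSet n J)) (Γ.confDim n)
      (Module.finrank ℝ (o.collapsed n J) + 1) := by
  classical
  induction J using Finset.strongInduction with
  | H J ih =>
    have key : ∀ I, I ⊂ J → SmoothlyCovered (o.faceSet n J I) (Γ.confDim n)
        (Module.finrank ℝ (o.collapsed n J) + 1) := by
      intro I hI
      rcases I.eq_empty_or_nonempty with rfl | hne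
      -- For `I = ∅` there is only one multiray.
      · refine smoothlyCovered_faceSet (e := 0) hI
          ((SmoothlyCovered.univ_of_finiteDimensional ?_).mono (subset_univ _))
        rw [finrank_collapsed_empty, Module.finrank_zero_of_subsingleton]
        omega
      · exact (smoothlyCovered_faceSet hI (ih I hI hne)).of_le fun m hm => by omega
    refine (SmoothlyCovered.iUnion fun I : {I // I ⊂ J} => key I.1 I.2).mono ?_
    intro θ hθ
    obtain ⟨c, ⟨hc0, hc1⟩, -, hc⟩ := o.closure_directionSet_subset n hJ hθ
    obtain ⟨I, hI, -, h⟩ := mem_faceSet_of_mem_rays hθ hc hc0 (by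
      by_contra! hcon
      have : ∑ j, c j ≤ 0 := Finset.sum_nonpos fun j _ => hcon j
      linarith)
    exact mem_iUnion.2 ⟨⟨I, hI⟩, h⟩

/-- One more dimension is lost at the multirays that are not rigid: they have a solution with some
vanishing components, so that the restriction to its zero set varies in codimension one. -/
theorem smoothlyCovered_not_isRigid (hJ : J.Nonempty) :
    SmoothlyCovered {θ | θ ∈ closure (o.directionSet n J) ∧ ¬ o.IsRigid θ} (Γ.confDim n)
      (Module.finrank ℝ (o.collapsed n J) + 2) := by
  refine (SmoothlyCovered.iUnion fun I : {I // I ⊂ J ∧ I.Nonempty} => smoothlyCovered_faceSet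
    I.2.1 (smoothlyCovered_closure_directionSet I.2.2)).mono ?_
  rintro θ ⟨hθ, hr⟩
  obtain ⟨c, hc, hc0, h0, hpos⟩ := exists_degenerate_of_not_isRigid hJ hθ hr
  obtain ⟨I, hI, hne, h⟩ := mem_faceSet_of_mem_rays hθ hc hc0 hpos
  exact mem_iUnion.2 ⟨⟨I, hI, hne h0⟩, h⟩

variable (o n) (M : Type*) [TopologicalSpace M] [ChartedSpace (EuclideanSpace ℝ (Fin n)) M]
  [IsManifold (𝓡 n) ∞ M] [T2Space M] [NeZero n] [CompactSpace M]

theorem exists_mem_edgeStratum_of_mem_sing {y : Γ.Xtilde n M} (hy : y ∈ o.sing n M) :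
    ∃ J : Finset Γ.Edge, J.Nonempty ∧ blowdown y ∈ edgeStratum M J := by
  obtain ⟨J, hJ⟩ := exists_mem_edgeStratum (blowdown y)
  rw [sing_eq] at hy
  simp only [mem_iUnion] at hy
  obtain ⟨I, -, l, -, -, hl⟩ := hy
  exact ⟨J, ⟨l, (hJ l).1 hl⟩, hJ⟩

/-- The part of the singular set over `J` in the domain of one chart is parametrized by collapsed
positions and by limits of directions that are not rigid. -/
theorem codimAtLeast_sing_inter {φ : OpenPartialHomeomorph M (EuclideanSpace ℝ (Fin n))}
    (hφ : φ ∈ IsManifold.maximalAtlas (𝓡 n) ∞ M) (hJ : J.Nonempty) :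
    (Γ.blowupCharts n M).CodimAtLeast
      (o.sing n M ∩ blowdown ⁻¹' edgeStratum M J ∩ (Γ.blowupCharts n M).dom φ) (Γ.confDim n) 2 := by
  classical
  rcases isEmpty_or_nonempty (Γ.Xtilde n M) with hE | hE
  · exact ⟨∅, countable_empty, by simp, fun y => hE.elim y⟩
  let U : Set ((J → Euc n) × o.collapsed n J) :=
    {p | (∀ j, p.1 j ≠ 0) ∧ (p.2 : Γ.Vert → Euc n) ∈ o.admissible J φ}
  have hU : IsOpen U := by
    refine IsOpen.inter (s := {p : (J → Euc n) × o.collapsed n J | ∀ j, p.1 j ≠ 0}) ?_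
      ((o.isOpen_admissible J φ).preimage (by fun_prop))
    have : {p : (J → Euc n) × o.collapsed n J | ∀ j, p.1 j ≠ 0} = ⋂ j, {p | p.1 j ≠ 0} := by
      ext; simp
    rw [this]
    exact isOpen_iInter_of_finite fun j => isOpen_ne_fun (by fun_prop) continuous_const
  -- Directions are normalized here, because the parameters have to range over an open set.
  let g : (J → Euc n) × o.collapsed n J → Γ.BlowupCoord n := fun p =>
    o.polarCoord (fun j => ‖p.1 j‖⁻¹ • p.1 j) (p.2 : Γ.Vert → Euc n)
  have hg : ∀ p ∈ U, g p ∈ Γ.chartRange φ := fun p hp =>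
    polarCoord_mem_chartRange p.2.2 hp.2.2 (fun j => norm_smul_inv_norm (hp.1 j)) hp.2.1
  have hgs : ContDiffOn ℝ ∞ g U := by
    intro p hp
    have h1 : ContDiffAt ℝ ∞ (fun p : (J → Euc n) × o.collapsed n J =>
        fun j => ‖p.1 j‖⁻¹ • p.1 j) p :=
      contDiffAt_pi.2 fun j => by
        have h2 : ContDiffAt ℝ ∞ (fun p : (J → Euc n) × o.collapsed n J => p.1 j) p := by fun_prop
        exact ((h2.norm ℝ (hp.1 j)).inv (norm_ne_zero_iff.2 (hp.1 j))).smul h2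
    have h3 : ContDiffAt ℝ ∞ (fun p : (J → Euc n) × o.collapsed n J =>
        (p.2 : Γ.Vert → Euc n)) p := by
      have : ContDiff ℝ ∞ (fun p : (J → Euc n) × o.collapsed n J =>
          (o.collapsed n J).subtypeL p.2) := by fun_prop
      exact this.contDiffAt
    exact (ContDiffAt.comp
      (g := fun p : (J → Euc n) × (Γ.Vert → Euc n) => o.polarCoord p.1 p.2)
      (f := fun p : (J → Euc n) × o.collapsed n J =>
        (fun j => ‖p.1 j‖⁻¹ • p.1 j, (p.2 : Γ.Vert → Euc n))) p
      (contDiffAt_uncurry_polarCoord hp.2.2) (h1.prodMk h3)).contDiffWithinAt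
  have hB : SmoothlyCovered
      ({θ | θ ∈ closure (o.directionSet n J) ∧ ¬ o.IsRigid θ} ×ˢ univ :
        Set ((J → Euc n) × o.collapsed n J))
      (Γ.confDim n) 2 :=
    ((smoothlyCovered_not_isRigid hJ).prod (SmoothlyCovered.univ_of_finiteDimensional
      (W := o.collapsed n J) (c := 0) le_rfl)).of_le fun m hm => by omega
  refine ((isSmooth_blowupCharts Γ n M).codimAtLeast_image hφ hB hU
    (f := fun p => pointOf φ (g p)) (fun p hp => pointOf_mem hφ (hg p hp))
    (hgs.congr fun p hp => chart_pointOf hφ (hg p hp))).mono ?_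
  rintro y ⟨⟨hy, hyJ⟩, hd⟩
  have hvd := o.conf_subset n M hy.1
  obtain ⟨u, hu⟩ := (mem_vertexDiagonal_iff hd).1 hvd
  have hr := (mem_edgeStratum_iff hd).1 hyJ
  have hz := chart_mem_chartRange (Γ := Γ) hφ hd
  have hn := norm_direction (J := J) hφ hd
  refine ⟨(direction φ J y, ⟨u, hu.coboundary_eq_zero hr⟩), ⟨⟨⟨?_, ?_⟩, mem_univ _⟩, ?_, ?_⟩, ?_⟩
  · exact (mem_conf_iff hφ hd ⟨hvd, hyJ⟩).1 hy.1
  · rw [← mem_smoothStratum_iff hφ hd hJ ⟨hvd, hyJ⟩]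
    exact fun h => h.2 hy
  · exact fun j => norm_ne_zero_iff.1 ((hn j).trans_ne one_ne_zero)
  · exact ⟨hu.mem_target hz, fun l hl => hu.sub_ne_zero hz hr hl⟩
  · have : g (direction φ J y, ⟨u, hu.coboundary_eq_zero hr⟩) =
        (Γ.blowupCharts n M).chart φ y := by
      refine Eq.trans ?_ (hu.eq_polarCoord hz hr)
      change o.polarCoord (fun j => ‖direction φ J y j‖⁻¹ • direction φ J y j) u = _
      simp only [hn, inv_one, one_smul]
      rfl
    change pointOf φ (g _) = y
    rw [this, pointOf_chart hφ hd]

theorem codimAtLeast_sing :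
    (Γ.blowupCharts n M).CodimAtLeast (o.sing n M) (Γ.confDim n) 2 := by
  have hS := isSmooth_blowupCharts Γ n M
  have := DiagBlowup.compactSpace (n := n) (M := M)
  choose φ hφ hd using hS.exists_chart
  obtain ⟨t, ht⟩ := CompactSpace.elim_nhds_subcover (fun y => (Γ.blowupCharts n M).dom (φ y))
    fun y => hS.dom_mem_nhds (hφ y) (hd y)
  refine (ChartSystem.CodimAtLeast.biUnion t.countable_toSet fun y _ =>
    ChartSystem.CodimAtLeast.iUnion fun J : {J : Finset Γ.Edge // J.Nonempty} =>
    o.codimAtLeast_sing_inter n M (hφ y) J.2).mono fun y hy => ?_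
  obtain ⟨J, hJ, hyJ⟩ := o.exists_mem_edgeStratum_of_mem_sing n M hy
  obtain ⟨x, hx, hyx⟩ := mem_iUnion₂.1 (ht.ge (mem_univ y))
  exact mem_iUnion₂.2 ⟨x, hx, mem_iUnion.2 ⟨⟨J, hJ⟩, ⟨hy, hyJ⟩, hyx⟩⟩

end EdgeOrientation

end RibbonGraph

/-! ### The decomposition of the configuration space -/

namespace RibbonGraph

namespace EdgeOrientation

variable {F : Type*} [Finite F] {Γ : RibbonGraph F} (o : Γ.EdgeOrientation) (n : ℕ)
  (M : Type*) [TopologicalSpace M] [ChartedSpace (EuclideanSpace ℝ (Fin n)) M]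

theorem pairwise_disjoint_smoothStratum :
    Pairwise (Function.onFun Disjoint (o.smoothStratum n M)) := fun _ _ hne =>
  Set.disjoint_left.2 fun _ h h' => hne (eq_of_mem_edgeStratum h.1.2 h'.1.2)

theorem pairwise_disjoint_mainFace : Pairwise (Function.onFun Disjoint (o.mainFace n M)) :=
  fun _ _ hne => Set.disjoint_left.2 fun _ h h' =>
    hne (Finset.singleton_injective (eq_of_mem_edgeStratum h.2 h'.2))

theorem boundary1_eq :
    o.boundary1 n M = (⋃ l : Γ.Edge, o.mainFace n M l) ∪ o.hiddenBoundary n M := by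
  refine Subset.antisymm (fun y hy => ?_) (union_subset
    (iUnion_subset fun l => inter_subset_left) (iUnion₂_subset fun J hJ =>
      o.smoothStratum_subset_boundary1 n M (Finset.card_pos.1 (by omega))))
  obtain ⟨J, hJ, hyJ⟩ := mem_iUnion₂.1 hy
  rcases (Nat.succ_le_of_lt hJ.card_pos).eq_or_lt with h | h
  · obtain ⟨l, rfl⟩ := Finset.card_eq_one.1 h.symm
    exact Or.inl (mem_iUnion.2 ⟨l, hy, hyJ.1.2⟩)
  · exact Or.inr (mem_iUnion₂.2 ⟨J, h, hyJ⟩)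

theorem disjoint_mainFace_hiddenBoundary :
    Disjoint (⋃ l : Γ.Edge, o.mainFace n M l) (o.hiddenBoundary n M) := by
  refine Set.disjoint_left.2 fun y h h' => ?_
  obtain ⟨l, hl⟩ := mem_iUnion.1 h
  obtain ⟨J, hJ, hyJ⟩ := mem_iUnion₂.1 h'
  rw [eq_of_mem_edgeStratum hyJ.1.2 hl.2, Finset.card_singleton] at hJ
  omega

theorem stratum_subset_cornerStratum (J : Finset Γ.Edge) :
    o.stratum n M J ⊆ Γ.cornerStratum n M J.card := fun y hy => by
  have h := Nat.card_congr (Equiv.subtypeEquivRight hy.2)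
  exact h.trans (by rw [Nat.card_eq_fintype_card, Fintype.card_coe])

/-- Each stratum of the boundary is open in the boundary, and the complement is a union of other
strata. -/
theorem isClopen_smoothStratum [T2Space M] (J : Finset Γ.Edge) :
    IsClopen ((Subtype.val : o.boundary1 n M → Γ.Xtilde n M) ⁻¹' o.smoothStratum n M J) := by
  have hopen : ∀ I : Finset Γ.Edge,
      IsOpen ((Subtype.val : o.boundary1 n M → Γ.Xtilde n M) ⁻¹' o.smoothStratum n M I) := by
    intro I
    refine isOpen_iff_mem_nhds.2 fun y hy => ?_
    filter_upwards [continuous_subtype_val.continuousAt.eventually (eventually_mem_stratum hy)]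
      with z hz
    obtain ⟨K, hK, hzK⟩ := mem_iUnion₂.1 z.2
    rwa [← hz K hK hzK.1]
  refine ⟨?_, hopen J⟩
  have : ((Subtype.val : o.boundary1 n M → Γ.Xtilde n M) ⁻¹' o.smoothStratum n M J)ᶜ =
      ⋃ (I : Finset Γ.Edge) (_ : I ≠ J), Subtype.val ⁻¹' o.smoothStratum n M I := by
    ext y
    simp only [mem_compl_iff, mem_iUnion]
    constructor
    · intro h
      obtain ⟨I, -, hyI⟩ := mem_iUnion₂.1 y.2
      exact ⟨I, fun hIJ => h (hIJ ▸ hyI), hyI⟩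
    · rintro ⟨I, hIJ, hI⟩ h
      exact Set.disjoint_left.1 (o.pairwise_disjoint_smoothStratum n M hIJ) hI h
  rw [← isOpen_compl_iff, this]
  exact isOpen_iUnion fun I => isOpen_iUnion fun _ => hopen I

theorem connectedComponentIn_boundary1_subset [T2Space M] {J : Finset Γ.Edge} (hJ : J.Nonempty)
    {y : Γ.Xtilde n M} (hy : y ∈ o.smoothStratum n M J) :
    connectedComponentIn (o.boundary1 n M) y ⊆ o.smoothStratum n M J := by
  have hyb := o.smoothStratum_subset_boundary1 n M hJ hy
  rw [connectedComponentIn_eq_image hyb]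
  rintro _ ⟨z, hz, rfl⟩
  exact (o.isClopen_smoothStratum n M J).connectedComponent_subset (x := ⟨y, hyb⟩) hy hz

theorem conf_eq : o.conf n M = o.smoothPart n M ∪ o.sing n M := by
  refine Subset.antisymm (fun y hy => ?_) (union_subset (union_subset inter_subset_left
    (iUnion₂_subset fun J _ => sdiff_subset.trans inter_subset_left)) inter_subset_left)
  by_cases hs : y ∈ o.sing n M
  · exact Or.inr hs
  obtain ⟨J, hJ⟩ := exists_mem_edgeStratum (blowdown y)
  rcases J.eq_empty_or_nonempty with rfl | hne
  · exact Or.inl (Or.inl ⟨hy, hJ⟩)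
  · exact Or.inl (o.smoothStratum_subset_smoothPart n M hne ⟨⟨hy, hJ⟩, hs⟩)

variable [IsManifold (𝓡 n) ∞ M] [T2Space M] [NeZero n] [CompactSpace M]

theorem disjoint_smoothPart_sing : Disjoint (o.smoothPart n M) (o.sing n M) := by
  refine Set.disjoint_left.2 fun y h hs => ?_
  rcases h with h | h
  · obtain ⟨J, hJ, hyJ⟩ := o.exists_mem_edgeStratum_of_mem_sing n M hs
    exact hJ.ne_empty (eq_of_mem_edgeStratum hyJ h.2)
  · obtain ⟨J, -, hyJ⟩ := mem_iUnion₂.1 h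
    exact hyJ.2 hs

theorem isCompact_conf : IsCompact (o.conf n M) := by
  have := DiagBlowup.compactSpace (n := n) (M := M)
  exact (o.isClosed_conf n M).isCompact

/-- The components of the boundary are open in its strata, which are locally connected. -/
theorem isSubmanifold_connectedComponentIn {J : Finset Γ.Edge} (hJ : J.Nonempty)
    {y : Γ.Xtilde n M} (hy : y ∈ o.smoothStratum n M J) :
    (Γ.blowupCharts n M).IsSubmanifold (connectedComponentIn (o.boundary1 n M) y)
      (Γ.confDim n - 1) := by
  have hS := isSmooth_blowupCharts Γ n M
  have hsub := o.connectedComponentIn_boundary1_subset n M hJ hy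
  have hAB := o.smoothStratum_subset_boundary1 n M hJ
  refine hS.isSubmanifold fun p hp => ?_
  have hpA := hsub hp
  obtain ⟨D, hD⟩ := exists_subsetChart_smoothStratum hJ hpA
  obtain ⟨_, -⟩ := o.exists_chartedSpace_smoothStratum n M hJ
  have := ChartedSpace.locallyConnectedSpace (EuclideanSpace ℝ (Fin (Γ.confDim n - 1)))
    (o.smoothStratum n M J)
  obtain ⟨Ω, hΩ, hΩeq⟩ := isOpen_induced_iff.1
    (isOpen_connectedComponent (x := (⟨p, hpA⟩ : o.smoothStratum n M J)))
  have hΩsub : o.smoothStratum n M J ∩ Ω ⊆ connectedComponentIn (o.boundary1 n M) y := by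
    rw [connectedComponentIn_eq hp]
    rintro z ⟨hz, hzΩ⟩
    refine (isPreconnected_connectedComponent.image Subtype.val
      continuous_subtype_val.continuousOn).subset_connectedComponentIn
      (mem_image_of_mem _ (mem_connectedComponent (x := (⟨p, hpA⟩ : o.smoothStratum n M J))))
      (by rintro _ ⟨w, -, rfl⟩; exact hAB w.2) ⟨⟨z, hz⟩, ?_, rfl⟩
    exact hΩeq.subset hzΩ
  obtain ⟨D', hD', -, -⟩ := ChartSystem.SubsetChart.exists_of_inter_eq hS D hΩ
    (A' := connectedComponentIn (o.boundary1 n M) y) (Subset.antisymm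
      (fun z hz => ⟨hΩsub hz, hz.2⟩) (inter_subset_inter_left _ hsub))
  refine ⟨D', hD' ▸ ⟨hD, ?_⟩⟩
  have : (⟨p, hpA⟩ : o.smoothStratum n M J) ∈ Subtype.val ⁻¹' Ω :=
    hΩeq.symm ▸ mem_connectedComponent
  exact this

end EdgeOrientation

end RibbonGraph

theorem mainTheorem5 {F : Type*} [Finite F] (Γ : RibbonGraph F) (hΓ : Γ.IsTrivalent)
    (o : Γ.EdgeOrientation) (n : ℕ) [NeZero n]
    (M : Type*) [TopologicalSpace M] [CompactSpace M] [T2Space M]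
    [ChartedSpace (EuclideanSpace ℝ (Fin n)) M] [IsManifold (𝓡 n) ∞ M] :
    -- compactness and the decomposition into open stratum, boundary and singular part
    IsCompact (o.conf n M) ∧
    o.conf n M = o.smoothPart n M ∪ o.sing n M ∧
    Disjoint (o.smoothPart n M) (o.sing n M) ∧
    Disjoint (o.stratum n M ∅) (o.boundary1 n M) ∧
    o.stratum n M ∅ = RibbonGraph.blowdown ⁻¹' (o.vertexDiagonal M \ Γ.edgeDiagonal M) ∧
    IsClosed (o.sing n M) ∧
    (Γ.blowupCharts n M).CodimAtLeast (o.sing n M) (Γ.confDim n) 2 ∧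
    -- main and hidden faces
    o.boundary1 n M = (⋃ l : Γ.Edge, o.mainFace n M l) ∪ o.hiddenBoundary n M ∧
    Disjoint (⋃ l : Γ.Edge, o.mainFace n M l) (o.hiddenBoundary n M) ∧
    Pairwise (Function.onFun Disjoint (o.mainFace n M)) ∧
    Pairwise (Function.onFun Disjoint (o.smoothStratum n M)) ∧
    -- the open stratum and the components of the boundary are submanifolds
    (Γ.blowupCharts n M).IsSubmanifold (o.stratum n M ∅) (Γ.confDim n) ∧
    o.stratum n M ∅ ⊆ Γ.cornerStratum n M 0 ∧
    (∀ y ∈ o.boundary1 n M, ∃ m : ℕ, 0 < m ∧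
      connectedComponentIn (o.boundary1 n M) y ⊆ Γ.cornerStratum n M m ∧
      (Γ.blowupCharts n M).IsSubmanifold (connectedComponentIn (o.boundary1 n M) y)
        (Γ.confDim n - 1)) ∧
    (∀ J : Finset Γ.Edge, J.Nonempty →
      IsClopen ((Subtype.val : o.boundary1 n M → Γ.Xtilde n M) ⁻¹' o.smoothStratum n M J)) ∧
    -- characterization of the smooth points of a stratum
    (∀ J : Finset Γ.Edge, J.Nonempty → ∀ φ ∈ IsManifold.maximalAtlas (𝓡 n) ∞ M,
      ∀ y ∈ (Γ.blowupCharts n M).dom φ,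
      RibbonGraph.blowdown y ∈ o.vertexDiagonal M ∩ RibbonGraph.edgeStratum M J →
      (y ∈ o.smoothStratum n M J ↔ ∃! x, o.IsSolution φ J y x)) ∧
    -- the smooth part is a manifold with boundary
    ∃ _ : ChartedSpace (EuclideanHalfSpace (Γ.confDim n)) (o.smoothPart n M),
      IsManifold (𝓡∂ (Γ.confDim n)) ∞ (o.smoothPart n M) ∧
      (Γ.blowupCharts n M).Immersion (𝓡∂ (Γ.confDim n))
        (Subtype.val : o.smoothPart n M → Γ.Xtilde n M) ∧
      (𝓡∂ (Γ.confDim n)).interior (o.smoothPart n M) = Subtype.val ⁻¹' o.stratum n M ∅ ∧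
      (𝓡∂ (Γ.confDim n)).boundary (o.smoothPart n M) = Subtype.val ⁻¹' o.boundary1 n M ∧
      ∀ J : Finset Γ.Edge, J.Nonempty →
        ∃ _ : ChartedSpace (EuclideanSpace ℝ (Fin (Γ.confDim n - 1))) (o.smoothStratum n M J),
          IsManifold (𝓡 (Γ.confDim n - 1)) ∞ (o.smoothStratum n M J) ∧
          (Γ.blowupCharts n M).Immersion (𝓡 (Γ.confDim n - 1))
            (Subtype.val : o.smoothStratum n M J → Γ.Xtilde n M) ∧
          -- the blow-down map is a submersion onto its image
          (∃ (m : ℕ) (_ : ChartedSpace (EuclideanSpace ℝ (Fin m))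
              (RibbonGraph.blowdown '' o.smoothStratum n M J)),
            IsManifold (𝓡 m) ∞ (RibbonGraph.blowdown '' o.smoothStratum n M J) ∧
            (Γ.baseCharts n M).Immersion (𝓡 m)
              (Subtype.val : RibbonGraph.blowdown '' o.smoothStratum n M J → Γ.X M) ∧
            ContMDiff (𝓡 (Γ.confDim n - 1)) (𝓡 m) ∞
              (imageFactorization RibbonGraph.blowdown (o.smoothStratum n M J)) ∧
            ∀ p, Function.Surjective (mfderiv (𝓡 (Γ.confDim n - 1)) (𝓡 m)
              (imageFactorization RibbonGraph.blowdown (o.smoothStratum n M J)) p)) ∧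
          -- boundary charts defined by the unique solutions
          ∀ y : o.smoothStratum n M J, ∀ φ ∈ IsManifold.maximalAtlas (𝓡 n) ∞ M,
            y.1 ∈ (Γ.blowupCharts n M).dom φ → ∀ a ∈ o.vertOf J,
            ∃ β : PartialDiffeomorph ((𝓡∂ 1).prod (𝓡 (Γ.confDim n - 1))) (𝓡∂ (Γ.confDim n))
                (EuclideanHalfSpace 1 × o.smoothStratum n M J) (o.smoothPart n M) ∞,
              (0, y) ∈ β.source ∧
              ∀ q ∈ β.source,
                o.IsBoundaryChartValue φ J a (q.1.1 0) q.2.1 (β.toFun q).1 := by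
  have hS := RibbonGraph.isSmooth_blowupCharts Γ n M
  refine ⟨o.isCompact_conf n M, o.conf_eq n M, o.disjoint_smoothPart_sing n M,
    o.disjoint_stratum_boundary1 n M, o.stratum_empty n M, o.isClosed_sing n M,
    o.codimAtLeast_sing n M, o.boundary1_eq n M, o.disjoint_mainFace_hiddenBoundary n M,
    o.pairwise_disjoint_mainFace n M, o.pairwise_disjoint_smoothStratum n M,
    o.isSubmanifold_stratum_empty n M, o.stratum_subset_cornerStratum n M ∅, fun y hy => ?_,
    fun J _ => o.isClopen_smoothStratum n M J, fun J hJ φ hφ y hy hyJ => ?_, ?_⟩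
  · obtain ⟨J, hJ, hyJ⟩ := mem_iUnion₂.1 hy
    exact ⟨J.card, hJ.card_pos, (o.connectedComponentIn_boundary1_subset n M hJ hyJ).trans
      (sdiff_subset.trans (o.stratum_subset_cornerStratum n M J)),
      o.isSubmanifold_connectedComponentIn n M hJ hyJ⟩
  · rw [RibbonGraph.EdgeOrientation.mem_smoothStratum_iff hφ hy hJ hyJ,
      RibbonGraph.EdgeOrientation.existsUnique_isSolution_iff hφ hy hJ]
  · obtain ⟨cs, hA, hint, hbd⟩ := o.exists_chartedSpace_smoothPart n M
    refine ⟨cs, hA.isManifold, hA.immersion, hint, hbd, fun J hJ => ?_⟩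
    obtain ⟨cs', hB⟩ := o.exists_chartedSpace_smoothStratum n M hJ
    refine ⟨cs', hB.isManifold, hB.immersion,
      RibbonGraph.EdgeOrientation.exists_chartedSpace_image hJ hB, fun y φ hφ hy a ha => ?_⟩
    obtain ⟨W, -, C, hV, hval⟩ :=
      RibbonGraph.EdgeOrientation.exists_collarChart hφ hJ y.2 hy ha
    obtain ⟨β, hβ, h⟩ := C.exists_partialDiffeomorph hJ hφ hA hB y hy hV
    refine ⟨β, hβ, fun q hq => ?_⟩
    obtain ⟨w, h1, h2, h3, h4, h5, h6⟩ := h q hq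
    exact hval _ w h1 h2 q.1.2 _ h3 _ h4 h5 h6
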